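/- For $c\in[1,\infty]$ let $d_c$ denote the $L_c$ metric on $\mathbb{R}^2$. For sequences $P=(p_1,\dots,p_n)$ and $Q=(q_1,\dots,q_m)$ of points in the plane ($n,m\ge 1$; the vertices of two polygonal curves), the discrete Fréchet distance under $L_c$ is $$D_F(P,Q)=\min_F\ \max_{(i,j)\in F} d_c(p_i,q_j),$$ where $F$ ranges over all monotone walks from $(1,1)$ to $(n,m)$, i.e. finite sequences of index pairs in which, at each step, each of the two indices stays the same or grows by one. For $\gamma,\varepsilon>0$ and an integer $\delta\ge 0$, the curve $Q$ is an $(\varepsilon,\delta)$-curve (with edge length bound $\gamma$) if all its edges $q_jq_{j+1}$ have Euclidean length at most $\gamma$ and every point of the plane lies in at most $\delta$ of the Euclidean balls of radius $\varepsilon$ centred at $q_1,\dots,q_m$ (balls of different vertices are counted separately, even if the vertices coincide). Theorem. Fix a constant $\gamma>0$. There is an algorithm, i.e. a fixed program for the real RAM (unit-cost exact arithmetic and comparisons on reals; indirectly addressed memory; addition, subtraction and comparison of integers; no rounding of reals to integers; evaluation of the $L_c$ norm of a vector in unit time), and there are constants $C$ and $k$, depending only on $\gamma$, such that the following holds for every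 $c\in[1,\infty]$, every $\varepsilon\in(0,1)$, all $n,m\ge 1$ and every $\delta$. If $P$ has $n$ vertices and all its edges have Euclidean length at most $\gamma$, and if $Q$ is an $(\varepsilon,\delta)$-curve with $m$ vertices, then on input $(P,Q,\varepsilon)$ (without $\delta$) the algorithm halts after at most $$C\cdot\frac{\sqrt{\delta}}{\varepsilon^{1.5}}\,(n+m)^{1.5}\,\log^k(n+m)$$ steps and outputs a $(1+\varepsilon)$-approximation of $D_F(P,Q)$ under $L_c$, i.e. a real number $v$ with $D_F(P,Q)\le v\le(1+\varepsilon)\,D_F(P,Q)$. In other words, a $(1+\varepsilon)$-approximation of $D_F(P,Q)$ under any $L_c$ metric can be computed in $\tilde O\big(\tfrac{\sqrt\delta}{\varepsilon^{1.5}}(n+m)^{1.5}\big)$ time. -/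

import Mathlib

open scoped ENNReal

noncomputable section

/-- The plane; `dist` on it is the Euclidean distance. -/
abbrev Plane : Type := EuclideanSpace ℝ (Fin 2)

/-- The `L_c` norm of the vector `(x, y)`. -/
def lcNorm (c : ℝ≥0∞) (x y : ℝ) : ℝ :=
  ‖(WithLp.toLp c ![x, y] : PiLp c (fun _ : Fin 2 => ℝ))‖

/-- The `L_c` distance of two points of the plane. -/
def lcDist (c : ℝ≥0∞) (p q : Plane) : ℝ :=
  lcNorm c (p 0 - q 0) (p 1 - q 1)

/-! ### Curves and the discrete Fréchet distance -/

/-- A monotone walk from the first to the last cell of an `n × m` grid (indices start at `0`):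
in every step each of the two indices either stays or grows by one. -/
structure MonotoneWalk (n m : ℕ) where
  steps : ℕ
  cell : Fin (steps + 1) → Fin n × Fin m
  start_fst : ((cell 0).1 : ℕ) = 0
  start_snd : ((cell 0).2 : ℕ) = 0
  step_fst : ∀ i : Fin steps, ((cell i.succ).1 : ℕ) = ((cell i.castSucc).1 : ℕ) ∨
    ((cell i.succ).1 : ℕ) = ((cell i.castSucc).1 : ℕ) + 1
  step_snd : ∀ i : Fin steps, ((cell i.succ).2 : ℕ) = ((cell i.castSucc).2 : ℕ) ∨
    ((cell i.succ).2 : ℕ) = ((cell i.castSucc).2 : ℕ) + 1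
  finish_fst : ((cell (Fin.last steps)).1 : ℕ) + 1 = n
  finish_snd : ((cell (Fin.last steps)).2 : ℕ) + 1 = m

/-- The cost of a walk: the largest `L_c` distance `d(p_i, q_j)` over its cells `(i, j)`. -/
def walkCost (c : ℝ≥0∞) {n m : ℕ} (P : Fin n → Plane) (Q : Fin m → Plane)
    (F : MonotoneWalk n m) : ℝ :=
  Finset.univ.sup' Finset.univ_nonempty
    (fun i : Fin (F.steps + 1) => lcDist c (P (F.cell i).1) (Q (F.cell i).2))

/-- The discrete Fréchet distance under `L_c`: the least cost of a monotone walk. -/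
def discreteFrechet (c : ℝ≥0∞) {n m : ℕ} (P : Fin n → Plane) (Q : Fin m → Plane) : ℝ :=
  ⨅ F : MonotoneWalk n m, walkCost c P Q F

/-- All edges of the polygonal curve with vertices `P 0, …, P (n - 1)` have length at most `γ`. -/
def EdgesAtMost (γ : ℝ) {n : ℕ} (P : Fin n → Plane) : Prop :=
  ∀ (i : ℕ) (h : i + 1 < n), dist (P ⟨i, by omega⟩) (P ⟨i + 1, h⟩) ≤ γ

/-- `(ε, δ)`-curves (for the edge length bound `γ`): every point of the plane lies in at most `δ`
of the Euclidean balls of radius `ε` around the vertices. Vertices at the same place are counted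
separately. -/
def IsEpsDeltaCurve (γ ε : ℝ) (δ : ℕ) {m : ℕ} (Q : Fin m → Plane) : Prop :=
  EdgesAtMost γ Q ∧ ∀ x : Plane, {j : Fin m | x ∈ Metric.closedBall (Q j) ε}.ncard ≤ δ

/-! ### The real RAM

A uniform unit-cost machine model, written as structured programs. The memory has variables and
unbounded arrays, both for natural numbers and for real numbers. Natural numbers (used as
counters and addresses) can be added, subtracted and compared, and converted to reals; real
numbers admit exact field operations, comparisons and the evaluation of the `L_c` norm. There is
no way to round a real number to an integer. The text of a program is fixed, so that it names
finitely many variables and arrays. -/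

namespace RealRAM

/-- The contents of the memory. -/
structure State where
  natVar : ℕ → ℕ
  realVar : ℕ → ℝ
  natArr : ℕ → ℕ → ℕ
  realArr : ℕ → ℕ → ℝ

/-- Expressions for natural numbers; `get a e` reads the array named `a` at index `e`. -/
inductive NatExpr where
  | lit (k : ℕ)
  | var (x : ℕ)
  | get (a : ℕ) (e : NatExpr)
  | add (e₁ e₂ : NatExpr)
  | sub (e₁ e₂ : NatExpr)

/-- Expressions for real numbers. -/
inductive RealExpr where
  | ofNat (e : NatExpr)
  | var (x : ℕ)
  | get (a : ℕ) (e : NatExpr)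
  | add (e₁ e₂ : RealExpr)
  | sub (e₁ e₂ : RealExpr)
  | mul (e₁ e₂ : RealExpr)
  | div (e₁ e₂ : RealExpr)
  | norm (e₁ e₂ : RealExpr)

/-- Tests. -/
inductive Test where
  | natLe (e₁ e₂ : NatExpr)
  | realLe (e₁ e₂ : RealExpr)
  | not (b : Test)
  | and (b₁ b₂ : Test)

/-- Programs. -/
inductive Program where
  | skip
  | setNat (x : ℕ) (e : NatExpr)
  | setReal (x : ℕ) (e : RealExpr)
  | storeNat (a : ℕ) (i : NatExpr) (e : NatExpr)
  | storeReal (a : ℕ) (i : NatExpr) (e : RealExpr)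
  | seq (A B : Program)
  | ite (b : Test) (A B : Program)
  | while (b : Test) (A : Program)

/-- The value of an expression; subtraction of natural numbers is truncated at `0`. -/
def NatExpr.eval (s : State) : NatExpr → ℕ
  | lit k => k
  | var x => s.natVar x
  | get a e => s.natArr a (e.eval s)
  | add e₁ e₂ => e₁.eval s + e₂.eval s
  | sub e₁ e₂ => e₁.eval s - e₂.eval s

/-- The value of an expression; division by zero returns `0`. -/
def RealExpr.eval (c : ℝ≥0∞) (s : State) : RealExpr → ℝ
  | ofNat e => (e.eval s : ℝ)
  | var x => s.realVar x
  | get a e => s.realArr a (e.eval s)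
  | add e₁ e₂ => e₁.eval c s + e₂.eval c s
  | sub e₁ e₂ => e₁.eval c s - e₂.eval c s
  | mul e₁ e₂ => e₁.eval c s * e₂.eval c s
  | div e₁ e₂ => e₁.eval c s / e₂.eval c s
  | norm e₁ e₂ => lcNorm c (e₁.eval c s) (e₂.eval c s)

/-- The truth value of a test. -/
def Test.Holds (c : ℝ≥0∞) (s : State) : Test → Prop
  | natLe e₁ e₂ => e₁.eval s ≤ e₂.eval s
  | realLe e₁ e₂ => e₁.eval c s ≤ e₂.eval c s
  | not b => ¬ b.Holds c s
  | and b₁ b₂ => b₁.Holds c s ∧ b₂.Holds c s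

/-- The number of operations in the evaluation of an expression. -/
def NatExpr.cost : NatExpr → ℕ
  | lit _ => 1
  | var _ => 1
  | get _ e => e.cost + 1
  | add e₁ e₂ => e₁.cost + e₂.cost + 1
  | sub e₁ e₂ => e₁.cost + e₂.cost + 1

/-- The number of operations in the evaluation of an expression. -/
def RealExpr.cost : RealExpr → ℕ
  | ofNat e => e.cost + 1
  | var _ => 1
  | get _ e => e.cost + 1
  | add e₁ e₂ => e₁.cost + e₂.cost + 1
  | sub e₁ e₂ => e₁.cost + e₂.cost + 1
  | mul e₁ e₂ => e₁.cost + e₂.cost + 1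
  | div e₁ e₂ => e₁.cost + e₂.cost + 1
  | norm e₁ e₂ => e₁.cost + e₂.cost + 1

/-- The number of operations in the evaluation of a test. -/
def Test.cost : Test → ℕ
  | natLe e₁ e₂ => e₁.cost + e₂.cost + 1
  | realLe e₁ e₂ => e₁.cost + e₂.cost + 1
  | not b => b.cost + 1
  | and b₁ b₂ => b₁.cost + b₂.cost + 1

/-- Assignment to a natural number variable. -/
def State.setNat (s : State) (x v : ℕ) : State :=
  { s with natVar := Function.update s.natVar x v }

/-- Assignment to a real variable. -/
def State.setReal (s : State) (x : ℕ) (v : ℝ) : State :=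
  { s with realVar := Function.update s.realVar x v }

/-- Assignment to a cell of a natural number array. -/
def State.storeNat (s : State) (a i v : ℕ) : State :=
  { s with natArr := Function.update s.natArr a (Function.update (s.natArr a) i v) }

/-- Assignment to a cell of a real array. -/
def State.storeReal (s : State) (a i : ℕ) (v : ℝ) : State :=
  { s with realArr := Function.update s.realArr a (Function.update (s.realArr a) i v) }

/-- `Runs c A s T s'`: started in the memory `s`, on a machine that evaluates the `L_c` norm, the
program `A` halts after exactly `T` operations and leaves the memory `s'`. -/
inductive Runs (c : ℝ≥0∞) : Program → State → ℕ → State → Prop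
  | skip (s : State) : Runs c .skip s 1 s
  | setNat (s : State) (x : ℕ) (e : NatExpr) :
      Runs c (.setNat x e) s (e.cost + 1) (s.setNat x (e.eval s))
  | setReal (s : State) (x : ℕ) (e : RealExpr) :
      Runs c (.setReal x e) s (e.cost + 1) (s.setReal x (e.eval c s))
  | storeNat (s : State) (a : ℕ) (i e : NatExpr) :
      Runs c (.storeNat a i e) s (i.cost + e.cost + 1) (s.storeNat a (i.eval s) (e.eval s))
  | storeReal (s : State) (a : ℕ) (i : NatExpr) (e : RealExpr) :
      Runs c (.storeReal a i e) s (i.cost + e.cost + 1) (s.storeReal a (i.eval s) (e.eval c s))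
  | seq {A B : Program} {s s' s'' : State} {T T' : ℕ} :
      Runs c A s T s' → Runs c B s' T' s'' → Runs c (.seq A B) s (T + T') s''
  | ite_true {b : Test} {A B : Program} {s s' : State} {T : ℕ} :
      b.Holds c s → Runs c A s T s' → Runs c (.ite b A B) s (b.cost + 1 + T) s'
  | ite_false {b : Test} {A B : Program} {s s' : State} {T : ℕ} :
      ¬ b.Holds c s → Runs c B s T s' → Runs c (.ite b A B) s (b.cost + 1 + T) s'
  | while_true {b : Test} {A : Program} {s s' s'' : State} {T T' : ℕ} :
      b.Holds c s → Runs c A s T s' → Runs c (.while b A) s' T' s'' →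
        Runs c (.while b A) s (b.cost + 1 + T + T') s''
  | while_false {b : Test} {A : Program} {s : State} :
      ¬ b.Holds c s → Runs c (.while b A) s (b.cost + 1) s

/-- The initial memory: `n` and `m` in the natural variables `0` and `1`, `ε` in the real variable
`0`, the coordinates of the vertices of `P` in the real arrays `0`, `1`, those of `Q` in the real
arrays `2`, `3`, and zeros everywhere else. -/
def input {n m : ℕ} (P : Fin n → Plane) (Q : Fin m → Plane) (ε : ℝ) : State where
  natVar x := if x = 0 then n else if x = 1 then m else 0
  realVar x := if x = 0 then ε else 0
  natArr _ _ := 0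
  realArr a i :=
    if a = 0 then (if h : i < n then P ⟨i, h⟩ 0 else 0)
    else if a = 1 then (if h : i < n then P ⟨i, h⟩ 1 else 0)
    else if a = 2 then (if h : i < m then Q ⟨i, h⟩ 0 else 0)
    else if a = 3 then (if h : i < m then Q ⟨i, h⟩ 1 else 0)
    else 0

/-- The output of a computation is the final content of the real variable `0`. -/
def State.output (s : State) : ℝ := s.realVar 0

end RealRAM

end

noncomputable section

/-! Moving one index by one changes d(p_i, q_j) by at most ℓ = 2γ, whatever c is. This is used twice
when deciding, up to a factor 1 + ε, whether the Fréchet distance is at most μ. First, only every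
g-th vertex of P (a row of the grid) is examined, where g is a power of two of order max(1, εμ/L),
capped near n, and L ≥ 8ℓ is a constant: the skipped rows differ from examined ones by at most εμ/8
(`reach_coarsen`, `reach_refine`). Second, in an examined row, a cell whose distance misses the
threshold D = μ + εμ/8 by x permits a jump over about x/L columns, all on the same side of D
(`le_iff_of_jump`). So the reachable cells of a row form at most one interval per jump, and the
intervals are merged from those of the previous row with one moving pointer (`reach_segment`,
`IntervalList.first_entry`).

Counting jumps: a jump of length 2^κ within the row passes only cells that miss D by at most h =
3L·2^κ, so a row needs at most 1 + ∑ 2^(-κ) · #{cells that miss D by at most 3L·2^κ} jumps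
(`jumpPotential_jump`). These cells are vertices of Q in an L_c annulus, which contains O(δ(D +
h)h/ε²) of them (`card_annulus_le`). There are also at most m of them, and the geometric mean of the
two bounds gives O(√(mδ(D + 1))/ε) per level κ (`jumpPotential_gridDist_le`). Unless a single row
remains, the number R of examined rows satisfies R√(D + 1) = O(n/√ε) (`rowCount_sq_le`).
Multiplying, one decision costs √δ·n√m/ε^1.5 up to logarithms (`mul_min_le_timeBound`).

Distances of at most ε, where bisection has no positive lower end to start from, are found exactly
by a dynamic program that stops at every cell of value at most ε and jumps only from other cells
(`exec_sparseDP`). Otherwise bisection takes O(log((n + m)/ε)) decisions (`exec_searchLoop`). The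
factor log(1/ε) is not a power of log(n + m), but it is absorbed because the number of jumps is also
at most (n + m)² (`min_mul_log_le`). The three logarithms of the final bound come from the levels κ,
from finding jump lengths by doubling, and from bisection. -/

/-! ### Geometry of the L_c norms, uniformly in c. -/

theorem lcNorm_top (x y : ℝ) : lcNorm ∞ x y = max |x| |y| := by
  unfold lcNorm
  rw [PiLp.norm_eq_ciSup]
  apply le_antisymm
  · refine ciSup_le fun i => ?_
    fin_cases i <;> simp
  · have hb := Set.finite_range fun i : Fin 2 =>
      ‖(WithLp.toLp ∞ ![x, y] : PiLp ∞ (fun _ : Fin 2 => ℝ)) i‖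
    exact max_le (by simpa using le_ciSup hb.bddAbove 0) (by simpa using le_ciSup hb.bddAbove 1)

theorem lcNorm_of_ne_top {c : ℝ≥0∞} (hc : 1 ≤ c) (hc' : c ≠ ∞) (x y : ℝ) :
    lcNorm c x y = (|x| ^ c.toReal + |y| ^ c.toReal) ^ (1 / c.toReal) := by
  unfold lcNorm
  rw [PiLp.norm_eq_sum (ENNReal.toReal_pos (by positivity) hc')]
  simp [Fin.sum_univ_two]

theorem lcNorm_nonneg {c : ℝ≥0∞} (hc : 1 ≤ c) (x y : ℝ) : 0 ≤ lcNorm c x y := by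
  have : Fact (1 ≤ c) := ⟨hc⟩
  exact norm_nonneg (WithLp.toLp c ![x, y] : PiLp c (fun _ : Fin 2 => ℝ))

theorem lcNorm_add_le {c : ℝ≥0∞} (hc : 1 ≤ c) (x y x' y' : ℝ) :
    lcNorm c (x + x') (y + y') ≤ lcNorm c x y + lcNorm c x' y' := by
  have : Fact (1 ≤ c) := ⟨hc⟩
  have h := norm_add_le (WithLp.toLp c ![x, y] : PiLp c (fun _ : Fin 2 => ℝ))
    (WithLp.toLp c ![x', y'])
  rw [← WithLp.toLp_add] at h
  simpa [lcNorm] using h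

theorem lcNorm_smul {c : ℝ≥0∞} (hc : 1 ≤ c) (a x y : ℝ) :
    lcNorm c (a * x) (a * y) = |a| * lcNorm c x y := by
  have : Fact (1 ≤ c) := ⟨hc⟩
  have h := norm_smul a (WithLp.toLp c ![x, y] : PiLp c (fun _ : Fin 2 => ℝ))
  rw [← WithLp.toLp_smul] at h
  simpa [lcNorm] using h

theorem abs_fst_le_lcNorm {c : ℝ≥0∞} (hc : 1 ≤ c) (x y : ℝ) : |x| ≤ lcNorm c x y := by
  have : Fact (1 ≤ c) := ⟨hc⟩
  simpa [lcNorm] using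
    PiLp.norm_apply_le (WithLp.toLp c ![x, y] : PiLp c (fun _ : Fin 2 => ℝ)) 0

theorem abs_snd_le_lcNorm {c : ℝ≥0∞} (hc : 1 ≤ c) (x y : ℝ) : |y| ≤ lcNorm c x y := by
  have : Fact (1 ≤ c) := ⟨hc⟩
  simpa [lcNorm] using
    PiLp.norm_apply_le (WithLp.toLp c ![x, y] : PiLp c (fun _ : Fin 2 => ℝ)) 1

theorem lcNorm_abs {c : ℝ≥0∞} (hc : 1 ≤ c) (x y : ℝ) : lcNorm c |x| |y| = lcNorm c x y := by
  by_cases h : c = ∞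
  · subst h; simp [lcNorm_top]
  · simp [lcNorm_of_ne_top hc h]

theorem lcNorm_mono {c : ℝ≥0∞} (hc : 1 ≤ c) {x y x' y' : ℝ} (hx : |x| ≤ |x'|) (hy : |y| ≤ |y'|) :
    lcNorm c x y ≤ lcNorm c x' y' := by
  by_cases h : c = ∞
  · subst h; simp only [lcNorm_top]; exact max_le_max hx hy
  · simp only [lcNorm_of_ne_top hc h]
    gcongr

theorem lcNorm_le_add {c : ℝ≥0∞} (hc : 1 ≤ c) (x y : ℝ) : lcNorm c x y ≤ |x| + |y| := by
  have h1 : lcNorm c 1 0 = 1 := by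
    by_cases h : c = ∞
    · subst h; simp [lcNorm_top]
    · have : c.toReal ≠ 0 := (ENNReal.toReal_pos (by positivity) h).ne'
      simp [lcNorm_of_ne_top hc h, this]
  have h2 : lcNorm c 0 1 = 1 := by
    by_cases h : c = ∞
    · subst h; simp [lcNorm_top]
    · have : c.toReal ≠ 0 := (ENNReal.toReal_pos (by positivity) h).ne'
      simp [lcNorm_of_ne_top hc h, this]
  have h := lcNorm_add_le hc (x * 1) (x * 0) (y * 0) (y * 1)
  rw [lcNorm_smul hc, lcNorm_smul hc, h1, h2] at h
  simpa using h

/-- In the positive quadrant every `L_c` norm grows at least at unit rate along the diagonal. -/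
theorem lcNorm_add_diagonal {c : ℝ≥0∞} (hc : 1 ≤ c) {x y τ : ℝ} (hx : 0 ≤ x) (hy : 0 ≤ y)
    (hτ : 0 ≤ τ) : lcNorm c x y + τ ≤ lcNorm c (x + τ) (y + τ) := by
  set N := lcNorm c x y with hN
  have hxN : x ≤ N := (le_abs_self x).trans (abs_fst_le_lcNorm hc x y)
  have hyN : y ≤ N := (le_abs_self y).trans (abs_snd_le_lcNorm hc x y)
  rcases (lcNorm_nonneg hc x y).eq_or_lt with h0 | h0
  · rw [← hN] at h0
    rw [← h0, zero_add]
    calc τ ≤ |x + τ| := by rw [abs_of_nonneg (by positivity)]; linarith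
      _ ≤ _ := abs_fst_le_lcNorm hc _ _
  · rw [← hN] at h0
    -- Scaling by 1 + τ/N lengthens the vector by exactly τ, and raises each coordinate by at most τ
    -- because coordinates are at most N.
    have key : lcNorm c ((1 + τ / N) * x) ((1 + τ / N) * y) = N + τ := by
      rw [lcNorm_smul hc, abs_of_nonneg (by positivity), ← hN]
      field_simp
    rw [← key]
    have aux : ∀ z : ℝ, 0 ≤ z → z ≤ N → |(1 + τ / N) * z| ≤ |z + τ| := by
      intro z hz hzN
      rw [abs_of_nonneg (by positivity), abs_of_nonneg (by positivity)]
      have : τ / N * z ≤ τ := by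
        rw [div_mul_eq_mul_div, div_le_iff₀ h0]; gcongr
      linarith
    exact lcNorm_mono hc (aux x hx hxN) (aux y hy hyN)

theorem lcNorm_sub_le_abs {c : ℝ≥0∞} (hc : 1 ≤ c) (x y x' y' : ℝ) :
    lcNorm c x y - lcNorm c x' y' ≤ |x - x'| + |y - y'| := by
  have h := lcNorm_add_le hc (x - x') (y - y') x' y'
  rw [sub_add_cancel, sub_add_cancel] at h
  linarith [lcNorm_le_add hc (x - x') (y - y')]

/-- Two points of the positive quadrant that agree up to `η` in the difference of their coordinates
and in their norm are close. -/
theorem abs_sub_le_of_lcNorm_close {c : ℝ≥0∞} (hc : 1 ≤ c) {x y x' y' η : ℝ} (hx : 0 ≤ x)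
    (hy : 0 ≤ y) (hx' : 0 ≤ x') (hy' : 0 ≤ y') (hu : |(x - y) - (x' - y')| ≤ η)
    (hv : |lcNorm c x y - lcNorm c x' y'| ≤ η) : |x - x'| ≤ 3 * η ∧ |y - y'| ≤ 2 * η := by
  wlog h : y' ≤ y generalizing x y x' y'
  · rw [abs_sub_comm] at hu hv
    have := this hx' hy' hx hy hu hv (by linarith)
    rwa [abs_sub_comm x, abs_sub_comm y]
  -- Shift (x', y') along the diagonal until the second coordinates agree. The norm grows by at
  -- least y - y'. The first coordinates now differ by at most η, so the norm is within η of that of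
  -- (x, y).
  have h1 := lcNorm_add_diagonal hc hx' hy' (sub_nonneg.2 h)
  have h2 := lcNorm_sub_le_abs hc (x' + (y - y')) (y' + (y - y')) x y
  have e1 : x' + (y - y') - x = -((x - y) - (x' - y')) := by ring
  have e2 : y' + (y - y') - y = 0 := by ring
  rw [e1, e2, abs_neg, abs_zero] at h2
  have h3 := abs_le.1 hv
  have h4 := abs_le.1 hu
  have h5 : y - y' ≤ 2 * η := by linarith
  exact ⟨abs_le.2 ⟨by linarith, by linarith⟩, abs_le.2 ⟨by linarith, h5⟩⟩

/-- The factor 2 serves all c at once: the L_c norm is at most the L_1 norm, and each coordinate is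
at most the Euclidean norm. -/
theorem lcDist_sub_le {c : ℝ≥0∞} (hc : 1 ≤ c) (p q q' : Plane) :
    |lcDist c p q - lcDist c p q'| ≤ 2 * dist q q' := by
  have h0 : |q 0 - q' 0| ≤ dist q q' := by
    simpa [Real.dist_eq, dist_eq_norm] using PiLp.norm_apply_le (q - q') 0
  have h1 : |q 1 - q' 1| ≤ dist q q' := by
    simpa [Real.dist_eq, dist_eq_norm] using PiLp.norm_apply_le (q - q') 1
  have e : ∀ a b d : ℝ, |a - b - (a - d)| = |b - d| := fun a b d => by
    rw [abs_sub_comm b d]; congr 1; ring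
  have k1 := lcNorm_sub_le_abs hc (p 0 - q 0) (p 1 - q 1) (p 0 - q' 0) (p 1 - q' 1)
  have k2 := lcNorm_sub_le_abs hc (p 0 - q' 0) (p 1 - q' 1) (p 0 - q 0) (p 1 - q 1)
  rw [e, e] at k1 k2
  rw [abs_sub_comm (q' 0), abs_sub_comm (q' 1)] at k2
  unfold lcDist
  exact abs_le.2 ⟨by linarith, by linarith⟩

theorem lcDist_comm {c : ℝ≥0∞} (hc : 1 ≤ c) (p q : Plane) : lcDist c p q = lcDist c q p := by
  unfold lcDist
  rw [← lcNorm_abs hc, abs_sub_comm, abs_sub_comm (p 1), lcNorm_abs hc]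

/-! ### Packing: vertices in an annulus. -/

theorem card_int_Icc_floor_le {a b : ℝ} (h : a ≤ b) :
    ((Finset.Icc ⌊a⌋ ⌊b⌋).card : ℝ) ≤ b - a + 2 := by
  rw [Int.card_Icc]
  have h1 : ⌊a⌋ ≤ ⌊b⌋ := Int.floor_le_floor h
  have h2 : ((⌊b⌋ + 1 - ⌊a⌋).toNat : ℤ) = ⌊b⌋ + 1 - ⌊a⌋ := Int.toNat_of_nonneg (by omega)
  have h3 : ((⌊b⌋ + 1 - ⌊a⌋).toNat : ℝ) = (⌊b⌋ : ℝ) + 1 - ⌊a⌋ := by exact_mod_cast h2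
  rw [h3]
  linarith [Int.floor_le b, Int.lt_floor_add_one a]

theorem abs_sub_lt_of_floor_div_eq {a b η : ℝ} (hη : 0 < η) (h : ⌊a / η⌋ = ⌊b / η⌋) :
    |a - b| ≤ η := by
  have := Int.abs_sub_lt_one_of_floor_eq_floor h
  rw [← sub_div, abs_div, abs_of_pos hη, div_lt_one hη] at this
  exact this.le

/-- The number of vertices of an `(ε, δ)`-curve in an `L_c` annulus. -/
theorem card_annulus_le {c : ℝ≥0∞} (hc : 1 ≤ c) {m : ℕ} {Q : Fin m → Plane} {γ ε : ℝ} {δ : ℕ}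
    (hε : 0 < ε) (hε1 : ε < 1) (hQ : IsEpsDeltaCurve γ ε δ Q) (p : Plane) {D h : ℝ}
    (hD : 0 ≤ D) (hh : 1 ≤ h) :
    ((Finset.univ.filter fun j : Fin m => |lcDist c p (Q j) - D| ≤ h).card : ℝ) ≤
      400 * δ * ((D + h) * h) / ε ^ 2 := by
  classical
  set S := Finset.univ.filter fun j : Fin m => |lcDist c p (Q j) - D| ≤ h
  -- In each quadrant around p, the coordinates |X| - |Y| and the L_c norm are cut into a grid of
  -- width ε/4. Points of one cell differ by at most 3η and 2η in X and Y, hence have Euclidean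
  -- distance at most √13·ε/4 < ε. So a cell contains at most δ vertices.
  set η := ε / 4 with hη
  have hη0 : 0 < η := by positivity
  let X : Fin m → ℝ := fun j => p 0 - Q j 0
  let Y : Fin m → ℝ := fun j => p 1 - Q j 1
  let F : Fin m → (Bool × Bool) × (ℤ × ℤ) := fun j =>
    ((decide (0 ≤ X j), decide (0 ≤ Y j)), (⌊(|X j| - |Y j|) / η⌋, ⌊lcDist c p (Q j) / η⌋))
  have hfib : ∀ a ∈ S.image F, (S.filter fun x => F x = a).card ≤ δ := by
    intro a ha
    obtain ⟨j₀, hj₀, rfl⟩ := Finset.mem_image.1 ha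
    refine le_trans ?_ (hQ.2 (Q j₀))
    rw [← Set.ncard_coe_finset]
    refine Set.ncard_le_ncard (fun j hj => ?_) (Set.toFinite _)
    simp only [Finset.coe_filter, Set.mem_ofPred_eq, F, Prod.mk.injEq, decide_eq_decide] at hj
    obtain ⟨-, ⟨hsx, hsy⟩, hu, hv⟩ := hj
    have hu' := abs_sub_lt_of_floor_div_eq hη0 hu
    have hv' := abs_sub_lt_of_floor_div_eq hη0 hv
    have e : ∀ j, lcDist c p (Q j) = lcNorm c |X j| |Y j| := fun j => (lcNorm_abs hc _ _).symm
    rw [e, e] at hv'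
    obtain ⟨hx, hy⟩ := abs_sub_le_of_lcNorm_close hc (abs_nonneg _) (abs_nonneg _) (abs_nonneg _)
      (abs_nonneg _) hu' hv'
    have hs : ∀ a b : ℝ, (0 ≤ a ↔ 0 ≤ b) → |a - b| = |(|a| - |b|)| := by
      intro a b hab
      by_cases ha : 0 ≤ a
      · rw [abs_of_nonneg ha, abs_of_nonneg (hab.1 ha)]
      · have hb : ¬ 0 ≤ b := fun h => ha (hab.2 h)
        rw [abs_of_neg (not_le.1 ha), abs_of_neg (not_le.1 hb), abs_sub_comm]
        congr 1; ring
    rw [← hs _ _ hsx] at hx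
    rw [← hs _ _ hsy] at hy
    have hx2 : |Q j₀ 0 - Q j 0| ≤ 3 * η := by
      have : X j - X j₀ = Q j₀ 0 - Q j 0 := by simp only [X]; ring
      rwa [this] at hx
    have hy2 : |Q j₀ 1 - Q j 1| ≤ 2 * η := by
      have : Y j - Y j₀ = Q j₀ 1 - Q j 1 := by simp only [Y]; ring
      rwa [this] at hy
    show Q j₀ ∈ Metric.closedBall (Q j) ε
    rw [Metric.mem_closedBall, EuclideanSpace.dist_eq, Fin.sum_univ_two, Real.dist_eq, Real.dist_eq]
    refine Real.sqrt_le_iff.2 ⟨hε.le, ?_⟩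
    have := pow_le_pow_left₀ (abs_nonneg _) hx2 2
    have := pow_le_pow_left₀ (abs_nonneg _) hy2 2
    nlinarith [sq_nonneg ε]
  have h1 := Finset.card_le_mul_card_image S δ hfib
  -- The first coordinate ranges over a window of length 2(D + h), but the norm only over one of
  -- length 2h. This makes the count proportional to (D + h)h instead of (D + h)².
  have hsub : S.image F ⊆ (Finset.univ : Finset (Bool × Bool)) ×ˢ
      (Finset.Icc ⌊(-(D + h)) / η⌋ ⌊(D + h) / η⌋ ×ˢ Finset.Icc ⌊(D - h) / η⌋ ⌊(D + h) / η⌋) := by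
    intro a ha
    obtain ⟨j, hj, rfl⟩ := Finset.mem_image.1 ha
    have hj' : |lcDist c p (Q j) - D| ≤ h := (Finset.mem_filter.1 hj).2
    have hj2 := abs_le.1 hj'
    have hX : |X j| ≤ lcDist c p (Q j) := abs_fst_le_lcNorm hc _ _
    have hY : |Y j| ≤ lcDist c p (Q j) := abs_snd_le_lcNorm hc _ _
    have hX0 := abs_nonneg (X j)
    have hY0 := abs_nonneg (Y j)
    simp only [F, Finset.mem_product, Finset.mem_univ, true_and, Finset.mem_Icc]
    refine ⟨⟨?_, ?_⟩, ?_, ?_⟩ <;> apply Int.floor_le_floor <;> gcongr <;> linarith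
  have h2 := Finset.card_le_card hsub
  rw [Finset.card_product, Finset.card_product] at h2
  have h4 : (Finset.univ : Finset (Bool × Bool)).card = 4 := by simp
  rw [h4] at h2
  have h3 : (S.card : ℝ) ≤ δ * (4 * (((Finset.Icc ⌊(-(D + h)) / η⌋ ⌊(D + h) / η⌋).card : ℝ) *
      ((Finset.Icc ⌊(D - h) / η⌋ ⌊(D + h) / η⌋).card : ℝ))) := by
    exact_mod_cast h1.trans (Nat.mul_le_mul_left δ h2)
  -- The rounding term 2 is absorbed because ε < 1 ≤ h.
  have k1 : ((Finset.Icc ⌊(-(D + h)) / η⌋ ⌊(D + h) / η⌋).card : ℝ) ≤ 10 * (D + h) / ε := by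
    refine (card_int_Icc_floor_le (by gcongr; linarith)).trans ?_
    rw [hη, le_div_iff₀ hε]
    field_simp
    nlinarith
  have k2 : ((Finset.Icc ⌊(D - h) / η⌋ ⌊(D + h) / η⌋).card : ℝ) ≤ 10 * h / ε := by
    refine (card_int_Icc_floor_le (by gcongr; linarith)).trans ?_
    rw [hη, le_div_iff₀ hε]
    field_simp
    nlinarith
  calc (S.card : ℝ) ≤ δ * (4 * ((10 * (D + h) / ε) * (10 * h / ε))) := by
        refine h3.trans ?_
        gcongr
    _ = _ := by field_simp; ring


/-- `reach S i p` says that a monotone walk through cells in `S` leads from the first cell to the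
cell `(i - 1, p - 1)`; the indices are shifted by one, and `(0, 0)` is a virtual start. -/
def reach (S : ℕ → ℕ → Prop) : ℕ → ℕ → Prop
  | 0 => fun p => p = 0
  | i + 1 => fun p =>
    Nat.rec False (fun p r => S i p ∧ (reach S i p ∨ reach S i (p + 1) ∨ r)) p

/-! ### Reachability in the grid. -/

section Reach

variable {S S' : ℕ → ℕ → Prop}

@[simp] theorem reach_zero (p : ℕ) : reach S 0 p ↔ p = 0 := Iff.rfl

@[simp] theorem reach_succ_zero (i : ℕ) : ¬ reach S (i + 1) 0 := fun h => h

theorem reach_succ_succ (i p : ℕ) : reach S (i + 1) (p + 1) ↔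
    S i p ∧ (reach S i p ∨ reach S i (p + 1) ∨ reach S (i + 1) p) := Iff.rfl

theorem reach_true (i p : ℕ) : reach (fun _ _ => True) (i + 1) (p + 1) := by
  induction i with
  | zero =>
    induction p with
    | zero => simp [reach_succ_succ]
    | succ p ih => exact ⟨trivial, Or.inr (Or.inr ih)⟩
  | succ i ih => exact ⟨trivial, Or.inr (Or.inl ih)⟩

theorem reach_congr {n m : ℕ} (h : ∀ i < n, ∀ j < m, S i j ↔ S' i j) :
    ∀ i ≤ n, ∀ p ≤ m, (reach S i p ↔ reach S' i p) := by
  intro i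
  induction i with
  | zero => simp
  | succ i ihi =>
    intro hi p
    induction p with
    | zero => simp
    | succ p ihp =>
      intro hp
      rw [reach_succ_succ, reach_succ_succ, h i (by omega) p (by omega), ihi (by omega) p (by omega),
        ihi (by omega) (p + 1) hp, ihp (by omega)]

/-- On a free segment of a row, the reachable cells are those after the first entry. -/
theorem reach_segment {i j g m : ℕ} (hS : ∀ q, j ≤ q → q < j + g → q < m → S i q) :
    ∀ p, j < p → p ≤ j + g → p ≤ m →
      (reach S (i + 1) p ↔ reach S (i + 1) j ∨ ∃ q, j ≤ q ∧ q ≤ p ∧ reach S i q) := by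
  intro p hjp
  induction p, hjp using Nat.le_induction with
  | base =>
    intro h1 h2
    rw [reach_succ_succ]
    constructor
    · rintro ⟨-, h | h | h⟩
      · exact Or.inr ⟨j, le_rfl, by omega, h⟩
      · exact Or.inr ⟨j + 1, by omega, le_rfl, h⟩
      · exact Or.inl h
    · refine fun h => ⟨hS j le_rfl (by omega) (by omega), ?_⟩
      rcases h with h | ⟨q, hq1, hq2, hq⟩
      · exact Or.inr (Or.inr h)
      · obtain rfl | rfl : q = j ∨ q = j + 1 := by omega
        · exact Or.inl hq
        · exact Or.inr (Or.inl hq)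
  | succ p hp ih =>
    intro h1 h2
    have ih := ih (by omega) (by omega)
    rw [reach_succ_succ, ih]
    constructor
    · rintro ⟨-, h | h | h | ⟨q, hq1, hq2, hq⟩⟩
      · exact Or.inr ⟨p, by omega, by omega, h⟩
      · exact Or.inr ⟨p + 1, by omega, by omega, h⟩
      · exact Or.inl h
      · exact Or.inr ⟨q, hq1, by omega, hq⟩
    · refine fun h => ⟨hS p (by omega) (by omega) (by omega), ?_⟩
      rcases h with h | ⟨q, hq1, hq2, hq⟩
      · exact Or.inr (Or.inr (Or.inl h))
      · obtain h3 | rfl : q ≤ p ∨ q = p + 1 := by omega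
        · exact Or.inr (Or.inr (Or.inr ⟨q, hq1, h3, hq⟩))
        · exact Or.inr (Or.inl hq)

/-- Passing to every `s`-th row keeps reachable cells reachable. -/
theorem reach_coarsen {n m s : ℕ}
    (h : ∀ i < n, ∀ j < m, S i j → S' (i / s) j) :
    ∀ i < n, ∀ p < m, reach S (i + 1) (p + 1) → reach S' (i / s + 1) (p + 1) := by
  intro i
  induction i with
  | zero =>
    intro hn p
    induction p with
    | zero => exact fun hm hr => ⟨h 0 hn 0 hm hr.1, Or.inl (by simp)⟩
    | succ p ih =>
      intro hm hr
      refine ⟨h 0 hn _ hm hr.1, ?_⟩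
      rcases hr.2 with h | h | h
      · simp at h
      · simp at h
      · exact Or.inr (Or.inr (ih (by omega) h))
  | succ i ihi =>
    intro hn p
    -- A downward step either stays in its block of s rows or enters the next one. If it stays, a
    -- diagonal step becomes a horizontal one and a vertical step disappears.
    have hdiv : (i + 1) / s = i / s ∨ (i + 1) / s = i / s + 1 := by
      rw [Nat.succ_div]; split <;> simp
    induction p with
    | zero =>
      intro hm hr
      refine ⟨h _ hn _ hm hr.1, ?_⟩
      rcases hr.2 with h | h | h
      · simp at h
      · have := ihi (by omega) 0 hm h
        rcases hdiv with e | e <;> rw [e]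
        · exact this.2
        · exact Or.inr (Or.inl this)
      · simp at h
    | succ p ihp =>
      intro hm hr
      refine ⟨h _ hn _ hm hr.1, ?_⟩
      rcases hr.2 with h | h | h
      · have := ihi (by omega) p (by omega) h
        rcases hdiv with e | e <;> rw [e]
        · exact Or.inr (Or.inr this)
        · exact Or.inl this
      · have := ihi (by omega) (p + 1) hm h
        rcases hdiv with e | e <;> rw [e]
        · exact this.2
        · exact Or.inr (Or.inl this)
      · exact Or.inr (Or.inr (ihp (by omega) h))

/-- A walk through every `s`-th row can be refined to a walk through all rows. -/
theorem reach_refine {n m s : ℕ}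
    (h : ∀ a t j, t < s → a * s + t < n → j < m → S' a j → S (a * s + t) j) :
    ∀ a p t, t < s → a * s + t < n → p < m → reach S' (a + 1) (p + 1) →
      reach S (a * s + t + 1) (p + 1) := by
  intro a
  induction a with
  | zero =>
    intro p
    induction p with
    | zero =>
      intro t
      induction t with
      | zero => exact fun hs hn hm hr => ⟨h 0 0 0 hs hn hm hr.1, Or.inl (by simp)⟩
      | succ t ih =>
        exact fun hs hn hm hr => ⟨h 0 _ 0 hs hn hm hr.1,
          Or.inr (Or.inl (ih (by omega) (by omega) hm hr))⟩
    | succ p ihp =>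
      intro t
      induction t with
      | zero =>
        intro hs hn hm hr
        refine ⟨h 0 0 _ hs hn hm hr.1, ?_⟩
        rcases hr.2 with h | h | h
        · simp at h
        · simp at h
        · exact Or.inr (Or.inr (ihp 0 hs hn (by omega) h))
      | succ t ih =>
        exact fun hs hn hm hr => ⟨h 0 _ _ hs hn hm hr.1,
          Or.inr (Or.inl (ih (by omega) (by omega) hm hr))⟩
  | succ a iha =>
    -- The first row of block a + 1 follows the last row of block a, so the induction hypothesis is
    -- used at offset s - 1. The other rows of a block are entered from above in the same column.
    have hrow : ∀ s', (a + 1) * (s' + 1) = a * (s' + 1) + s' + 1 := fun s' => by ring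
    intro p
    induction p with
    | zero =>
      intro t
      induction t with
      | zero =>
        intro hs hn hm hr
        refine ⟨h _ 0 _ hs hn hm hr.1, ?_⟩
        obtain ⟨s, rfl⟩ : ∃ s', s = s' + 1 := ⟨s - 1, by omega⟩
        rw [hrow] at hn ⊢
        rcases hr.2 with h | h | h
        · simp at h
        · exact Or.inr (Or.inl (iha 0 s (by omega) (by omega) hm h))
        · simp at h
      | succ t ih =>
        exact fun hs hn hm hr => ⟨h _ _ _ hs hn hm hr.1,
          Or.inr (Or.inl (ih (by omega) (by omega) hm hr))⟩
    | succ p ihp =>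
      intro t
      induction t with
      | zero =>
        intro hs hn hm hr
        refine ⟨h _ 0 _ hs hn hm hr.1, ?_⟩
        obtain h' | h' | h' := hr.2
        · obtain ⟨s, rfl⟩ : ∃ s', s = s' + 1 := ⟨s - 1, by omega⟩
          rw [hrow] at hn ⊢
          exact Or.inl (iha p s (by omega) (by omega) (by omega) h')
        · obtain ⟨s, rfl⟩ : ∃ s', s = s' + 1 := ⟨s - 1, by omega⟩
          rw [hrow] at hn ⊢
          exact Or.inr (Or.inl (iha (p + 1) s (by omega) (by omega) hm h'))
        · exact Or.inr (Or.inr (ihp 0 hs hn (by omega) h'))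
      | succ t ih =>
        exact fun hs hn hm hr => ⟨h _ _ _ hs hn hm hr.1,
          Or.inr (Or.inl (ih (by omega) (by omega) hm hr))⟩

/-- A walk through cells in `S` from `(0, 0)` to `(a, b)`. -/
def ChainTo (S : ℕ → ℕ → Prop) (a b : ℕ) : Prop :=
  ∃ (k : ℕ) (z : ℕ → ℕ × ℕ), z 0 = (0, 0) ∧ z k = (a, b) ∧
    (∀ t < k, ((z (t + 1)).1 = (z t).1 ∨ (z (t + 1)).1 = (z t).1 + 1) ∧
      ((z (t + 1)).2 = (z t).2 ∨ (z (t + 1)).2 = (z t).2 + 1)) ∧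
    ∀ t ≤ k, S (z t).1 (z t).2 ∧ (z t).1 ≤ a ∧ (z t).2 ≤ b

theorem ChainTo.snoc {a b a' b' : ℕ} (h : ChainTo S a b) (hS : S a' b')
    (ha : a' = a ∨ a' = a + 1) (hb : b' = b ∨ b' = b + 1) : ChainTo S a' b' := by
  obtain ⟨k, z, h0, hk, hstep, hz⟩ := h
  refine ⟨k + 1, fun t => if t ≤ k then z t else (a', b'), by simp [h0], by simp, ?_, ?_⟩
  · intro t ht
    have htk : t ≤ k := by omega
    by_cases h1 : t + 1 ≤ k
    · simpa only [if_pos h1, if_pos htk] using hstep t h1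
    · obtain rfl : t = k := by omega
      simpa [hk] using And.intro ha hb
  · intro t ht
    by_cases h1 : t ≤ k
    · have := hz t h1
      simp only [if_pos h1]
      exact ⟨this.1, by omega, by omega⟩
    · simp only [if_neg h1]
      exact ⟨hS, le_rfl, le_rfl⟩

theorem chainTo_of_reach : ∀ i p, reach S (i + 1) (p + 1) → ChainTo S i p := by
  intro i
  induction i with
  | zero =>
    intro p
    induction p with
    | zero =>
      exact fun h => ⟨0, fun _ => (0, 0), rfl, rfl, by simp, fun t _ => ⟨h.1, le_rfl, le_rfl⟩⟩
    | succ p ih =>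
      rintro ⟨hS, h | h | h⟩
      · simp at h
      · simp at h
      · exact (ih h).snoc hS (by simp) (by simp)
  | succ i ihi =>
    intro p
    induction p with
    | zero =>
      rintro ⟨hS, h | h | h⟩
      · simp at h
      · exact (ihi 0 h).snoc hS (by simp) (by simp)
      · simp at h
    | succ p ih =>
      rintro ⟨hS, h | h | h⟩
      · exact (ihi p h).snoc hS (by simp) (by simp)
      · exact (ihi (p + 1) h).snoc hS (by simp) (by simp)
      · exact (ih h).snoc hS (by simp) (by simp)

end Reach

/-- The distances of the vertices, as a function of natural numbers. -/
def gridDist (c : ℝ≥0∞) {n m : ℕ} (P : Fin n → Plane) (Q : Fin m → Plane) (i j : ℕ) : ℝ :=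
  if h : i < n ∧ j < m then lcDist c (P ⟨i, h.1⟩) (Q ⟨j, h.2⟩) else 0

/-! ### The discrete Fréchet distance as a reachability threshold. -/

section Frechet

variable {c : ℝ≥0∞} {n m : ℕ} {P : Fin n → Plane} {Q : Fin m → Plane}

theorem gridDist_fin (i : Fin n) (j : Fin m) : gridDist c P Q i j = lcDist c (P i) (Q j) := by
  simp [gridDist]

theorem walkCost_le_iff (F : MonotoneWalk n m) (x : ℝ) : walkCost c P Q F ≤ x ↔
    ∀ i, gridDist c P Q (F.cell i).1 (F.cell i).2 ≤ x := by
  simp [walkCost, gridDist_fin]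

theorem exists_walkCost_le_iff (hn : 0 < n) (hm : 0 < m) (x : ℝ) :
    (∃ F : MonotoneWalk n m, walkCost c P Q F ≤ x) ↔
      reach (fun i j => gridDist c P Q i j ≤ x) n m := by
  constructor
  · rintro ⟨F, hF⟩
    rw [walkCost_le_iff] at hF
    have key : ∀ t : ℕ, ∀ h : t < F.steps + 1, reach (fun i j => gridDist c P Q i j ≤ x)
        ((F.cell ⟨t, h⟩).1 + 1) ((F.cell ⟨t, h⟩).2 + 1) := by
      intro t
      induction t with
      | zero =>
        intro h
        have h1 := F.start_fst
        have h2 := F.start_snd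
        have h3 := hF 0
        rw [h1, h2] at h3
        change reach _ (((F.cell 0).1 : ℕ) + 1) (((F.cell 0).2 : ℕ) + 1)
        rw [h1, h2]
        exact ⟨h3, Or.inl rfl⟩
      | succ t ih =>
        intro h
        have ih := ih (by omega)
        have h1 := F.step_fst ⟨t, by omega⟩
        have h2 := F.step_snd ⟨t, by omega⟩
        have h3 := hF ⟨t + 1, h⟩
        change ((F.cell ⟨t + 1, h⟩).1 : ℕ) = (F.cell ⟨t, by omega⟩).1 ∨
          ((F.cell ⟨t + 1, h⟩).1 : ℕ) = (F.cell ⟨t, by omega⟩).1 + 1 at h1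
        change ((F.cell ⟨t + 1, h⟩).2 : ℕ) = (F.cell ⟨t, by omega⟩).2 ∨
          ((F.cell ⟨t + 1, h⟩).2 : ℕ) = (F.cell ⟨t, by omega⟩).2 + 1 at h2
        refine ⟨h3, ?_⟩
        -- If neither index moves, the cell is the previous one, and the predecessor already found
        -- serves again.
        rcases h1 with h1 | h1 <;> rcases h2 with h2 | h2 <;> rw [h1, h2]
        · exact ih.2
        · exact Or.inr (Or.inr ih)
        · exact Or.inr (Or.inl ih)
        · exact Or.inl ih
    have := key F.steps (by omega)
    have h1 := F.finish_fst
    have h2 := F.finish_snd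
    change ((F.cell ⟨F.steps, _⟩).1 : ℕ) + 1 = n at h1
    change ((F.cell ⟨F.steps, _⟩).2 : ℕ) + 1 = m at h2
    rwa [h1, h2] at this
  · intro h
    obtain ⟨a, rfl⟩ : ∃ a, n = a + 1 := ⟨n - 1, by omega⟩
    obtain ⟨b, rfl⟩ : ∃ b, m = b + 1 := ⟨m - 1, by omega⟩
    obtain ⟨k, z, h0, hk, hstep, hz⟩ := chainTo_of_reach a b h
    let F : MonotoneWalk (a + 1) (b + 1) :=
      { steps := k
        cell := fun t => (⟨(z t).1, by have := hz t (by omega); omega⟩,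
          ⟨(z t).2, by have := hz t (by omega); omega⟩)
        start_fst := by simp [h0]
        start_snd := by simp [h0]
        step_fst := fun t => (hstep t t.2).1
        step_snd := fun t => (hstep t t.2).2
        finish_fst := by simp [hk]
        finish_snd := by simp [hk] }
    exact ⟨F, (walkCost_le_iff F x).2 fun t => (hz t (Nat.lt_succ_iff.1 t.2)).1⟩

theorem discreteFrechet_le_iff (hn : 0 < n) (hm : 0 < m) (x : ℝ) :
    discreteFrechet c P Q ≤ x ↔ reach (fun i j => gridDist c P Q i j ≤ x) n m := by
  rw [← exists_walkCost_le_iff hn hm]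
  -- Every cost is one of finitely many vertex distances, so the infimum is attained once some walk
  -- exists.
  have hfin : (Set.range fun F : MonotoneWalk n m => walkCost c P Q F).Finite := by
    refine (Set.finite_range fun z : Fin n × Fin m => lcDist c (P z.1) (Q z.2)).subset ?_
    rintro _ ⟨F, rfl⟩
    obtain ⟨t, -, ht⟩ := Finset.exists_mem_eq_sup' (Finset.univ_nonempty (α := Fin (F.steps + 1)))
      fun i => lcDist c (P (F.cell i).1) (Q (F.cell i).2)
    exact ⟨F.cell t, ht.symm⟩
  have hne : (Set.range fun F : MonotoneWalk n m => walkCost c P Q F).Nonempty := by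
    obtain ⟨B, hB⟩ := (Set.finite_range fun z : Fin n × Fin m => lcDist c (P z.1) (Q z.2)).bddAbove
    have : reach (fun i j => gridDist c P Q i j ≤ max B 0) n m := by
      have h := reach_true (n - 1) (m - 1)
      rw [Nat.sub_add_cancel hn, Nat.sub_add_cancel hm] at h
      refine (reach_congr (n := n) (m := m) (fun i hi j hj => ?_) n le_rfl m le_rfl).1 h
      simp only [true_iff, gridDist, hi, hj, and_self, dite_true]
      exact (hB ⟨(⟨i, hi⟩, ⟨j, hj⟩), rfl⟩).trans (le_max_left _ _)
    obtain ⟨F, -⟩ := (exists_walkCost_le_iff hn hm _).2 this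
    exact ⟨_, F, rfl⟩
  constructor
  · intro h
    obtain ⟨F, hF⟩ := hne.csInf_mem hfin
    exact ⟨F, hF.trans_le h⟩
  · rintro ⟨F, hF⟩
    exact (ciInf_le hfin.bddBelow F).trans hF

end Frechet

/-! ### Long jumps along a row -/

section Jump

/-- The weight of a cell with slack `x j`: the sum of `2⁻ᵏ` over the levels `k` with
`x j ≤ H * 2ᵏ`. -/
def slackWeight (K : ℕ) (H : ℝ) (x : ℕ → ℝ) (j : ℕ) : ℝ :=
  ∑ κ ∈ Finset.range K, if x j ≤ H * 2 ^ κ then (1 / 2 : ℝ) ^ κ else 0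

/-- A bound for the number of jumps from `j` to the end `m` of the row. -/
def jumpPotential (K : ℕ) (H : ℝ) (x : ℕ → ℝ) (m j : ℕ) : ℝ :=
  ∑ j' ∈ Finset.Ico j m, slackWeight K H x j' + if j < m then 1 else 0

variable {K : ℕ} {H : ℝ} {x : ℕ → ℝ} {m : ℕ}

theorem slackWeight_nonneg (j : ℕ) : 0 ≤ slackWeight K H x j :=
  Finset.sum_nonneg fun κ _ => by split <;> positivity

theorem jumpPotential_nonneg (j : ℕ) : 0 ≤ jumpPotential K H x m j :=
  add_nonneg (Finset.sum_nonneg fun _ _ => slackWeight_nonneg _) (by split <;> norm_num)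

theorem abs_sub_le_of_steps {f : ℕ → ℝ} {ℓ : ℝ}
    (hf : ∀ j, j + 1 < m → |f (j + 1) - f j| ≤ ℓ) {j : ℕ} :
    ∀ t, j + t < m → |f (j + t) - f j| ≤ t * ℓ := by
  intro t
  induction t with
  | zero => simp
  | succ t ih =>
    intro h
    have h1 := ih (by omega)
    have h2 := hf (j + t) (by omega)
    have h3 := abs_add_le (f (j + t + 1) - f (j + t)) (f (j + t) - f j)
    rw [sub_add_sub_cancel] at h3
    push_cast
    rw [← add_assoc]
    linarith

/-- If the jump stays in the row, each of the 2^κ cells it passes has slack at most 2·2^κ·L + 2^κ·ℓ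
≤ 3L·2^κ and so weighs at least 2^(-κ): together they pay 1. A jump past the end is paid by the
extra summand 1. The level κ of a jump inside the row is below K because 2^κ < m < 2^K. -/
theorem jumpPotential_jump {L ℓ : ℝ} (hL : 0 ≤ L) (hℓ : ℓ ≤ L)
    (hx : ∀ j, j + 1 < m → |x (j + 1) - x j| ≤ ℓ) {j κ : ℕ} (hj : j < m) (hK : m < 2 ^ K)
    (hg : m < 2 ^ κ ∨ x j ≤ 2 * (2 ^ κ * L)) :
    jumpPotential K (3 * L) x m (j + 2 ^ κ) + 1 ≤ jumpPotential K (3 * L) x m j := by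
  unfold jumpPotential
  rw [if_pos hj]
  by_cases h : j + 2 ^ κ < m
  · rw [if_pos h]
    have hκ : κ < K := by
      by_contra hc
      have := Nat.pow_le_pow_right (n := 2) (by norm_num) (not_lt.1 hc)
      omega
    have hxj : x j ≤ 2 * (2 ^ κ * L) := hg.resolve_left (by omega)
    rw [← Finset.sum_Ico_consecutive _ (Nat.le_add_right j (2 ^ κ)) h.le]
    have : (1 : ℝ) ≤ ∑ i ∈ Finset.Ico j (j + 2 ^ κ), slackWeight K (3 * L) x i := by
      have h1 : ∀ i ∈ Finset.Ico j (j + 2 ^ κ), (1 / 2 : ℝ) ^ κ ≤ slackWeight K (3 * L) x i := by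
        intro i hi
        rw [Finset.mem_Ico] at hi
        obtain ⟨t, rfl⟩ := Nat.exists_eq_add_of_le hi.1
        have h2 := (le_abs_self _).trans (abs_sub_le_of_steps hx (j := j) t (by omega))
        have h3 : (t : ℝ) ≤ 2 ^ κ := by
          have : t ≤ 2 ^ κ := by omega
          exact_mod_cast this
        have h4 : (t : ℝ) * ℓ ≤ 2 ^ κ * L :=
          (mul_le_mul_of_nonneg_left hℓ (Nat.cast_nonneg t)).trans
            (mul_le_mul_of_nonneg_right h3 hL)
        have h5 : x (j + t) ≤ 3 * L * 2 ^ κ := by linarith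
        calc (1 / 2 : ℝ) ^ κ = if x (j + t) ≤ 3 * L * 2 ^ κ then (1 / 2 : ℝ) ^ κ else 0 := by
              rw [if_pos h5]
          _ ≤ _ := Finset.single_le_sum
              (f := fun κ => if x (j + t) ≤ 3 * L * 2 ^ κ then (1 / 2 : ℝ) ^ κ else 0)
              (fun κ _ => by split <;> positivity) (Finset.mem_range.2 hκ)
      have h2 := Finset.card_nsmul_le_sum _ _ _ h1
      rw [Nat.card_Ico, Nat.add_sub_cancel_left, nsmul_eq_mul] at h2
      have h3 : ((2 ^ κ : ℕ) : ℝ) * (1 / 2) ^ κ = 1 := by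
        push_cast
        rw [← mul_pow]; norm_num
      linarith
    linarith
  · rw [if_neg h, Finset.Ico_eq_empty (by omega), Finset.sum_empty]
    have := Finset.sum_nonneg fun i (_ : i ∈ Finset.Ico j m) =>
      slackWeight_nonneg (K := K) (H := 3 * L) (x := x) i
    linarith

theorem jumpPotential_zero_le (hm : 0 < m) {B : ℝ}
    (hB : ∀ κ < K, (1 / 2 : ℝ) ^ κ *
      ((Finset.range m).filter fun j => x j ≤ H * 2 ^ κ).card ≤ B) :
    jumpPotential K H x m 0 ≤ 1 + K * B := by
  unfold jumpPotential slackWeight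
  rw [if_pos hm, Finset.sum_comm, add_comm, ← Finset.range_eq_Ico]
  gcongr
  calc _ ≤ ∑ κ ∈ Finset.range K, B := Finset.sum_le_sum fun κ hκ => by
        rw [← Finset.sum_filter, Finset.sum_const, nsmul_eq_mul, mul_comm]
        exact hB κ (Finset.mem_range.1 hκ)
    _ = K * B := by simp

end Jump

/-! ### The number of jumps on an (ε, δ)-curve. -/

section CurveJump

variable {c : ℝ≥0∞} {n m : ℕ} {P : Fin n → Plane} {Q : Fin m → Plane} {γ ε : ℝ} {δ : ℕ}

theorem gridDist_nonneg (hc : 1 ≤ c) (i j : ℕ) : 0 ≤ gridDist c P Q i j := by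
  unfold gridDist
  split
  · exact lcNorm_nonneg hc _ _
  · exact le_rfl

theorem gridDist_succ_right (hc : 1 ≤ c) (hQ : EdgesAtMost γ Q) {i : ℕ} (hi : i < n) (j : ℕ)
    (hj : j + 1 < m) : |gridDist c P Q i (j + 1) - gridDist c P Q i j| ≤ 2 * γ := by
  have hj' : j < m := by omega
  simp only [gridDist, hi, hj, hj', and_self, dite_true]
  have h := hQ j hj
  rw [dist_comm] at h
  linarith [lcDist_sub_le hc (P ⟨i, hi⟩) (Q ⟨j + 1, hj⟩) (Q ⟨j, hj'⟩)]

theorem gridDist_succ_left (hc : 1 ≤ c) (hP : EdgesAtMost γ P) {j : ℕ} (hj : j < m) (i : ℕ)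
    (hi : i + 1 < n) : |gridDist c P Q (i + 1) j - gridDist c P Q i j| ≤ 2 * γ := by
  have hi' : i < n := by omega
  simp only [gridDist, hj, hi, hi', and_self, dite_true]
  have h := hP i hi
  rw [dist_comm] at h
  rw [lcDist_comm hc, lcDist_comm hc (P ⟨i, hi'⟩)]
  linarith [lcDist_sub_le hc (Q ⟨j, hj⟩) (P ⟨i + 1, hi⟩) (P ⟨i, hi'⟩)]

/-- On level κ the number a of cells is bounded both by m and by the annulus count, and a² is at
most the product. With h = 3L·2^κ, the weight 2^(-κ) turns h into 3L, so all levels obey the same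
bound; the constant is 60² = 400 · 9. -/
theorem jumpPotential_gridDist_le (hc : 1 ≤ c) (hm : 0 < m) (hε : 0 < ε) (hε1 : ε < 1)
    (hQ : IsEpsDeltaCurve γ ε δ Q) {i : ℕ} (hi : i < n) {D L : ℝ} (hD : 0 ≤ D) (hL : 1 ≤ L)
    (K : ℕ) :
    jumpPotential K (3 * L) (fun j => |gridDist c P Q i j - D|) m 0 ≤
      1 + K * min (m : ℝ) (60 * L * Real.sqrt (m * δ * (D + 1)) / ε) := by
  refine jumpPotential_zero_le hm fun κ _ => ?_
  set A := (Finset.range m).filter fun j => |gridDist c P Q i j - D| ≤ 3 * L * 2 ^ κ with hA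
  have hp : (1 / 2 : ℝ) ^ κ ≤ 1 := pow_le_one₀ (by norm_num) (by norm_num)
  have hp0 : 0 < (1 / 2 : ℝ) ^ κ := by positivity
  have hAm : (A.card : ℝ) ≤ m := by
    have := Finset.card_filter_le (Finset.range m)
      fun j => |gridDist c P Q i j - D| ≤ 3 * L * 2 ^ κ
    rw [Finset.card_range] at this
    exact Nat.cast_le.2 this
  have h2 : (1 : ℝ) ≤ 2 ^ κ := one_le_pow₀ (by norm_num)
  set h := 3 * L * 2 ^ κ with hh
  have hh1 : 1 ≤ h := by nlinarith
  have hAann : (A.card : ℝ) ≤ 400 * δ * ((D + h) * h) / ε ^ 2 := by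
    refine le_trans ?_ (card_annulus_le hc hε hε1 hQ (P ⟨i, hi⟩) hD hh1)
    have : A.card ≤ ((Finset.univ.filter fun j : Fin m =>
        |lcDist c (P ⟨i, hi⟩) (Q j) - D| ≤ h).map Fin.valEmbedding).card := by
      refine Finset.card_le_card fun j hj => ?_
      rw [hA, Finset.mem_filter, Finset.mem_range] at hj
      refine Finset.mem_map.2 ⟨⟨j, hj.1⟩, ?_, rfl⟩
      rw [Finset.mem_filter]
      refine ⟨Finset.mem_univ _, ?_⟩
      simpa [gridDist, hi, hj.1] using hj.2
    rw [Finset.card_map] at this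
    exact_mod_cast this
  refine le_min ((mul_le_of_le_one_left (Nat.cast_nonneg _) hp).trans hAm) ?_
  rw [le_div_iff₀ hε]
  refine abs_le_of_sq_le_sq' ?_ (by positivity) |>.2
  have hA0 : (0 : ℝ) ≤ A.card := Nat.cast_nonneg _
  have e1 : ((1 / 2 : ℝ) ^ κ * A.card * ε) ^ 2 ≤
      ((1 / 2 : ℝ) ^ κ) ^ 2 * (m * (400 * δ * ((D + h) * h) / ε ^ 2)) * ε ^ 2 := by
    rw [mul_pow, mul_pow, sq (A.card : ℝ)]
    gcongr
  refine e1.trans ?_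
  have e2 : (1 / 2 : ℝ) ^ κ * h = 3 * L := by
    rw [hh, mul_comm, mul_assoc, ← mul_pow]; norm_num
  have e3 : ((1 / 2 : ℝ) ^ κ) ^ 2 * (m * (400 * δ * ((D + h) * h) / ε ^ 2)) * ε ^ 2 =
      400 * (m * δ) * (((1 / 2 : ℝ) ^ κ * D + (1 / 2 : ℝ) ^ κ * h) * ((1 / 2 : ℝ) ^ κ * h)) := by
    field_simp
  rw [e3, e2, mul_pow, Real.sq_sqrt (by positivity)]
  have e4 : (1 / 2 : ℝ) ^ κ * D ≤ D := mul_le_of_le_one_left hD hp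
  have e5 : ((1 / 2 : ℝ) ^ κ * D + 3 * L) * (3 * L) ≤ 9 * L ^ 2 * (D + 1) := by
    nlinarith [mul_nonneg hD (sub_nonneg.2 hL)]
  have e6 : (0 : ℝ) ≤ m * δ := by positivity
  nlinarith [mul_le_mul_of_nonneg_left e5 e6]

end CurveJump

/-- A jump that is short compared with the slack stays on the same side of the threshold. -/
theorem le_iff_of_jump {f : ℕ → ℝ} {m g j : ℕ} {ℓ L D : ℝ} (hL : ℓ < L)
    (hf : ∀ j, j + 1 < m → |f (j + 1) - f j| ≤ ℓ) (hg : g = 1 ∨ g * L ≤ |f j - D|) :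
    ∀ q, j ≤ q → q < j + g → q < m → (f q ≤ D ↔ f j ≤ D) := by
  intro q h1 h2 h3
  obtain ⟨t, rfl⟩ := Nat.exists_eq_add_of_le h1
  rcases hg with rfl | hg
  · obtain rfl : t = 0 := by omega
    rfl
  · rcases Nat.eq_zero_or_pos t with rfl | ht
    · rfl
    have h4 := abs_le.1 (abs_sub_le_of_steps hf t h3)
    have hℓ : 0 ≤ ℓ := (abs_nonneg _).trans (hf j (by omega))
    have h5 : (t : ℝ) * ℓ < g * L := by
      have h6 : (t : ℝ) < g := by
        have : t < g := by omega
        exact_mod_cast this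
      have h7 : (0 : ℝ) < t := by exact_mod_cast ht
      nlinarith
    constructor
    · intro h
      by_contra hc
      rw [abs_of_pos (by linarith)] at hg
      linarith
    · intro h
      rw [abs_of_nonpos (by linarith)] at hg
      linarith


/-! ### A program logic with running times. -/

namespace RealRAM

/-- Total correctness with a post-condition on the final memory and the number of operations. -/
def Exec (c : ℝ≥0∞) (A : Program) (s : State) (Q : State → ℕ → Prop) : Prop :=
  ∃ (T : ℕ) (s' : State), Runs c A s T s' ∧ Q s' T

variable {c : ℝ≥0∞} {A B : Program} {s : State} {Q Q' : State → ℕ → Prop}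

theorem Exec.mono (h : Exec c A s Q) (hQ : ∀ s' T, Q s' T → Q' s' T) : Exec c A s Q' := by
  obtain ⟨T, s', hr, hq⟩ := h
  exact ⟨T, s', hr, hQ _ _ hq⟩

theorem exec_skip : Exec c .skip s Q ↔ Q s 1 := by
  constructor
  · rintro ⟨T, s', hr, hq⟩; cases hr; exact hq
  · exact fun h => ⟨_, _, .skip s, h⟩

theorem exec_setNat {x : ℕ} {e : NatExpr} :
    Exec c (.setNat x e) s Q ↔ Q (s.setNat x (e.eval s)) (e.cost + 1) := by
  constructor
  · rintro ⟨T, s', hr, hq⟩; cases hr; exact hq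
  · exact fun h => ⟨_, _, .setNat s x e, h⟩

theorem exec_setReal {x : ℕ} {e : RealExpr} :
    Exec c (.setReal x e) s Q ↔ Q (s.setReal x (e.eval c s)) (e.cost + 1) := by
  constructor
  · rintro ⟨T, s', hr, hq⟩; cases hr; exact hq
  · exact fun h => ⟨_, _, .setReal s x e, h⟩

theorem exec_storeNat {a : ℕ} {i e : NatExpr} : Exec c (.storeNat a i e) s Q ↔
    Q (s.storeNat a (i.eval s) (e.eval s)) (i.cost + e.cost + 1) := by
  constructor
  · rintro ⟨T, s', hr, hq⟩; cases hr; exact hq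
  · exact fun h => ⟨_, _, .storeNat s a i e, h⟩

theorem exec_storeReal {a : ℕ} {i : NatExpr} {e : RealExpr} : Exec c (.storeReal a i e) s Q ↔
    Q (s.storeReal a (i.eval s) (e.eval c s)) (i.cost + e.cost + 1) := by
  constructor
  · rintro ⟨T, s', hr, hq⟩; cases hr; exact hq
  · exact fun h => ⟨_, _, .storeReal s a i e, h⟩

theorem exec_seq : Exec c (.seq A B) s Q ↔
    Exec c A s fun s' T => Exec c B s' fun s'' T' => Q s'' (T + T') := by
  constructor
  · rintro ⟨T, s', hr, hq⟩
    cases hr with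
    | seq h1 h2 => exact ⟨_, _, h1, _, _, h2, hq⟩
  · rintro ⟨T, s', h1, T', s'', h2, hq⟩
    exact ⟨_, _, .seq h1 h2, hq⟩

theorem exec_ite {b : Test} : Exec c (.ite b A B) s Q ↔
    (b.Holds c s → Exec c A s fun s' T => Q s' (b.cost + 1 + T)) ∧
    (¬ b.Holds c s → Exec c B s fun s' T => Q s' (b.cost + 1 + T)) := by
  constructor
  · rintro ⟨T, s', hr, hq⟩
    cases hr with
    | ite_true hb h => exact ⟨fun _ => ⟨_, _, h, hq⟩, fun hb' => absurd hb hb'⟩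
    | ite_false hb h => exact ⟨fun hb' => absurd hb' hb, fun _ => ⟨_, _, h, hq⟩⟩
  · rintro ⟨h1, h2⟩
    by_cases hb : b.Holds c s
    · obtain ⟨T, s', h, hq⟩ := h1 hb
      exact ⟨_, _, .ite_true hb h, hq⟩
    · obtain ⟨T, s', h, hq⟩ := h2 hb
      exact ⟨_, _, .ite_false hb h, hq⟩

/-! ### Memory that a program leaves unchanged -/

/-- The natural number variables that a program assigns. -/
def Program.natVars : Program → List ℕ
  | .setNat x _ => [x]
  | .seq A B => A.natVars ++ B.natVars
  | .ite _ A B => A.natVars ++ B.natVars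
  | .while _ A => A.natVars
  | _ => []

/-- The real variables that a program assigns. -/
def Program.realVars : Program → List ℕ
  | .setReal x _ => [x]
  | .seq A B => A.realVars ++ B.realVars
  | .ite _ A B => A.realVars ++ B.realVars
  | .while _ A => A.realVars
  | _ => []

/-- The natural number arrays that a program changes. -/
def Program.natArrs : Program → List ℕ
  | .storeNat a _ _ => [a]
  | .seq A B => A.natArrs ++ B.natArrs
  | .ite _ A B => A.natArrs ++ B.natArrs
  | .while _ A => A.natArrs
  | _ => []

/-- The real arrays that a program changes. -/
def Program.realArrs : Program → List ℕ
  | .storeReal a _ _ => [a]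
  | .seq A B => A.realArrs ++ B.realArrs
  | .ite _ A B => A.realArrs ++ B.realArrs
  | .while _ A => A.realArrs
  | _ => []

/-- The memories `s` and `s'` agree outside the variables and arrays that `A` changes. -/
structure Frame (A : Program) (s s' : State) : Prop where
  natVar : ∀ x, x ∉ A.natVars → s'.natVar x = s.natVar x
  realVar : ∀ x, x ∉ A.realVars → s'.realVar x = s.realVar x
  natArr : ∀ x, x ∉ A.natArrs → s'.natArr x = s.natArr x
  realArr : ∀ x, x ∉ A.realArrs → s'.realArr x = s.realArr x

theorem Frame.refl (A : Program) (s : State) : Frame A s s :=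
  ⟨fun _ _ => rfl, fun _ _ => rfl, fun _ _ => rfl, fun _ _ => rfl⟩

theorem Frame.trans {s s' s'' : State} (h : Frame A s s') (h' : Frame A s' s'') :
    Frame A s s'' :=
  ⟨fun x hx => (h'.natVar x hx).trans (h.natVar x hx),
    fun x hx => (h'.realVar x hx).trans (h.realVar x hx),
    fun x hx => (h'.natArr x hx).trans (h.natArr x hx),
    fun x hx => (h'.realArr x hx).trans (h.realArr x hx)⟩

theorem Frame.weaken {s s' : State} (h : Frame A s s') (h1 : A.natVars ⊆ B.natVars)
    (h2 : A.realVars ⊆ B.realVars) (h3 : A.natArrs ⊆ B.natArrs) (h4 : A.realArrs ⊆ B.realArrs) :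
    Frame B s s' :=
  ⟨fun x hx => h.natVar x fun h => hx (h1 h), fun x hx => h.realVar x fun h => hx (h2 h),
    fun x hx => h.natArr x fun h => hx (h3 h), fun x hx => h.realArr x fun h => hx (h4 h)⟩

/-- Membership in the syntactic lists is decided by `simp`, so specifications need only mention what
a block changes. -/
theorem Runs.frame {s s' : State} {T : ℕ} (h : Runs c A s T s') : Frame A s s' := by
  induction h with
  | skip s => exact Frame.refl _ _
  | setNat s x e =>
    refine ⟨fun y hy => ?_, fun _ _ => rfl, fun _ _ => rfl, fun _ _ => rfl⟩
    have : y ≠ x := by simpa [Program.natVars] using hy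
    simp [State.setNat, this]
  | setReal s x e =>
    refine ⟨fun _ _ => rfl, fun y hy => ?_, fun _ _ => rfl, fun _ _ => rfl⟩
    have : y ≠ x := by simpa [Program.realVars] using hy
    simp [State.setReal, this]
  | storeNat s x i e =>
    refine ⟨fun _ _ => rfl, fun _ _ => rfl, fun y hy => ?_, fun _ _ => rfl⟩
    have : y ≠ x := by simpa [Program.natArrs] using hy
    simp [State.storeNat, this]
  | storeReal s x i e =>
    refine ⟨fun _ _ => rfl, fun _ _ => rfl, fun _ _ => rfl, fun y hy => ?_⟩
    have : y ≠ x := by simpa [Program.realArrs] using hy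
    simp [State.storeReal, this]
  | seq _ _ ih1 ih2 =>
    refine (ih1.weaken ?_ ?_ ?_ ?_).trans (ih2.weaken ?_ ?_ ?_ ?_) <;>
      simp [Program.natVars, Program.realVars, Program.natArrs, Program.realArrs]
  | ite_true _ _ ih =>
    refine ih.weaken ?_ ?_ ?_ ?_ <;>
      simp [Program.natVars, Program.realVars, Program.natArrs, Program.realArrs]
  | ite_false _ _ ih =>
    refine ih.weaken ?_ ?_ ?_ ?_ <;>
      simp [Program.natVars, Program.realVars, Program.natArrs, Program.realArrs]
  | while_true _ _ _ ih1 ih2 =>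
    exact Frame.trans (ih1.weaken (fun _ h => h) (fun _ h => h) (fun _ h => h) fun _ h => h) ih2
  | while_false => exact Frame.refl _ _

theorem Exec.frame (h : Exec c A s Q) : Exec c A s fun s' T => Frame A s s' ∧ Q s' T := by
  obtain ⟨T, s', hr, hq⟩ := h
  exact ⟨T, s', hr, hr.frame, hq⟩

/-- Loops, with an invariant and a potential that pays for the operations. -/
theorem Exec.while {b : Test} {s₀ : State} (Inv : State → Prop) (Φ : State → ℝ)
    (hΦ : ∀ s, Inv s → 0 ≤ Φ s)
    (hA : ∀ s, Frame A s₀ s → Inv s → b.Holds c s → Exec c A s fun s' T =>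
      Inv s' ∧ (T : ℝ) + b.cost + 1 + Φ s' ≤ Φ s)
    (h0 : Inv s₀) : Exec c (.while b A) s₀ fun s' T =>
      Frame A s₀ s' ∧ Inv s' ∧ ¬ b.Holds c s' ∧ (T : ℝ) + Φ s' ≤ Φ s₀ + b.cost + 1 := by
  -- Each round consumes at least one unit of the potential, so induction on a natural number above
  -- it yields termination together with the time bound.
  have key : ∀ N : ℕ, ∀ s, Frame A s₀ s → Inv s → Φ s < N → Exec c (.while b A) s fun s' T =>
      Inv s' ∧ ¬ b.Holds c s' ∧ (T : ℝ) + Φ s' ≤ Φ s + b.cost + 1 := by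
    intro N
    induction N with
    | zero => exact fun s _ hs hlt => absurd (hΦ s hs) (by push_cast at hlt; linarith)
    | succ N ih =>
      intro s hf hs hlt
      by_cases hb : b.Holds c s
      · obtain ⟨T, s', hr, hi, hc⟩ := hA s hf hs hb
        have hT : (0 : ℝ) ≤ T := Nat.cast_nonneg T
        have hbc : (0 : ℝ) ≤ b.cost := Nat.cast_nonneg _
        obtain ⟨T', s'', hr', hi', hb', hc'⟩ := ih s' (hf.trans hr.frame) hi
          (by push_cast at hlt; linarith)
        refine ⟨_, s'', .while_true hb hr hr', hi', hb', ?_⟩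
        push_cast
        linarith
      · refine ⟨_, s, .while_false hb, hs, hb, ?_⟩
        push_cast
        linarith
  obtain ⟨N, hN⟩ := exists_nat_gt (Φ s₀)
  refine (key N s₀ (Frame.refl _ _) h0 hN).frame.mono fun s' T h => ⟨?_, h.2⟩
  exact h.1.weaken (fun _ h => h) (fun _ h => h) (fun _ h => h) fun _ h => h

/-! ### Evaluation of straight-line code -/

section Eval

variable (x v a i : ℕ) (w : ℝ)

theorem setNat_natVar (y : ℕ) :
    (s.setNat x v).natVar y = if y = x then v else s.natVar y := by
  simp [State.setNat, Function.update_apply]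

theorem setReal_realVar (y : ℕ) :
    (s.setReal x w).realVar y = if y = x then w else s.realVar y := by
  simp [State.setReal, Function.update_apply]

theorem storeNat_natArr (b k : ℕ) : (s.storeNat a i v).natArr b k =
    if b = a then (if k = i then v else s.natArr b k) else s.natArr b k := by
  by_cases h : b = a
  · subst h; simp [State.storeNat, Function.update_apply]
  · simp [State.storeNat, h]

theorem storeReal_realArr (b k : ℕ) : (s.storeReal a i w).realArr b k =
    if b = a then (if k = i then w else s.realArr b k) else s.realArr b k := by
  by_cases h : b = a
  · subst h; simp [State.storeReal, Function.update_apply]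
  · simp [State.storeReal, h]

theorem setNat_realVar : (s.setNat x v).realVar = s.realVar := rfl
theorem setNat_natArr : (s.setNat x v).natArr = s.natArr := rfl
theorem setNat_realArr : (s.setNat x v).realArr = s.realArr := rfl
theorem setReal_natVar : (s.setReal x w).natVar = s.natVar := rfl
theorem setReal_natArr : (s.setReal x w).natArr = s.natArr := rfl
theorem setReal_realArr : (s.setReal x w).realArr = s.realArr := rfl
theorem storeNat_natVar : (s.storeNat a i v).natVar = s.natVar := rfl
theorem storeNat_realVar : (s.storeNat a i v).realVar = s.realVar := rfl
theorem storeNat_realArr : (s.storeNat a i v).realArr = s.realArr := rfl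
theorem storeReal_natVar : (s.storeReal a i w).natVar = s.natVar := rfl
theorem storeReal_realVar : (s.storeReal a i w).realVar = s.realVar := rfl
theorem storeReal_natArr : (s.storeReal a i w).natArr = s.natArr := rfl

end Eval

attribute [local simp] exec_skip exec_setNat exec_setReal exec_storeNat exec_storeReal exec_seq
  exec_ite setNat_natVar setReal_realVar storeNat_natArr storeReal_realArr setNat_realVar
  setNat_natArr setNat_realArr setReal_natVar setReal_natArr setReal_realArr storeNat_natVar
  storeNat_realVar storeNat_realArr storeReal_natVar storeReal_realVar storeReal_natArr
  NatExpr.eval RealExpr.eval Test.Holds NatExpr.cost RealExpr.cost Test.cost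

/-! ### Doubling -/

/-- `x := 1`, then `x` is doubled while `2 * x * L ≤ t` and `x ≤ cap`. -/
def doubling (x cap L t : ℕ) : Program :=
  .seq (.setNat x (.lit 1))
    (.while (.and (.realLe (.mul (.ofNat (.add (.var x) (.var x))) (.ofNat (.lit L))) (.var t))
      (.natLe (.var x) (.var cap))) (.setNat x (.add (.var x) (.var x))))

/-- Reals cannot be rounded, so the quotient t / L is approximated within a factor 2 by a power of
two. The cap keeps the time logarithmic when t is huge; exceeding it is harmless, as the jump or
stride then passes the end. The case κ = 0 is the unit jump, which needs no slack. -/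
theorem exec_doubling {x cap L t : ℕ} (hx : cap ≠ x) (s : State) :
    Exec c (doubling x cap L t) s fun s' T => Frame (doubling x cap L t) s s' ∧
      ((T : ℝ) ≤ 18 * Nat.log 2 (s.natVar cap) + 34) ∧
      ∃ κ : ℕ, s'.natVar x = 2 ^ κ ∧ (κ = 0 ∨ (2 : ℝ) ^ κ * L ≤ s.realVar t) ∧
        (s.natVar cap < 2 ^ κ ∨ s.realVar t ≤ 2 * (2 ^ κ * L)) ∧
        (κ = 0 ∨ 2 ^ κ ≤ 2 * s.natVar cap) := by
  apply Exec.frame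
  unfold doubling
  simp only [exec_seq, exec_setNat]
  refine (Exec.while (fun s' => ∃ κ : ℕ, s'.natVar x = 2 ^ κ ∧
      (κ = 0 ∨ (2 : ℝ) ^ κ * L ≤ s.realVar t) ∧ (κ = 0 ∨ 2 ^ κ ≤ 2 * s.natVar cap))
    (fun s' => 18 * ((Nat.log 2 (s.natVar cap) : ℝ) + 1 - Nat.log 2 (s'.natVar x)))
    ?_ ?_ ?_).mono ?_
  · rintro s' ⟨κ, hκ, -, h2⟩
    rw [hκ, Nat.log_pow (by norm_num)]
    have : κ ≤ Nat.log 2 (s.natVar cap) + 1 := by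
      rcases h2 with rfl | h2
      · omega
      · rcases κ with _ | κ
        · omega
        · rw [pow_succ, mul_comm] at h2
          have := Nat.le_log_of_pow_le (b := 2) (by norm_num)
            (Nat.le_of_mul_le_mul_left h2 (by norm_num))
          omega
    have h3 : (κ : ℝ) ≤ Nat.log 2 (s.natVar cap) + 1 := by exact_mod_cast this
    linarith
  · rintro s' hf ⟨κ, hκ, -, -⟩ ⟨hb1, hb2⟩
    have hcap : s'.natVar cap = s.natVar cap := by
      rw [hf.natVar cap (by simpa [Program.natVars] using hx)]
      simp [hx]
    have ht : s'.realVar t = s.realVar t := hf.realVar t (by simp [Program.realVars])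
    simp only [Test.Holds, NatExpr.eval, RealExpr.eval, hκ, hcap, ht] at hb1 hb2
    simp only [exec_setNat, NatExpr.eval, setNat_natVar, if_true, hκ]
    have e : 2 ^ κ + 2 ^ κ = 2 ^ (κ + 1) := by ring
    refine ⟨⟨κ + 1, e, Or.inr ?_, Or.inr ?_⟩, ?_⟩
    · rw [e] at hb1
      exact_mod_cast hb1
    · rw [← e]; omega
    · rw [e, Nat.log_pow (by norm_num), Nat.log_pow (by norm_num)]
      simp only [NatExpr.cost, Test.cost, RealExpr.cost]
      push_cast
      linarith
  · exact ⟨0, by simp, Or.inl rfl, Or.inl rfl⟩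
  · rintro s' T ⟨hf, ⟨κ, hκ, h1, h2⟩, hb, hT⟩
    have hcap : s'.natVar cap = s.natVar cap := by
      rw [hf.natVar cap (by simpa [Program.natVars] using hx)]
      simp [hx]
    have ht : s'.realVar t = s.realVar t := hf.realVar t (by simp [Program.realVars])
    have e : 2 ^ κ + 2 ^ κ = 2 ^ (κ + 1) := by ring
    refine ⟨?_, κ, hκ, h1, ?_, h2⟩
    · simp only [hκ, Nat.log_pow (by norm_num : 1 < 2), setNat_natVar, NatExpr.eval, if_true,
        NatExpr.cost, Test.cost, RealExpr.cost, Nat.log_one_right] at hT ⊢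
      have h3 : (κ : ℝ) ≤ Nat.log 2 (s.natVar cap) + 1 := by
        rcases h2 with rfl | h2
        · push_cast; positivity
        · rcases κ with _ | κ
          · push_cast; positivity
          · rw [pow_succ, mul_comm] at h2
            have := Nat.le_log_of_pow_le (b := 2) (by norm_num)
              (Nat.le_of_mul_le_mul_left h2 (by norm_num))
            exact_mod_cast Nat.succ_le_succ this
      push_cast at hT ⊢
      linarith
    · simp only [Test.Holds, NatExpr.eval, RealExpr.eval, hκ, hcap, ht, e, not_and_or, not_le]
        at hb
      rcases hb with hb | hb
      · right
        push_cast at hb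
        rw [pow_succ] at hb
        linarith
      · exact Or.inl hb

/-! ### Scanning a row -/

/-- The value of the distance of `p_i` and `q_j` in the memory `s`. -/
def State.cellDist (c : ℝ≥0∞) (s : State) (i j : ℕ) : ℝ :=
  lcNorm c (s.realArr 0 i - s.realArr 2 j) (s.realArr 1 i - s.realArr 3 j)

/-- The memory holds two curves of `n` and `m` vertices with the distances `f`. -/
structure Loaded (c : ℝ≥0∞) (f : ℕ → ℕ → ℝ) (n m : ℕ) (s : State) : Prop where
  natVar_zero : s.natVar 0 = n
  natVar_one : s.natVar 1 = m
  cellDist_eq : ∀ i < n, ∀ j < m, s.cellDist c i j = f i j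

theorem Loaded.of_eq {f : ℕ → ℕ → ℝ} {n m : ℕ} {s s' : State} (h : Loaded c f n m s)
    (h0 : s'.natVar 0 = s.natVar 0) (h1 : s'.natVar 1 = s.natVar 1)
    (ha : ∀ a < 4, s'.realArr a = s.realArr a) : Loaded c f n m s' :=
  ⟨h0.trans h.1, h1.trans h.2, fun i hi j hj => by
    rw [← h.3 i hi j hj]
    simp [State.cellDist, ha]⟩

/-- The distance of the current vertices. -/
def distance : Program :=
  .setReal 2 (.norm (.sub (.get 0 (.var 3)) (.get 2 (.var 4)))
    (.sub (.get 1 (.var 3)) (.get 3 (.var 4))))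

/-- Computes the distance `d` of the current vertices and a length `g` of a jump. -/
def probe (L : ℕ) : Program :=
  .seq distance
    (.seq (.ite (.realLe (.var 1) (.var 2)) (.setReal 3 (.sub (.var 2) (.var 1)))
      (.setReal 3 (.sub (.var 1) (.var 2)))) (doubling 5 1 L 3))

theorem exec_probe {f : ℕ → ℕ → ℝ} {n m : ℕ} (L : ℕ) {s : State} (hs : Loaded c f n m s)
    {i j : ℕ} (h3 : s.natVar 3 = i) (h4 : s.natVar 4 = j) (hi : i < n) (hj : j < m) :
    Exec c (probe L) s fun s' T => Frame (probe L) s s' ∧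
      ((T : ℝ) ≤ 18 * Nat.log 2 m + 54) ∧ s'.realVar 2 = f i j ∧
      ∃ κ : ℕ, s'.natVar 5 = 2 ^ κ ∧ (κ = 0 ∨ (2 : ℝ) ^ κ * L ≤ |f i j - s.realVar 1|) ∧
        (m < 2 ^ κ ∨ |f i j - s.realVar 1| ≤ 2 * (2 ^ κ * L)) ∧ 2 ^ κ ≤ 2 * m := by
  apply Exec.frame
  have hd := hs.cellDist_eq i hi j hj
  unfold State.cellDist at hd
  have key : ∀ s₁ : State, s₁.natVar 1 = m → s₁.realVar 2 = f i j →
      s₁.realVar 3 = |f i j - s.realVar 1| → Exec c (doubling 5 1 L 3) s₁ fun s' T =>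
        ((12 + (3 + 1 + 4) + T : ℕ) : ℝ) ≤ 18 * Nat.log 2 m + 54 ∧ s'.realVar 2 = f i j ∧
        ∃ κ : ℕ, s'.natVar 5 = 2 ^ κ ∧ (κ = 0 ∨ (2 : ℝ) ^ κ * L ≤ |f i j - s.realVar 1|) ∧
          (m < 2 ^ κ ∨ |f i j - s.realVar 1| ≤ 2 * (2 ^ κ * L)) ∧ 2 ^ κ ≤ 2 * m := by
    intro s₁ k1 k2 k3
    refine (exec_doubling (by norm_num) s₁).mono ?_
    rintro s' T ⟨hf, hT, κ, hκ, e1, e2, e3⟩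
    rw [k1] at hT e2 e3
    rw [k3] at e1 e2
    refine ⟨?_, ?_, κ, hκ, e1, e2, ?_⟩
    · push_cast; linarith
    · rw [hf.realVar 2 (by simp [doubling, Program.realVars]), k2]
    · rcases e3 with rfl | e3
      · simp; omega
      · exact e3
  unfold probe distance
  simp only [exec_seq, exec_setReal, exec_ite, RealExpr.eval, NatExpr.eval, Test.Holds, h3, h4, hd,
    setReal_realVar, RealExpr.cost, NatExpr.cost, Test.cost, if_true]
  refine ⟨fun h => ?_, fun h => ?_⟩
  · have h : s.realVar 1 ≤ f i j := by simpa using h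
    refine (key _ ?_ ?_ ?_).mono fun s' T h => ?_
    · exact hs.natVar_one
    · simp
    · simp [abs_of_nonneg (sub_nonneg.2 h)]
    · push_cast at h ⊢
      exact ⟨by linarith [h.1], h.2⟩
  · have h : f i j < s.realVar 1 := by simpa using h
    refine (key _ ?_ ?_ ?_).mono fun s' T h => ?_
    · exact hs.natVar_one
    · simp
    · rw [abs_sub_comm]
      simp [abs_of_nonneg (sub_nonneg.2 h.le)]
    · push_cast at h ⊢
      exact ⟨by linarith [h.1], h.2⟩

end RealRAM


namespace RealRAM

variable {c : ℝ≥0∞} {s : State}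

/-! ### The exact dynamic program for small distances -/

theorem setReal_self (x : ℕ) : s.setReal x (s.realVar x) = s := by
  simp [State.setReal]

theorem exec_max (x : ℕ) (e : RealExpr) :
    Exec c (.ite (.realLe (.var x) e) (.setReal x e) .skip) s fun s' T =>
      s' = s.setReal x (max (s.realVar x) (e.eval c s)) ∧ T ≤ 2 * e.cost + 5 := by
  simp only [exec_ite, exec_setReal, exec_skip, Test.Holds, Test.cost, RealExpr.eval, RealExpr.cost]
  refine ⟨fun h => ⟨by rw [max_eq_right h], by omega⟩, fun h => ⟨?_, by omega⟩⟩
  rw [max_eq_left (not_le.1 h).le, setReal_self]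

theorem exec_min (x : ℕ) (e : RealExpr) :
    Exec c (.ite (.realLe e (.var x)) (.setReal x e) .skip) s fun s' T =>
      s' = s.setReal x (min (e.eval c s) (s.realVar x)) ∧ T ≤ 2 * e.cost + 5 := by
  simp only [exec_ite, exec_setReal, exec_skip, Test.Holds, Test.cost, RealExpr.eval, RealExpr.cost]
  refine ⟨fun h => ⟨by rw [min_eq_left h], by omega⟩, fun h => ⟨?_, by omega⟩⟩
  rw [min_eq_right (not_le.1 h).le, setReal_self]

/-- Stores `1 - v`, where `v` is the bottleneck value of the current cell; `0` stands for an
unreachable cell. -/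
def sparseCell : Program :=
  .seq (.setReal 6 (.get 4 (.add (.var 10) (.var 4))))
  (.seq (.ite (.realLe (.var 6) (.get 4 (.add (.add (.var 10) (.var 4)) (.lit 1))))
    (.setReal 6 (.get 4 (.add (.add (.var 10) (.var 4)) (.lit 1)))) .skip)
  (.seq (.ite (.realLe (.var 6) (.get 4 (.add (.var 9) (.var 4))))
    (.setReal 6 (.get 4 (.add (.var 9) (.var 4)))) .skip)
  (.seq (.ite (.realLe (.sub (.ofNat (.lit 1)) (.var 2)) (.var 6))
    (.setReal 6 (.sub (.ofNat (.lit 1)) (.var 2))) .skip)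
  (.storeReal 4 (.add (.add (.var 9) (.var 4)) (.lit 1)) (.var 6)))))

theorem exec_sparseCell (s : State) {u v j : ℕ} (hu : s.natVar 10 = u) (hv : s.natVar 9 = v)
    (hj : s.natVar 4 = j) :
    Exec c sparseCell s fun s' T => Frame sparseCell s s' ∧ T ≤ 100 ∧
      s'.realArr 4 = Function.update (s.realArr 4) (v + j + 1) (min (1 - s.realVar 2)
        (max (max (s.realArr 4 (u + j)) (s.realArr 4 (u + j + 1))) (s.realArr 4 (v + j)))) := by
  apply Exec.frame
  unfold sparseCell
  rw [exec_seq, exec_setReal, exec_seq]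
  refine (exec_max _ _).mono ?_
  rintro _ T1 ⟨rfl, h1⟩
  rw [exec_seq]
  refine (exec_max _ _).mono ?_
  rintro _ T2 ⟨rfl, h2⟩
  rw [exec_seq]
  refine (exec_min _ _).mono ?_
  rintro _ T3 ⟨rfl, h3⟩
  simp only [RealExpr.cost, NatExpr.cost] at h1 h2 h3
  simp only [exec_storeReal, RealExpr.cost, NatExpr.cost, NatExpr.eval, RealExpr.eval,
    setReal_realVar, setReal_natVar, setReal_realArr, hu, hv, hj, if_true]
  refine ⟨by omega, ?_⟩
  simp [State.storeReal, setReal_realArr]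

/-- Treats a cell with all cells that are skipped after it. -/
def sparseStep (L : ℕ) : Program :=
  .seq (probe L) (.seq (.ite (.realLe (.var 2) (.var 1)) sparseCell .skip)
    (.setNat 4 (.add (.var 4) (.var 5))))

def sparseRow (L : ℕ) : Program :=
  .seq (.setNat 9 (.add (.add (.var 10) (.var 1)) (.lit 1)))
    (.seq (.setNat 4 (.lit 0)) (.while (.not (.natLe (.var 1) (.var 4))) (sparseStep L)))

/-- Computes the discrete Fréchet distance if it is at most `ε`. -/
def sparseDP (L : ℕ) : Program :=
  .seq (.setReal 1 (.var 0)) (.seq (.storeReal 4 (.lit 0) (.ofNat (.lit 1)))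
    (.seq (.setNat 10 (.lit 0)) (.seq (.setNat 3 (.lit 0))
      (.while (.not (.natLe (.var 0) (.var 3)))
        (.seq (sparseRow L) (.seq (.setNat 10 (.var 9)) (.setNat 3 (.add (.var 3) (.lit 1)))))))))

section

attribute [local simp] sparseDP sparseRow sparseStep sparseCell probe distance doubling
  Program.natVars Program.realVars Program.natArrs Program.realArrs

variable {f : ℕ → ℕ → ℝ} {n m L K : ℕ} {ℓ ε J : ℝ}

/-- The part of the table `Y` from the address `u` on holds row `i` of the dynamic program, up to
column `p`. -/
def SparseRowSpec (f : ℕ → ℕ → ℝ) (ε : ℝ) (Y : ℕ → ℝ) (i u : ℕ) (p : ℕ) : Prop :=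
  ∀ q ≤ p, ∀ x, 0 ≤ x → x ≤ ε → (reach (fun i j => f i j ≤ x) i q ↔ 1 - x ≤ Y (u + q))

/-- One table serves all thresholds x ≤ ε, since it stores bottleneck values. Every row has a fresh
block of m + 1 addresses, so skipped entries still hold the initial 0. This reads as unreachable
because 0 < 1 - x for x ≤ ε < 1. -/
theorem exec_sparseRow (hs : Loaded c f n m s) {i u : ℕ} (h3 : s.natVar 3 = i) (hi : i < n)
    (hD : s.realVar 1 = ε) (hε : ε < 1) (hf0 : ∀ i j, 0 ≤ f i j) (hL : 1 ≤ L) (hℓ : ℓ < L)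
    (hf : ∀ i < n, ∀ j, j + 1 < m → |f i (j + 1) - f i j| ≤ ℓ) (hK : m < 2 ^ K)
    (hJ : jumpPotential K (3 * L) (fun j => |f i j - ε|) m 0 ≤ J) (hu : s.natVar 10 = u)
    (hprev : SparseRowSpec f ε (s.realArr 4) i u m) (hzero : ∀ a, u + m < a → s.realArr 4 a = 0) :
    Exec c (sparseRow L) s fun s' T => Frame (sparseRow L) s s' ∧ s'.natVar 9 = u + m + 1 ∧
      SparseRowSpec f ε (s'.realArr 4) (i + 1) (u + m + 1) m ∧
      (∀ a, u + m + 1 + m < a → s'.realArr 4 a = 0) ∧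
      (T : ℝ) ≤ (18 * Nat.log 2 m + 200) * J + 20 := by
  apply Exec.frame
  unfold sparseRow
  set v := u + m + 1 with hv
  set A : ℝ := 18 * Nat.log 2 m + 200 with hA
  have hA0 : 0 ≤ A := by positivity
  have hL1 : (1 : ℝ) ≤ L := by exact_mod_cast hL
  simp only [exec_seq, exec_setNat]
  refine (Exec.while (fun s' => SparseRowSpec f ε (s'.realArr 4) i u m ∧
      SparseRowSpec f ε (s'.realArr 4) (i + 1) v (min (s'.natVar 4) m) ∧
      ∀ a, v + min (s'.natVar 4) m < a → s'.realArr 4 a = 0)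
    (fun s' => A * jumpPotential K (3 * L) (fun j => |f i j - ε|) m (s'.natVar 4))
    (fun s' _ => mul_nonneg hA0 (jumpPotential_nonneg _)) ?_ ?_).mono ?_
  · rintro s₁ hfr ⟨hp, hc, hz⟩ hb
    have hs₁ : Loaded c f n m s₁ := by
      refine hs.of_eq ?_ ?_ fun a ha => ?_
      · rw [hfr.natVar 0 (by simp)]; simp [setNat_natVar]
      · rw [hfr.natVar 1 (by simp)]; simp [setNat_natVar]
      · rw [hfr.realArr a (by simp; omega)]; rfl
    have e1 : s₁.natVar 1 = m := hs₁.natVar_one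
    have hj : s₁.natVar 4 < m := by simpa [Test.Holds, NatExpr.eval, e1] using hb
    have e3 : s₁.natVar 3 = i := by rw [hfr.natVar 3 (by simp)]; simp [setNat_natVar, h3]
    have e9 : s₁.natVar 9 = v := by
      rw [hfr.natVar 9 (by simp)]
      simp [setNat_natVar, NatExpr.eval, hu, hs.natVar_one, hv]
    have e10 : s₁.natVar 10 = u := by rw [hfr.natVar 10 (by simp)]; simp [setNat_natVar, hu]
    have eD : s₁.realVar 1 = ε := by rw [hfr.realVar 1 (by simp)]; exact hD
    set j := s₁.natVar 4 with hjdef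
    rw [min_eq_left hj.le] at hc hz
    unfold sparseStep
    rw [exec_seq]
    refine (exec_probe L hs₁ e3 hjdef.symm hi hj).mono ?_
    rintro s₂ T₂ ⟨hfr₂, hT₂, hd, κ, hg, hg1, hg2, -⟩
    rw [eD] at hg1 hg2
    have hjump := jumpPotential_jump (K := K) (L := L) (x := fun j => |f i j - ε|) (by positivity)
      hℓ.le (fun j hj => (abs_abs_sub_abs_le _ _).trans (by
        rw [sub_sub_sub_cancel_right]; exact hf i hi j hj)) hj hK hg2
    have a4 : s₂.realArr 4 = s₁.realArr 4 := hfr₂.realArr 4 (by simp)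
    have a1 : s₂.realVar 1 = ε := by rw [hfr₂.realVar 1 (by simp), eD]
    have b4 : s₂.natVar 4 = j := hfr₂.natVar 4 (by simp)
    simp only [exec_seq, exec_ite, exec_skip, exec_setNat, Test.Holds, RealExpr.eval, NatExpr.eval,
      hd, a1, setNat_natVar, setNat_realArr, if_true, Test.cost, RealExpr.cost, NatExpr.cost]
    refine ⟨fun hfree => ?_, fun hbl => ?_⟩
    · refine (exec_sparseCell s₂ (u := u) (v := v) (j := j) ?_ ?_ b4).mono ?_
      · rw [hfr₂.natVar 10 (by simp), e10]
      · rw [hfr₂.natVar 9 (by simp), e9]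
      rintro s₃ T₃ ⟨hfr₃, hT₃, hY⟩
      rw [hfr₃.natVar 4 (by simp), hfr₃.natVar 5 (by simp), b4, hg]
      -- A cell of value at most ε has slack below 1 ≤ L, so no jump starts there: every cell that
      -- may be reachable is written.
      have hκ : κ = 0 := by
        refine hg1.resolve_right fun h => ?_
        have : |f i j - ε| < 1 := abs_lt.2 ⟨by linarith [hf0 i j], by linarith [hf0 i j]⟩
        have h2 : (1 : ℝ) ≤ 2 ^ κ := one_le_pow₀ (by norm_num)
        nlinarith
      subst hκ
      rw [pow_zero] at hjump ⊢
      rw [min_eq_left (show j + 1 ≤ m from hj)]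
      rw [hY, hd, a4]
      refine ⟨⟨fun q hq x hx0 hx => ?_, fun q hq x hx0 hx => ?_, fun a ha => ?_⟩, ?_⟩
      · rw [Function.update_of_ne (by omega)]
        exact hp q hq x hx0 hx
      · rcases Nat.lt_or_ge j q with h | h
        · obtain rfl : q = j + 1 := by omega
          rw [← add_assoc, Function.update_self, reach_succ_succ, hp j hj.le x hx0 hx,
            hp (j + 1) hj x hx0 hx, hc j le_rfl x hx0 hx, le_min_iff, le_max_iff, le_max_iff, or_assoc,
            ← add_assoc]
          exact and_congr ⟨fun h => by linarith, fun h => by linarith⟩ Iff.rfl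
        · rw [Function.update_of_ne (by omega)]
          exact hc q h x hx0 hx
      · rw [Function.update_of_ne (by omega)]
        exact hz a (by omega)
      · have := mul_le_mul_of_nonneg_left hjump hA0
        have hT₃' : (T₃ : ℝ) ≤ 100 := by exact_mod_cast hT₃
        push_cast
        linarith
    · rw [b4, hg, a4]
      refine ⟨⟨hp, fun q hq x hx0 hx => ?_, fun a ha => hz a (by omega)⟩, ?_⟩
      · rcases Nat.lt_or_ge j q with h | h
        · obtain ⟨q, rfl⟩ : ∃ q', q = q' + 1 := ⟨q - 1, by omega⟩
          -- All cells of a jump from a blocked cell exceed ε, hence every threshold x ≤ ε.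
          have h1 : ¬ f i q ≤ x := fun h1 => hbl <| (le_iff_of_jump (g := 2 ^ κ) hℓ (hf i hi) (by
            rcases hg1 with rfl | h
            · exact Or.inl (pow_zero 2)
            · exact Or.inr (by exact_mod_cast h)) q (by omega) (by omega) (by omega)).1
              (h1.trans hx)
          rw [reach_succ_succ, hz _ (by omega)]
          simp only [h1, false_and, false_iff, not_le]
          linarith
        · exact hc q h x hx0 hx
      · have := mul_le_mul_of_nonneg_left hjump hA0
        push_cast
        linarith
  · refine ⟨hprev, fun q hq x hx0 hx => ?_, fun a ha => hzero a ?_⟩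
    · have hq0 : q = 0 := by simpa [setNat_natVar, NatExpr.eval] using hq
      subst hq0
      simp only [setNat_realArr]
      rw [hzero _ (by omega)]
      simp only [reach_succ_zero, false_iff, not_le]
      linarith
    · simp [setNat_natVar, NatExpr.eval] at ha
      omega
  · rintro s' T ⟨hfr, ⟨hp, hc, hz⟩, hb, hT⟩
    have e1 : s'.natVar 1 = m := by
      rw [hfr.natVar 1 (by simp)]; simp [setNat_natVar, hs.natVar_one]
    have hj : m ≤ s'.natVar 4 := by simpa [Test.Holds, NatExpr.eval, e1] using hb
    rw [min_eq_right hj] at hc hz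
    refine ⟨?_, hc, hz, ?_⟩
    · rw [hfr.natVar 9 (by simp)]
      simp [setNat_natVar, NatExpr.eval, hu, hs.natVar_one, hv]
    · have h1 := mul_nonneg hA0 (jumpPotential_nonneg (K := K) (H := 3 * L)
        (x := fun j => |f i j - ε|) (m := m) (s'.natVar 4))
      have h2 := mul_le_mul_of_nonneg_left hJ hA0
      simp [setNat_natVar, NatExpr.eval, NatExpr.cost, Test.cost] at hT ⊢
      linarith

theorem exec_sparseDP (hs : Loaded c f n m s)
    (hD : s.realVar 0 = ε) (hε : ε < 1) (hf0 : ∀ i j, 0 ≤ f i j) (hL : 1 ≤ L) (hℓ : ℓ < L)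
    (hf : ∀ i < n, ∀ j, j + 1 < m → |f i (j + 1) - f i j| ≤ ℓ) (hK : m < 2 ^ K) 
    (hJ0 : 0 ≤ J) (hJ : ∀ i < n, jumpPotential K (3 * L) (fun j => |f i j - ε|) m 0 ≤ J)
    (hzero : s.realArr 4 = 0) :
    Exec c (sparseDP L) s fun s' T => Frame (sparseDP L) s s' ∧
      (∀ x, 0 ≤ x → x ≤ ε →
        (reach (fun i j => f i j ≤ x) n m ↔ 1 - x ≤ s'.realArr 4 (s'.natVar 10 + m))) ∧
      (T : ℝ) ≤ n * ((18 * Nat.log 2 m + 200) * J + 40) + 20 := by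
  apply Exec.frame
  unfold sparseDP
  set A : ℝ := (18 * Nat.log 2 m + 200) * J + 40 with hA
  have hA0 : 0 ≤ A := by positivity
  simp only [exec_seq, exec_setNat, exec_setReal, exec_storeReal]
  refine (Exec.while (fun s' => s'.natVar 3 ≤ n ∧
      SparseRowSpec f ε (s'.realArr 4) (s'.natVar 3) (s'.natVar 10) m ∧
      ∀ a, s'.natVar 10 + m < a → s'.realArr 4 a = 0)
    (fun s' => A * (n - s'.natVar 3)) (fun s' h => ?_) ?_ ?_).mono ?_
  · have : (s'.natVar 3 : ℝ) ≤ n := by exact_mod_cast h.1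
    exact mul_nonneg hA0 (by linarith)
  · rintro s₁ hfr ⟨hn, hp, hz⟩ hb
    have hs₁ : Loaded c f n m s₁ := by
      refine hs.of_eq ?_ ?_ fun a ha => ?_
      · rw [hfr.natVar 0 (by simp)]; simp [setNat_natVar, storeReal_natVar, setReal_natVar]
      · rw [hfr.natVar 1 (by simp)]; simp [setNat_natVar, storeReal_natVar, setReal_natVar]
      · rw [hfr.realArr a (by simp; omega)]
        funext k
        simp [setNat_realArr, storeReal_realArr, setReal_realArr, ha.ne]
    have hi : s₁.natVar 3 < n := by
      simpa [Test.Holds, NatExpr.eval, hs₁.natVar_zero] using hb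
    have eD : s₁.realVar 1 = ε := by
      rw [hfr.realVar 1 (by simp)]
      simp [setNat_realVar, storeReal_realVar, setReal_realVar, RealExpr.eval, hD]
    rw [exec_seq]
    refine (exec_sparseRow hs₁ rfl hi eD hε hf0 hL hℓ hf hK (hJ _ hi) rfl hp hz).mono ?_
    rintro s₂ T ⟨hfr₂, h9, hp₂, hz₂, hT⟩
    simp only [exec_seq, exec_setNat, setNat_natVar, setNat_realArr, NatExpr.eval, NatExpr.cost,
      h9, hfr₂.natVar 3 (by simp)]
    refine ⟨⟨hi, hp₂, hz₂⟩, ?_⟩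
    simp [Test.cost, NatExpr.cost]
    linarith
  · simp only [setNat_natVar, setNat_realArr, NatExpr.eval, storeReal_realArr, setReal_realArr,
      storeReal_natVar, setReal_natVar, hzero, RealExpr.eval]
    -- Row 0 is the virtual start: address 0 holds 1, which encodes bottleneck value 0, and the rest
    -- of the row is still 0.
    refine ⟨by simp, fun q hq x hx0 hx => ?_, fun a ha => ?_⟩
    · by_cases hq0 : q = 0
      · simp [storeReal_realArr, hq0, hx0]
      · simp only [storeReal_realArr, setReal_realArr, hzero]
        simp [hq0]
        linarith
    · have : a ≠ 0 := by
        rintro rfl; simp at ha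
      simp [this]
  · rintro s' T ⟨hfr, ⟨hn, hp, hz⟩, hb, hT⟩
    have e0 : s'.natVar 0 = n := by
      rw [hfr.natVar 0 (by simp)]
      simp [setNat_natVar, storeReal_natVar, setReal_natVar, hs.natVar_zero]
    have hj : n ≤ s'.natVar 3 := by simpa [Test.Holds, NatExpr.eval, e0] using hb
    have hj' : s'.natVar 3 = n := le_antisymm hn hj
    refine ⟨fun x hx0 hx => ?_, ?_⟩
    · rw [← hp m le_rfl x hx0 hx, hj']
    · rw [hj'] at hT
      simp [setNat_natVar, NatExpr.eval, NatExpr.cost, Test.cost, RealExpr.cost] at hT ⊢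
      linarith

end

end RealRAM


/-! ### Sorted lists of intervals -/

/-- The entries `[A x, B x]` for `a ≤ x < z` are disjoint intervals in increasing order; up to the
column `min e m` they make up the set `R`. -/
structure IntervalList (A B : ℕ → ℕ) (a z e m : ℕ) (R : ℕ → Prop) : Prop where
  fst_le_snd : ∀ x, a ≤ x → x < z → A x ≤ B x
  snd_lt_fst : ∀ x y, a ≤ x → x < y → y < z → B x < A y
  fst_le : ∀ x, a ≤ x → x < z → A x ≤ m
  snd_le : ∀ x, a ≤ x → x < z → B x ≤ e
  cover : ∀ p ≤ min e m, R p ↔ ∃ x, a ≤ x ∧ x < z ∧ A x ≤ p ∧ p ≤ B x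

namespace IntervalList

variable {A B A' B' : ℕ → ℕ} {a z e e' m : ℕ} {R R' : ℕ → Prop}

theorem congr (h : IntervalList A B a z e m R) (hA : ∀ x, a ≤ x → x < z → A' x = A x)
    (hB : ∀ x, a ≤ x → x < z → B' x = B x) : IntervalList A' B' a z e m R where
  fst_le_snd x h1 h2 := by rw [hA x h1 h2, hB x h1 h2]; exact h.fst_le_snd x h1 h2
  snd_lt_fst x y h1 h2 h3 := by
    rw [hB x h1 (by omega), hA y (by omega) h3]; exact h.snd_lt_fst x y h1 h2 h3
  fst_le x h1 h2 := by rw [hA x h1 h2]; exact h.fst_le x h1 h2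
  snd_le x h1 h2 := by rw [hB x h1 h2]; exact h.snd_le x h1 h2
  cover p hp := by
    rw [h.cover p hp]
    refine exists_congr fun x => and_congr_right fun h1 => and_congr_right fun h2 => ?_
    rw [hA x h1 h2, hB x h1 h2]

theorem skip (h : IntervalList A B a z e m R) (he : e ≤ e')
    (hR : ∀ p, e < p → p ≤ e' → p ≤ m → ¬ R p) : IntervalList A B a z e' m R where
  fst_le_snd := h.fst_le_snd
  snd_lt_fst := h.snd_lt_fst
  fst_le := h.fst_le
  snd_le x h1 h2 := (h.snd_le x h1 h2).trans he
  cover p hp := by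
    rw [le_min_iff] at hp
    by_cases hpe : p ≤ e
    · exact h.cover p (le_min hpe hp.2)
    · refine iff_of_false (hR p (by omega) hp.1 hp.2) ?_
      rintro ⟨x, h1, h2, -, h4⟩
      exact hpe (h4.trans (h.snd_le x h1 h2))

theorem snoc (h : IntervalList A B a z e m R) {α : ℕ} (haz : a ≤ z) (hα : e < α) (hα' : α ≤ e')
    (hαm : α ≤ m) (hR : ∀ p, e < p → p ≤ e' → p ≤ m → (R p ↔ α ≤ p)) :
    IntervalList (Function.update A z α) (Function.update B z e') a (z + 1) e' m R := by
  have hA : ∀ x, x < z → Function.update A z α x = A x := fun x hx =>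
    Function.update_of_ne (by omega) _ _
  have hB : ∀ x, x < z → Function.update B z e' x = B x := fun x hx =>
    Function.update_of_ne (by omega) _ _
  have hz : ∀ x, x < z + 1 → x < z ∨ x = z := fun x hx => by omega
  constructor
  · intro x h1 h2
    rcases hz x h2 with h2 | rfl
    · rw [hA x h2, hB x h2]; exact h.fst_le_snd x h1 h2
    · simpa using hα'
  · intro x y h1 h2 h3
    rw [hB x (by omega)]
    rcases hz y h3 with h3 | rfl
    · rw [hA y h3]; exact h.snd_lt_fst x y h1 h2 h3
    · rw [Function.update_self]; exact (h.snd_le x h1 h2).trans_lt hα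
  · intro x h1 h2
    rcases hz x h2 with h2 | rfl
    · rw [hA x h2]; exact h.fst_le x h1 h2
    · simpa using hαm
  · intro x h1 h2
    rcases hz x h2 with h2 | rfl
    · rw [hB x h2]; exact (h.snd_le x h1 h2).trans (by omega)
    · simp
  · intro p hp
    rw [le_min_iff] at hp
    by_cases hpe : p ≤ e
    · rw [h.cover p (le_min hpe hp.2)]
      constructor
      · rintro ⟨x, h1, h2, h3, h4⟩
        exact ⟨x, h1, by omega, by rwa [hA x h2], by rwa [hB x h2]⟩
      · rintro ⟨x, h1, h2, h3, h4⟩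
        rcases hz x h2 with h2 | rfl
        · exact ⟨x, h1, h2, by rwa [hA x h2] at h3, by rwa [hB x h2] at h4⟩
        · rw [Function.update_self] at h3
          omega
    · rw [hR p (by omega) hp.1 hp.2]
      constructor
      · exact fun h => ⟨z, haz, by omega, by simpa using h, by simpa using hp.1⟩
      · rintro ⟨x, h1, h2, h3, h4⟩
        rcases hz x h2 with h2 | rfl
        · rw [hB x h2] at h4
          exact absurd (h4.trans (h.snd_le x h1 h2)) hpe
        · simpa using h3

/-- Only the interval k matters: earlier ones end before j, and later ones begin after it. The first
possible entry is therefore at max j (A k). If no interval is left, k is the sentinel z, and A z > m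
rules out an entry. -/
theorem first_entry (h : IntervalList A B a z e m R) (hem : m ≤ e) (hz : m < A z) {j k : ℕ}
    (hak : a ≤ k) (hkz : k ≤ z) (hk : ∀ x, a ≤ x → x < k → B x < j) (hjk : j ≤ B k) (p : ℕ)
    (hjp : j < p) (hp : p ≤ m) : (∃ q, j ≤ q ∧ q ≤ p ∧ R q) ↔ A k ≤ p := by
  constructor
  · rintro ⟨q, h1, h2, hq⟩
    obtain ⟨x, h3, h4, h5, h6⟩ := (h.cover q (le_min (by omega) (by omega))).1 hq
    have hkx : k ≤ x := by
      by_contra hc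
      have := hk x h3 (by omega)
      omega
    rcases hkx.eq_or_lt with rfl | hkx
    · omega
    · have := h.snd_lt_fst k x hak hkx h4
      have := h.fst_le_snd k hak (by omega)
      omega
  · intro hA
    have hkz' : k < z := by
      rcases hkz.eq_or_lt with rfl | h
      · omega
      · exact h
    have hle := h.fst_le_snd k hak hkz'
    exact ⟨max j (A k), le_max_left _ _, max_le (by omega) hA,
      (h.cover _ (by simp only [le_min_iff, max_le_iff]; omega)).2
        ⟨k, hak, hkz', le_max_right _ _, max_le hjk hle⟩⟩

end IntervalList

namespace RealRAM

variable {c : ℝ≥0∞} {s : State}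

/-! ### The decision procedure -/

/-- Moves the pointer to the first interval of the previous row that ends at `j` or later. -/
def advance : Program :=
  .while (.not (.natLe (.var 4) (.get 1 (.var 6)))) (.setNat 6 (.add (.var 6) (.lit 1)))

/-- Appends the reachable part of the free segment that starts after column `j`. -/
def mergeCell : Program :=
  .seq advance (.seq (.setNat 9 (.add (.var 4) (.lit 1)))
    (.seq (.ite (.and (.natLe (.var 8) (.lit 0)) (.natLe (.var 9) (.get 0 (.var 6))))
      (.setNat 9 (.get 0 (.var 6))) .skip)
    (.ite (.natLe (.var 9) (.add (.var 4) (.var 5)))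
      (.seq (.storeNat 0 (.var 7) (.var 9)) (.seq (.storeNat 1 (.var 7) (.add (.var 4) (.var 5)))
        (.seq (.setNat 7 (.add (.var 7) (.lit 1))) (.setNat 8 (.lit 1)))))
      (.setNat 8 (.lit 0)))))

def decisionStep (L : ℕ) : Program :=
  .seq (probe L) (.seq (.ite (.realLe (.var 2) (.var 1)) mergeCell (.setNat 8 (.lit 0)))
    (.setNat 4 (.add (.var 4) (.var 5))))

/-- `4 * m`. -/
def sentinel : NatExpr := .add (.add (.var 1) (.var 1)) (.add (.var 1) (.var 1))

def decisionRow (L : ℕ) : Program :=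
  .seq (.setNat 10 (.var 7)) (.seq (.setNat 4 (.lit 0)) (.seq (.setNat 8 (.lit 0))
    (.seq (.while (.not (.natLe (.var 1) (.var 4))) (decisionStep L))
    (.seq (.storeNat 0 (.var 7) sentinel) (.seq (.storeNat 1 (.var 7) sentinel)
    (.seq (.setNat 7 (.add (.var 7) (.lit 1))) (.seq (.setNat 6 (.var 10))
    (.setNat 3 (.add (.var 3) (.var 2))))))))))

/-- Decides approximately whether the discrete Fréchet distance is at most the value of the real
variable `7`. -/
def decision (L : ℕ) : Program :=
  .seq (.setReal 3 (.mul (.var 0) (.var 7))) (.seq (doubling 2 0 L 3)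
    (.seq (.setReal 1 (.add (.var 7) (.div (.var 3) (.ofNat (.lit 8)))))
    (.seq (.storeNat 0 (.lit 0) (.lit 0)) (.seq (.storeNat 1 (.lit 0) (.lit 0))
    (.seq (.storeNat 0 (.lit 1) sentinel) (.seq (.storeNat 1 (.lit 1) sentinel)
    (.seq (.setNat 6 (.lit 0)) (.seq (.setNat 7 (.lit 2)) (.seq (.setNat 3 (.lit 0))
      (.while (.not (.natLe (.var 0) (.var 3))) (decisionRow L)))))))))))

section

attribute [local simp] decision decisionRow decisionStep mergeCell advance probe distance doubling
  Program.natVars Program.realVars Program.natArrs Program.realArrs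

/-- The time is stated through the displacement of the pointer, so that it telescopes over a row. -/
theorem exec_advance (s : State) {j k z : ℕ} (hj : s.natVar 4 = j) (hk : s.natVar 6 = k)
    (hkz : k ≤ z) (hz : j ≤ s.natArr 1 z) :
    Exec c advance s fun s' T => ∃ k', s' = s.setNat 6 k' ∧ k ≤ k' ∧ k' ≤ z ∧
      (∀ x, k ≤ x → x < k' → s.natArr 1 x < j) ∧ j ≤ s.natArr 1 k' ∧ T + 10 * k ≤ 10 * k' + 6 := by
  unfold advance
  refine (Exec.while (fun s' => ∃ k', s' = s.setNat 6 k' ∧ k ≤ k' ∧ k' ≤ z ∧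
    ∀ x, k ≤ x → x < k' → s.natArr 1 x < j) (fun s' => 10 * ((z : ℝ) - s'.natVar 6)) ?_ ?_ ?_).mono
    ?_
  · rintro _ ⟨k', rfl, h1, h2, h3⟩
    have : (k' : ℝ) ≤ z := by exact_mod_cast h2
    simp [setNat_natVar, this]
  · rintro _ - ⟨k', rfl, h1, h2, h3⟩ hb
    simp [Test.Holds, NatExpr.eval, setNat_natVar, setNat_natArr, hj] at hb
    simp only [exec_setNat, NatExpr.eval, setNat_natVar, if_true]
    refine ⟨⟨k' + 1, ?_, by omega, ?_, ?_⟩, ?_⟩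
    · simp [State.setNat]
    · rcases h2.eq_or_lt with rfl | h
      · omega
      · exact h
    · intro x hx hx'
      rcases Nat.lt_or_ge x k' with h | h
      · exact h3 x hx h
      · obtain rfl : x = k' := by omega
        exact hb
    · simp [NatExpr.cost, Test.cost]
      linarith
  · refine ⟨k, ?_, le_rfl, hkz, by intros; omega⟩
    rw [← hk]; simp [State.setNat]
  · rintro _ T ⟨-, ⟨k', rfl, h1, h2, h3⟩, hb, hT⟩
    simp [Test.Holds, NatExpr.eval, setNat_natVar, setNat_natArr, hj] at hb
    refine ⟨k', rfl, h1, h2, h3, hb, ?_⟩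
    simp [NatExpr.cost, Test.cost, setNat_natVar, hk] at hT
    have : (T : ℝ) + 10 * k ≤ 10 * k' + 6 := by linarith
    exact_mod_cast this

/-- Here α is the first reachable column of the free segment, in shifted indices. If the flag says
that column j is reachable, the walk continues from the left at j + 1. Otherwise it must enter from
the previous row, through the first interval that ends at j or later. -/
theorem exec_mergeCell (s : State) {j k z g o : ℕ} (hj : s.natVar 4 = j) (hg : s.natVar 5 = g)
    (hk : s.natVar 6 = k) (ho : s.natVar 7 = o) (hkz : k ≤ z) (hz : j ≤ s.natArr 1 z) :
    Exec c mergeCell s fun s' T => Frame mergeCell s s' ∧ ∃ k' α, s'.natVar 6 = k' ∧ k ≤ k' ∧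
      k' ≤ z ∧ (∀ x, k ≤ x → x < k' → s.natArr 1 x < j) ∧ j ≤ s.natArr 1 k' ∧
      T + 10 * k ≤ 10 * k' + 60 ∧
      α = (if s.natVar 8 = 0 then max (j + 1) (s.natArr 0 k') else j + 1) ∧
      ((α ≤ j + g ∧ s'.natArr 0 = Function.update (s.natArr 0) o α ∧
        s'.natArr 1 = Function.update (s.natArr 1) o (j + g) ∧ s'.natVar 7 = o + 1 ∧
        s'.natVar 8 = 1) ∨
       (¬ α ≤ j + g ∧ s'.natArr 0 = s.natArr 0 ∧ s'.natArr 1 = s.natArr 1 ∧ s'.natVar 7 = o ∧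
        s'.natVar 8 = 0)) := by
  apply Exec.frame
  unfold mergeCell
  rw [exec_seq]
  refine (exec_advance s hj hk hkz hz).mono ?_
  rintro _ T ⟨k', rfl, h1, h2, h3, h4, hT⟩
  set α := if s.natVar 8 = 0 then max (j + 1) (s.natArr 0 k') else j + 1 with hα
  -- Both branches of the first test leave α in variable 9, so the remaining code is treated once.
  have key : ∀ (s₁ : State) (T₁ : ℕ), s₁ = ((s.setNat 6 k').setNat 9 α) → T₁ ≤ 20 →
      Exec c (.ite (.natLe (.var 9) (.add (.var 4) (.var 5)))
      (.seq (.storeNat 0 (.var 7) (.var 9)) (.seq (.storeNat 1 (.var 7) (.add (.var 4) (.var 5)))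
        (.seq (.setNat 7 (.add (.var 7) (.lit 1))) (.setNat 8 (.lit 1)))))
      (.setNat 8 (.lit 0))) s₁ fun s' T' => ∃ k' α, s'.natVar 6 = k' ∧ k ≤ k' ∧
      k' ≤ z ∧ (∀ x, k ≤ x → x < k' → s.natArr 1 x < j) ∧ j ≤ s.natArr 1 k' ∧
      (T + (T₁ + T')) + 10 * k ≤ 10 * k' + 60 ∧
      α = (if s.natVar 8 = 0 then max (j + 1) (s.natArr 0 k') else j + 1) ∧
      ((α ≤ j + g ∧ s'.natArr 0 = Function.update (s.natArr 0) o α ∧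
        s'.natArr 1 = Function.update (s.natArr 1) o (j + g) ∧ s'.natVar 7 = o + 1 ∧
        s'.natVar 8 = 1) ∨
       (¬ α ≤ j + g ∧ s'.natArr 0 = s.natArr 0 ∧ s'.natArr 1 = s.natArr 1 ∧ s'.natVar 7 = o ∧
        s'.natVar 8 = 0)) := by
    rintro s₁ T₁ rfl hT₁
    simp only [exec_ite, exec_seq, exec_setNat, exec_storeNat, Test.Holds, NatExpr.eval,
      setNat_natVar, storeNat_natVar, Test.cost, NatExpr.cost]
    simp only [Nat.reduceEqDiff, if_false, if_true, hj, hg, ho]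
    refine ⟨fun h => ⟨k', α, rfl, h1, h2, h3, h4, by omega, hα, Or.inl ⟨h, ?_, ?_, trivial, trivial⟩⟩,
      fun h => ⟨k', α, rfl, h1, h2, h3, h4, by omega, hα, Or.inr ⟨h, rfl, rfl, trivial, trivial⟩⟩⟩
    · funext x
      simp [setNat_natArr, storeNat_natArr, Function.update_apply]
    · funext x
      simp [setNat_natArr, storeNat_natArr, Function.update_apply]
  simp only [exec_seq, exec_setNat]
  rw [exec_ite]
  simp only [exec_setNat, exec_skip, Test.Holds, NatExpr.eval, setNat_natVar, setNat_natArr,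
    Test.cost, NatExpr.cost, Nat.reduceEqDiff, if_false, if_true, hj]
  refine ⟨fun h => ?_, fun h => ?_⟩
  · refine (key _ 20 ?_ le_rfl).mono ?_
    · rw [hα, if_pos (by omega), max_eq_right h.2]
      simp [State.setNat]
    · rintro s' T' ⟨k'', α', a1, a2, a3, a4, a5, a6, a7⟩
      exact ⟨k'', α', a1, a2, a3, a4, a5, by omega, a7⟩
  · refine (key _ 20 ?_ le_rfl).mono ?_
    · have : α = j + 1 := by
        rw [hα]
        split_ifs with h8
        · have := not_and.1 h (by omega)
          omega
        · rfl
      rw [this]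
    · rintro s' T' ⟨k'', α', a1, a2, a3, a4, a5, a6, a7⟩
      exact ⟨k'', α', a1, a2, a3, a4, a5, by omega, a7⟩

end

end RealRAM


namespace RealRAM

variable {c : ℝ≥0∞} {s : State}

section

attribute [local simp] decision decisionRow decisionStep mergeCell advance probe distance doubling
  Program.natVars Program.realVars Program.natArrs Program.realArrs

variable {f : ℕ → ℕ → ℝ} {n m L K : ℕ} {ℓ D J : ℝ} {S : ℕ → ℕ → Prop}

/-- The state of the merge in row `r`: the intervals of the previous row are the entries from `a`
to `z`, those of the current row start at `z + 1`, and the columns up to `j` have been treated. -/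
structure MergeInv (S : ℕ → ℕ → Prop) (m r a z : ℕ) (s : State) (k o : ℕ) : Prop where
  natVar_six : s.natVar 6 = k
  natVar_seven : s.natVar 7 = o
  le_ptr : a ≤ k
  ptr_le : k ≤ z
  lt_out : z < o
  prev : IntervalList (s.natArr 0) (s.natArr 1) a z (3 * m) m (reach S r)
  fst_sentinel : s.natArr 0 z = 4 * m
  snd_sentinel : s.natArr 1 z = 4 * m
  lt_of_lt_ptr : ∀ x, a ≤ x → x < k → s.natArr 1 x < s.natVar 4
  cur : IntervalList (s.natArr 0) (s.natArr 1) (z + 1) o (s.natVar 4) m (reach S (r + 1))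
  flag : s.natVar 8 ≠ 0 ↔ reach S (r + 1) (min (s.natVar 4) m)
  col_le : s.natVar 4 ≤ 3 * m

/-- A jump is free or blocked as a whole. A free one appends at most one interval, determined by
`reach_segment` and `IntervalList.first_entry`; a blocked one clears the flag. In either case the
potential drops by one, which pays for the step and for a possible new interval. -/
theorem exec_decisionStep (hs : Loaded c f n m s) {i r a z k o : ℕ} (h3 : s.natVar 3 = i)
    (hi : i < n) (hD : s.realVar 1 = D) (hℓ : ℓ < L)
    (hf : ∀ i < n, ∀ j, j + 1 < m → |f i (j + 1) - f i j| ≤ ℓ) (hK : m < 2 ^ K)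
    (hS : ∀ j < m, S r j ↔ f i j ≤ D) (hinv : MergeInv S m r a z s k o) (hj : s.natVar 4 < m) :
    Exec c (decisionStep L) s fun s' T => ∃ k' o', MergeInv S m r a z s' k' o' ∧ k ≤ k' ∧
      o' ≤ o + 1 ∧ jumpPotential K (3 * L) (fun j => |f i j - D|) m (s'.natVar 4) + 1 ≤
        jumpPotential K (3 * L) (fun j => |f i j - D|) m (s.natVar 4) ∧
      (T : ℝ) + 10 * k ≤ 10 * k' + (18 * Nat.log 2 m + 140) := by
  unfold decisionStep
  obtain ⟨h6, h7, hak, hkz, hzo, hprev, hA, hB, hlt, hcur, hflag, hcol⟩ := hinv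
  set j := s.natVar 4 with hjdef
  rw [min_eq_left hj.le] at hflag
  rw [exec_seq]
  refine (exec_probe L hs h3 hjdef.symm hi hj).mono ?_
  rintro s₂ T₂ ⟨hfr₂, hT₂, hd, κ, hg, hg1, hg2, hg3⟩
  rw [hD] at hg1 hg2
  have hL0 : (0 : ℝ) ≤ L := Nat.cast_nonneg L
  have hjump := jumpPotential_jump (K := K) (L := L) (x := fun j => |f i j - D|) hL0
    hℓ.le (fun j hj => (abs_abs_sub_abs_le _ _).trans (by
      rw [sub_sub_sub_cancel_right]; exact hf i hi j hj)) hj hK hg2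
  have hseg : ∀ q, j ≤ q → q < j + 2 ^ κ → q < m → (S r q ↔ f i j ≤ D) := fun q h1 h2 h3 => by
    rw [hS q h3]
    refine le_iff_of_jump (g := 2 ^ κ) hℓ (hf i hi) ?_ q h1 h2 h3
    rcases hg1 with rfl | h
    · exact Or.inl (pow_zero 2)
    · exact Or.inr (by exact_mod_cast h)
  set g := 2 ^ κ with hgdef
  have hgpos : 0 < g := by positivity
  have a0 : s₂.natArr 0 = s.natArr 0 := hfr₂.natArr 0 (by simp)
  have a1 : s₂.natArr 1 = s.natArr 1 := hfr₂.natArr 1 (by simp)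
  have r1 : s₂.realVar 1 = D := by rw [hfr₂.realVar 1 (by simp), hD]
  have b4 : s₂.natVar 4 = j := hfr₂.natVar 4 (by simp)
  have b6 : s₂.natVar 6 = k := by rw [hfr₂.natVar 6 (by simp), h6]
  have b7 : s₂.natVar 7 = o := by rw [hfr₂.natVar 7 (by simp), h7]
  have b8 : s₂.natVar 8 = s.natVar 8 := hfr₂.natVar 8 (by simp)
  simp only [exec_seq, exec_ite, exec_setNat, Test.Holds, RealExpr.eval, NatExpr.eval,
    hd, r1, setNat_natVar, if_true, Test.cost, RealExpr.cost, NatExpr.cost]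
  refine ⟨fun hfree => ?_, fun hbl => ?_⟩
  · have hfreeS : ∀ q, j ≤ q → q < j + g → q < m → S r q := fun q h1 h2 h3 =>
      (hseg q h1 h2 h3).2 hfree
    refine (exec_mergeCell s₂ b4 hg b6 b7 hkz (by rw [a1, hB]; omega)).mono ?_
    rintro s₃ T₃ ⟨hfr₃, k', α, h6', hkk, hkz', hlt', hle', hT₃, hα, hcase⟩
    rw [a1] at hlt' hle'
    rw [a0, b8] at hα
    have c4 : s₃.natVar 4 = j := by rw [hfr₃.natVar 4 (by simp), b4]
    have c5 : s₃.natVar 5 = g := by rw [hfr₃.natVar 5 (by simp), hg]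
    have hlt₂ : ∀ x, a ≤ x → x < k' → s.natArr 1 x < j := fun x h1 h2 => by
      rcases Nat.lt_or_ge x k with h | h
      · exact hlt x h1 h
      · exact hlt' x h h2
    have hR : ∀ p, j < p → p ≤ j + g → p ≤ m → (reach S (r + 1) p ↔ α ≤ p) := by
      intro p h1 h2 h3
      rw [reach_segment hfreeS p h1 h2 h3, hprev.first_entry (by omega) (by omega) (hak.trans hkk)
        hkz' hlt₂ hle' p h1 h3, ← hflag, hα]
      split_ifs with h8
      · simp only [h8, ne_eq, not_true_eq_false, false_or, max_le_iff]
        omega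
      · simp only [h8, ne_eq, not_false_eq_true, true_or, true_iff]
        omega
    have hjα : j < α := by rw [hα]; split_ifs <;> omega
    have hT : ((T₂ + (1 + 1 + 1 + 1 + T₃ + (1 + 1 + 1 + 1)) : ℕ) : ℝ) + 10 * k ≤
        10 * k' + (18 * Nat.log 2 m + 140) := by
      have : (T₃ : ℝ) + 10 * k ≤ 10 * k' + 60 := by exact_mod_cast hT₃
      push_cast
      linarith
    simp only [c4, c5]
    rcases hcase with ⟨hαg, e0, e1, e7, e8⟩ | ⟨hαg, e0, e1, e7, e8⟩
    · rw [a0] at e0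
      rw [a1] at e1
      -- The sentinel 4m cannot be the start of an interval, because j < m and g ≤ 2m give j + g <
      -- 3m.
      have hαm : α ≤ m := by
        rw [hα] at hαg ⊢
        split_ifs at hαg ⊢ with h8
        · rcases hkz'.eq_or_lt with rfl | hlt
          · omega
          · have := hprev.fst_le k' (hak.trans hkk) hlt
            omega
        · omega
      refine ⟨k', o + 1, ⟨?_, ?_, hak.trans hkk, hkz', by omega, ?_, ?_, ?_, ?_, ?_, ?_, ?_⟩, hkk,
        le_rfl, hjump, hT⟩ <;> simp only [setNat_natVar, setNat_natArr, Nat.reduceEqDiff, if_false,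
          if_true, h6', e7, e8, e0, e1]
      · exact hprev.congr (fun x _ hx => Function.update_of_ne (by omega) _ _)
          fun x _ hx => Function.update_of_ne (by omega) _ _
      · rw [Function.update_of_ne (by omega), hA]
      · rw [Function.update_of_ne (by omega), hB]
      · intro x h1 h2
        rw [Function.update_of_ne (by omega)]
        have := hlt₂ x h1 h2
        omega
      · exact hcur.snoc (by omega) hjα hαg hαm hR
      · rw [hR _ (by omega) (by omega) (by omega)]
        simp only [ne_eq, one_ne_zero, not_false_eq_true, true_iff]
        omega
      · omega
    · rw [a0] at e0
      rw [a1] at e1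
      refine ⟨k', o, ⟨?_, ?_, hak.trans hkk, hkz', by omega, ?_, ?_, ?_, ?_, ?_, ?_, ?_⟩, hkk,
        Nat.le_succ o, hjump, hT⟩ <;> simp only [setNat_natVar, setNat_natArr, Nat.reduceEqDiff,
          if_false, if_true, h6', e7, e8, e0, e1]
      · exact hprev
      · exact hA
      · exact hB
      · intro x h1 h2
        have := hlt₂ x h1 h2
        omega
      · refine hcur.skip (by omega) fun p h1 h2 h3 => ?_
        rw [hR p h1 h2 h3]
        omega
      · rw [hR _ (by omega) (by omega) (by omega)]
        simp only [ne_eq, not_true_eq_false, false_iff]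
        omega
      · omega
  · have hR : ∀ p, j < p → p ≤ j + g → p ≤ m → ¬ reach S (r + 1) p := by
      intro p h1 h2 h3 hr
      obtain ⟨p, rfl⟩ : ∃ p', p = p' + 1 := ⟨p - 1, by omega⟩
      exact hbl ((hseg p (by omega) (by omega) (by omega)).1 hr.1)
    simp only [Nat.reduceEqDiff, if_false, b4, hg]
    refine ⟨k, o, ⟨?_, ?_, hak, hkz, hzo, ?_, ?_, ?_, ?_, ?_, ?_, ?_⟩, le_rfl,
        Nat.le_succ o, hjump, ?_⟩ <;> try simp only [setNat_natVar, setNat_natArr,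
          Nat.reduceEqDiff, if_false, if_true, b6, b7, a0, a1]
    · exact hprev
    · exact hA
    · exact hB
    · intro x h1 h2
      have := hlt x h1 h2
      omega
    · exact hcur.skip (by omega) hR
    · simp only [ne_eq, not_true_eq_false, false_iff]
      exact hR _ (by omega) (by omega) (by omega)
    · omega
    · push_cast
      linarith

/-- The pointer costs as much as the previous list is long. The same potential that bounds the jumps
bounds the length of the new list by J, which pays for the pointer of the next row. -/
theorem exec_decisionRow (hs : Loaded c f n m s) {i r a z : ℕ} (h3 : s.natVar 3 = i)
    (hi : i < n) (hD : s.realVar 1 = D) (hℓ : ℓ < L)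
    (hf : ∀ i < n, ∀ j, j + 1 < m → |f i (j + 1) - f i j| ≤ ℓ) (hK : m < 2 ^ K) (hm : 0 < m)
    (hJ : jumpPotential K (3 * L) (fun j => |f i j - D|) m 0 ≤ J)
    (hS : ∀ j < m, S r j ↔ f i j ≤ D) (h6 : s.natVar 6 = a) (h7 : s.natVar 7 = z + 1) (haz : a ≤ z)
    (hl : IntervalList (s.natArr 0) (s.natArr 1) a z (3 * m) m (reach S r))
    (hA : s.natArr 0 z = 4 * m) (hB : s.natArr 1 z = 4 * m) :
    Exec c (decisionRow L) s fun s' T => Frame (decisionRow L) s s' ∧ ∃ z', z + 1 ≤ z' ∧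
      s'.natVar 6 = z + 1 ∧ s'.natVar 7 = z' + 1 ∧
      IntervalList (s'.natArr 0) (s'.natArr 1) (z + 1) z' (3 * m) m (reach S (r + 1)) ∧
      s'.natArr 0 z' = 4 * m ∧ s'.natArr 1 z' = 4 * m ∧ (z' : ℝ) - (z + 1) ≤ J ∧
      s'.natVar 3 = i + s.natVar 2 ∧ (s'.natVar 8 ≠ 0 ↔ reach S (r + 1) m) ∧
      (T : ℝ) ≤ (18 * Nat.log 2 m + 200) * J + 10 * ((z : ℝ) - a) + 70 := by
  apply Exec.frame
  unfold decisionRow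
  set B : ℝ := 18 * Nat.log 2 m + 200 with hBdef
  have hB0 : 0 ≤ B := by positivity
  set pot := jumpPotential K (3 * L) (fun j => |f i j - D|) m with hpot
  have hpot0 : ∀ j, 0 ≤ pot j := fun j => jumpPotential_nonneg j
  simp only [exec_seq, exec_setNat]
  refine (Exec.while (fun s' => ∃ k o, MergeInv S m r a z s' k o ∧
      (o : ℝ) - (z + 1) + pot (s'.natVar 4) ≤ J)
    (fun s' => B * pot (s'.natVar 4) + 10 * ((z : ℝ) - s'.natVar 6)) ?_ ?_ ?_).mono ?_
  · rintro s' ⟨k, o, hinv, -⟩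
    have h1 : (k : ℝ) ≤ z := by exact_mod_cast hinv.ptr_le
    rw [hinv.natVar_six]
    exact add_nonneg (mul_nonneg hB0 (hpot0 _)) (by linarith)
  · rintro s₁ hfr ⟨k, o, hinv, hJ₁⟩ hb
    have hs₁ : Loaded c f n m s₁ := by
      refine hs.of_eq ?_ ?_ fun a ha => ?_
      · rw [hfr.natVar 0 (by simp)]; simp [setNat_natVar]
      · rw [hfr.natVar 1 (by simp)]; simp [setNat_natVar]
      · rw [hfr.realArr a (by simp)]; rfl
    have e3 : s₁.natVar 3 = i := by rw [hfr.natVar 3 (by simp)]; simp [setNat_natVar, h3]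
    have eD : s₁.realVar 1 = D := by rw [hfr.realVar 1 (by simp)]; exact hD
    have hj : s₁.natVar 4 < m := by
      simpa [Test.Holds, NatExpr.eval, hs₁.natVar_one] using hb
    refine (exec_decisionStep hs₁ e3 hi eD hℓ hf hK hS hinv hj).mono ?_
    rintro s₂ T ⟨k', o', hinv', hk, ho, hjump, hT⟩
    have ho' : (o' : ℝ) ≤ o + 1 := by exact_mod_cast ho
    refine ⟨⟨k', o', hinv', by linarith⟩, ?_⟩
    have := mul_le_mul_of_nonneg_left hjump hB0
    rw [hinv.natVar_six, hinv'.natVar_six]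
    simp only [Test.cost, NatExpr.cost]
    push_cast
    linarith
  · refine ⟨a, z + 1, ⟨?_, ?_, le_rfl, haz, by omega, ?_, ?_, ?_, ?_, ?_, ?_, ?_⟩, ?_⟩ <;>
      simp only [setNat_natVar, setNat_natArr, Nat.reduceEqDiff, NatExpr.eval, if_false, if_true,
        h6, h7]
    · exact hl
    · exact hA
    · exact hB
    · intro x h1 h2; omega
    · refine ⟨by intros; omega, by intros; omega, by intros; omega, by intros; omega, ?_⟩
      intro p hp
      obtain rfl : p = 0 := by omega
      refine iff_of_false (reach_succ_zero r) ?_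
      rintro ⟨x, h1, h2, -⟩
      omega
    · simp
    · omega
    · push_cast; linarith
  · rintro s' T ⟨hfr, ⟨k, o, hinv, hJ₁⟩, hb, hT⟩
    have e1 : s'.natVar 1 = m := by
      rw [hfr.natVar 1 (by simp)]; simp [setNat_natVar, hs.natVar_one]
    have hj : m ≤ s'.natVar 4 := by simpa [Test.Holds, NatExpr.eval, e1] using hb
    have e2 : s'.natVar 2 = s.natVar 2 := by
      rw [hfr.natVar 2 (by simp)]; simp [setNat_natVar]
    have e3 : s'.natVar 3 = i := by rw [hfr.natVar 3 (by simp)]; simp [setNat_natVar, h3]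
    have e10 : s'.natVar 10 = z + 1 := by
      rw [hfr.natVar 10 (by simp)]; simp [setNat_natVar, NatExpr.eval, h7]
    have hflag := hinv.flag
    rw [min_eq_right hj] at hflag
    have hsent : ∀ s₁ : State, s₁.natVar 1 = m → sentinel.eval s₁ = 4 * m := fun s₁ h => by
      simp only [sentinel, NatExpr.eval, h]; ring
    simp only [exec_storeNat, setNat_natVar, setNat_natArr, storeNat_natVar,
      NatExpr.eval, Nat.reduceEqDiff, if_false, if_true, hinv.natVar_seven, e10, e2, e3]
    rw [hsent s' e1, hsent (s'.storeNat 0 o (4 * m)) e1]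
    have hu0 : ((s'.storeNat 0 o (4 * m)).storeNat 1 o (4 * m)).natArr 0 =
        Function.update (s'.natArr 0) o (4 * m) := by
      funext x; simp [storeNat_natArr, Function.update_apply]
    have hu1 : ((s'.storeNat 0 o (4 * m)).storeNat 1 o (4 * m)).natArr 1 =
        Function.update (s'.natArr 1) o (4 * m) := by
      funext x; simp [storeNat_natArr, Function.update_apply]
    rw [hu0, hu1]
    refine ⟨o, hinv.lt_out, trivial, rfl, ?_, Function.update_self .., Function.update_self .., ?_,
      trivial,
      hflag, ?_⟩
    -- The scan may end anywhere between m and 3m. Extending the bound to 3m does not alter the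
    -- columns covered, which stop at m.
    · exact (hinv.cur.skip hinv.col_le (by intros; omega)).congr
        (fun x _ hx => Function.update_of_ne (by omega) _ _)
        fun x _ hx => Function.update_of_ne (by omega) _ _
    · linarith [hpot0 (s'.natVar 4)]
    · have h1 : (k : ℝ) ≤ z := by exact_mod_cast hinv.ptr_le
      have h2 := mul_nonneg hB0 (hpot0 (s'.natVar 4))
      have h3 := mul_le_mul_of_nonneg_left hJ hB0
      rw [hinv.natVar_six] at hT
      simp only [setNat_natVar, Nat.reduceEqDiff, NatExpr.eval, if_false, if_true, h6,
        NatExpr.cost, Test.cost, sentinel] at hT ⊢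
      push_cast at hT ⊢
      linarith

/-- The number of rows that the decision procedure treats with stride `s`. -/
def rowCount (n s : ℕ) : ℕ := (n - 1) / s + 1

theorem exec_decision (hs : Loaded c f n m s) (hn : 0 < n) {ε μ : ℝ} (hε : s.realVar 0 = ε)
    (hμ : s.realVar 7 = μ) (hℓ : ℓ < L)
    (hf : ∀ i < n, ∀ j, j + 1 < m → |f i (j + 1) - f i j| ≤ ℓ) (hK : m < 2 ^ K) (hm : 0 < m)
    (hJ0 : 0 ≤ J)
    (hJ : ∀ i < n, jumpPotential K (3 * L) (fun j => |f i j - (μ + ε * μ / 8)|) m 0 ≤ J) :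
    Exec c (decision L) s fun s' T => Frame (decision L) s s' ∧ ∃ κ : ℕ,
      (κ = 0 ∨ (2 : ℝ) ^ κ * L ≤ ε * μ) ∧ (n < 2 ^ κ ∨ ε * μ ≤ 2 * (2 ^ κ * L)) ∧
      (s'.natVar 8 ≠ 0 ↔
        reach (fun a j => f (a * 2 ^ κ) j ≤ μ + ε * μ / 8) (rowCount n (2 ^ κ)) m) ∧
      (T : ℝ) ≤ rowCount n (2 ^ κ) * ((18 * Nat.log 2 m + 210) * J + 90) +
        18 * Nat.log 2 n + 120 := by
  apply Exec.frame
  unfold decision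
  set B : ℝ := (18 * Nat.log 2 m + 210) * J + 90 with hBdef
  have hB0 : 0 ≤ B := by positivity
  rw [exec_seq, exec_setReal, exec_seq]
  refine (exec_doubling (by norm_num) _).mono ?_
  rintro s₁ T₁ ⟨hfr₁, hT₁, κ, hκ, h1, h2, -⟩
  have e0 : s₁.natVar 0 = n := by rw [hfr₁.natVar 0 (by simp)]; exact hs.natVar_zero
  have e1 : s₁.natVar 1 = m := by rw [hfr₁.natVar 1 (by simp)]; exact hs.natVar_one
  have r7 : s₁.realVar 7 = μ := by rw [hfr₁.realVar 7 (by simp)]; simp [setReal_realVar, hμ]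
  have r3 : s₁.realVar 3 = ε * μ := by
    rw [hfr₁.realVar 3 (by simp)]; simp [setReal_realVar, RealExpr.eval, hε, hμ]
  have ra : ∀ a, s₁.realArr a = s.realArr a := fun a => by
    rw [hfr₁.realArr a (by simp)]; rfl
  have ht : (s.setReal 3 ((RealExpr.var 0).mul (RealExpr.var 7)|>.eval c s)).realVar 3 = ε * μ := by
    simp [setReal_realVar, RealExpr.eval, hε, hμ]
  rw [ht] at h1 h2
  simp only [setReal_natVar, hs.natVar_zero] at h2 hT₁
  set g := 2 ^ κ with hg
  have hg0 : 0 < g := by positivity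
  set S : ℕ → ℕ → Prop := fun a j => f (a * g) j ≤ μ + ε * μ / 8 with hSdef
  have hsent : ∀ s₁ : State, s₁.natVar 1 = m → sentinel.eval s₁ = 4 * m := fun s₁ h => by
    simp only [sentinel, NatExpr.eval, h]; ring
  simp only [exec_seq, exec_setNat, exec_setReal, exec_storeNat, RealExpr.eval, NatExpr.eval, r7, r3]
  rw [hsent (((s₁.setReal 1 (μ + ε * μ / ((8 : ℕ) : ℝ))).storeNat 0 0 0).storeNat 1 0 0) e1,
    hsent ((((s₁.setReal 1 (μ + ε * μ / ((8 : ℕ) : ℝ))).storeNat 0 0 0).storeNat 1 0 0).storeNat 0 1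
      (4 * m)) e1]
  set s₂ := ((((((((s₁.setReal 1 (μ + ε * μ / ((8 : ℕ) : ℝ))).storeNat 0 0 0).storeNat 1 0 0).storeNat
    0 1 (4 * m)).storeNat 1 1 (4 * m)).setNat 6 0).setNat 7 2).setNat 3 0) with hs₂
  have q0 : s₂.natVar 0 = n := e0
  have q1 : s₂.natVar 1 = m := e1
  have q2 : s₂.natVar 2 = g := hκ
  have q3 : s₂.natVar 3 = 0 := rfl
  have q6 : s₂.natVar 6 = 0 := rfl
  have q7 : s₂.natVar 7 = 2 := rfl
  have p1 : s₂.realVar 1 = μ + ε * μ / 8 := by simp [hs₂, setNat_realVar, storeNat_realVar,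
    setReal_realVar]
  have pa : ∀ a, s₂.realArr a = s.realArr a := ra
  have l0 : s₂.natArr 0 0 = 0 := rfl
  have l1 : s₂.natArr 0 1 = 4 * m := rfl
  have l2 : s₂.natArr 1 0 = 0 := rfl
  have l3 : s₂.natArr 1 1 = 4 * m := rfl
  clear_value s₂
  -- The list entering a row has at most J intervals, except for the starting list, which has one;
  -- hence J + 1.
  refine (Exec.while (fun s' => ∃ r a z, s'.natVar 3 = r * g ∧ r ≤ rowCount n g ∧
      s'.natVar 6 = a ∧ s'.natVar 7 = z + 1 ∧ a ≤ z ∧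
      IntervalList (s'.natArr 0) (s'.natArr 1) a z (3 * m) m (reach S r) ∧
      s'.natArr 0 z = 4 * m ∧ s'.natArr 1 z = 4 * m ∧ (z : ℝ) - a ≤ J + 1 ∧
      (0 < r → (s'.natVar 8 ≠ 0 ↔ reach S r m)))
    (fun s' => B * ((rowCount n g : ℝ) - (s'.natVar 3 / g : ℕ))) ?_ ?_ ?_).mono ?_
  · rintro s' ⟨r, a, z, k3, hr, -⟩
    rw [k3, Nat.mul_div_cancel _ hg0]
    have : (r : ℝ) ≤ rowCount n g := by exact_mod_cast hr
    exact mul_nonneg hB0 (by linarith)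
  · rintro s₃ hfr ⟨r, a, z, k3, hr, k6, k7, haz, hl, hA, hA', hz, -⟩ hb
    have hs₃ : Loaded c f n m s₃ := by
      refine hs.of_eq ?_ ?_ fun a ha => ?_
      · rw [hfr.natVar 0 (by simp), q0, hs.natVar_zero]
      · rw [hfr.natVar 1 (by simp), q1, hs.natVar_one]
      · rw [hfr.realArr a (by simp), pa]
    have hi : r * g < n := by
      simpa [Test.Holds, NatExpr.eval, hs₃.natVar_zero, k3] using hb
    have hr' : r + 1 ≤ rowCount n g := by
      have : r ≤ (n - 1) / g := (Nat.le_div_iff_mul_le hg0).2 (by omega)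
      unfold rowCount
      omega
    have eD : s₃.realVar 1 = μ + ε * μ / 8 := by rw [hfr.realVar 1 (by simp), p1]
    have e2 : s₃.natVar 2 = g := by rw [hfr.natVar 2 (by simp), q2]
    refine (exec_decisionRow (S := S) hs₃ k3 hi eD hℓ hf hK hm (hJ _ hi) (fun j _ => Iff.rfl) k6 k7
      haz hl hA hA').mono ?_
    rintro s₄ T ⟨hfr₄, z', hz', k6', k7', hl', hA₄, hA₄', hJ', k3', hfl, hT⟩
    rw [e2] at k3'
    have hk3 : r * g + g = (r + 1) * g := by ring
    rw [hk3] at k3'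
    refine ⟨⟨r + 1, z + 1, z', k3', hr', k6', k7', hz', hl', hA₄, hA₄', ?_, fun _ => hfl⟩, ?_⟩
    · push_cast; linarith
    · rw [k3, k3', Nat.mul_div_cancel _ hg0, Nat.mul_div_cancel _ hg0]
      simp only [Test.cost, NatExpr.cost]
      push_cast
      linarith
  -- The starting list is the single interval [0, 0], the virtual start, followed by a sentinel.
  · refine ⟨0, 0, 1, by simp [q3], Nat.zero_le _, q6, q7, by norm_num, ?_, l1, l3, ?_, by simp⟩
    · have hx : ∀ x, x < 1 → x = 0 := by omega
      refine ⟨fun x _ h => ?_, by intros; omega, fun x _ h => ?_, fun x _ h => ?_, fun p hp => ?_⟩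
      · rw [hx x h, l0, l2]
      · rw [hx x h, l0]; omega
      · rw [hx x h, l2]; omega
      · rw [reach_zero]
        constructor
        · rintro rfl
          exact ⟨0, le_rfl, one_pos, by rw [l0], by rw [l2]⟩
        · rintro ⟨x, -, h, -, h'⟩
          rw [hx x h, l2] at h'
          omega
    · simpa using hJ0
  · rintro s' T ⟨hfr, ⟨r, a, z, k3, hr, -, -, -, -, -, -, -, hfl⟩, hb, hT⟩
    have e0' : s'.natVar 0 = n := by rw [hfr.natVar 0 (by simp), q0]
    have hrn : n ≤ r * g := by simpa [Test.Holds, NatExpr.eval, e0', k3] using hb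
    have hr' : r = rowCount n g := by
      refine le_antisymm hr ?_
      have : (n - 1) / g < r := (Nat.div_lt_iff_lt_mul hg0).2 (by omega)
      unfold rowCount
      omega
    refine ⟨κ, h1, h2, ?_, ?_⟩ <;> rw [← hg, ← hr']
    · refine hfl (Nat.pos_of_ne_zero fun h => ?_)
      rw [h] at hrn
      omega
    · rw [k3, q3, Nat.mul_div_cancel _ hg0, ← hr', Nat.zero_div] at hT
      simp only [NatExpr.cost, Test.cost, RealExpr.cost, sentinel] at hT ⊢
      push_cast at hT ⊢
      linarith

end

end RealRAM


/-- The outcome of the decision procedure, for a quantity `F` with `F ≤ x` iff the last cell can be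
reached through cells of value at most `x`. -/
theorem reach_rowCount {f : ℕ → ℕ → ℝ} {n m L κ : ℕ} {ℓ ε μ F : ℝ} (hn : 0 < n) (hm : 0 < m)
    (hL : 8 * ℓ ≤ L) (hℓ : 0 ≤ ℓ)
    (hf' : ∀ j < m, ∀ i, i + 1 < n → |f (i + 1) j - f i j| ≤ ℓ)
    (hεμ : 0 ≤ ε * μ) (hκ : κ = 0 ∨ (2 : ℝ) ^ κ * L ≤ ε * μ)
    (hF : ∀ x, F ≤ x ↔ reach (fun i j => f i j ≤ x) n m) :
    (reach (fun a j => f (a * 2 ^ κ) j ≤ μ + ε * μ / 8) (RealRAM.rowCount n (2 ^ κ)) m →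
      F ≤ μ + ε / 4 * μ) ∧
    (F ≤ μ → reach (fun a j => f (a * 2 ^ κ) j ≤ μ + ε * μ / 8)
      (RealRAM.rowCount n (2 ^ κ)) m) := by
  have hg : 0 < 2 ^ κ := by positivity
  -- Within a block the rows deviate by at most 2^κ·ℓ ≤ 2^κ·L/8 ≤ εμ/8; this is the purpose of `hL`.
  -- The error enters twice: the threshold is raised by εμ/8 so that no walk is lost, and refining a
  -- coarse walk adds another εμ/8.
  have key : ∀ a t j, t < 2 ^ κ → a * 2 ^ κ + t < n → j < m →
      |f (a * 2 ^ κ + t) j - f (a * 2 ^ κ) j| ≤ ε * μ / 8 := by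
    intro a t j ht hn hj
    refine (abs_sub_le_of_steps (f := fun i => f i j) (hf' j hj) t hn).trans ?_
    rcases hκ with rfl | hκ
    · obtain rfl : t = 0 := by simpa using ht
      simp only [Nat.cast_zero, zero_mul]
      positivity
    · have h1 : (t : ℝ) ≤ 2 ^ κ := by exact_mod_cast ht.le
      have h2 := mul_le_mul_of_nonneg_right h1 hℓ
      have h3 : (2 : ℝ) ^ κ * (8 * ℓ) ≤ 2 ^ κ * L := by gcongr
      linarith
  have hn1 : (n - 1) / 2 ^ κ * 2 ^ κ + (n - 1) % 2 ^ κ = n - 1 := Nat.div_add_mod' _ _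
  have hmod : (n - 1) % 2 ^ κ < 2 ^ κ := Nat.mod_lt _ hg
  unfold RealRAM.rowCount
  constructor
  · intro h
    rw [hF]
    have := reach_refine (S := fun i j => f i j ≤ μ + ε / 4 * μ)
      (S' := fun a j => f (a * 2 ^ κ) j ≤ μ + ε * μ / 8) (n := n) (m := m) (s := 2 ^ κ)
      (fun a t j ht hn hj hS => by
        have := (abs_le.1 (key a t j ht hn hj)).2
        linarith) ((n - 1) / 2 ^ κ) (m - 1) ((n - 1) % 2 ^ κ) hmod (by omega) (by omega)
        (by rwa [Nat.sub_add_cancel hm])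
    rwa [hn1, Nat.sub_add_cancel hn, Nat.sub_add_cancel hm] at this
  · intro h
    rw [hF] at h
    have := reach_coarsen (S := fun i j => f i j ≤ μ)
      (S' := fun a j => f (a * 2 ^ κ) j ≤ μ + ε * μ / 8) (n := n) (m := m) (s := 2 ^ κ)
      (fun i hi j hj hS => by
        have h1 : i / 2 ^ κ * 2 ^ κ + i % 2 ^ κ = i := Nat.div_add_mod' _ _
        have := (abs_le.1 (key (i / 2 ^ κ) (i % 2 ^ κ) j (Nat.mod_lt _ hg) (by rwa [h1]) hj)).1
        rw [h1] at this
        linarith) (n - 1) (by omega) (m - 1) (by omega)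
        (by rwa [Nat.sub_add_cancel hn, Nat.sub_add_cancel hm])
    rwa [Nat.sub_add_cancel hm] at this

namespace RealRAM

variable {c : ℝ≥0∞} {s : State}

/-! ### The search -/

def searchLoop (L : ℕ) : Program :=
  .while (.not (.realLe (.var 5) (.add (.var 4) (.mul (.div (.var 0) (.ofNat (.lit 4))) (.var 4)))))
    (.seq (.setReal 7 (.div (.add (.var 4) (.var 5)) (.ofNat (.lit 2))))
      (.seq (decision L) (.ite (.natLe (.var 8) (.lit 0)) (.setReal 4 (.var 7))
        (.setReal 5 (.var 7)))))

/-- Bisection between a lower bound and an upper bound of the discrete Fréchet distance. -/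
def search (L : ℕ) : Program :=
  .seq (.setNat 3 (.lit 0)) (.seq (.setNat 4 (.lit 0)) (.seq distance
  (.seq (.setReal 4 (.var 0)) (.seq (.ite (.realLe (.var 4) (.var 2)) (.setReal 4 (.var 2)) .skip)
  (.seq (.setReal 5 (.add (.var 2) (.mul (.ofNat (.lit L)) (.ofNat (.add (.var 0) (.var 1))))))
  (.seq (searchLoop L)
  (.setReal 0 (.add (.var 5) (.mul (.div (.var 0) (.ofNat (.lit 4))) (.var 5))))))))))

/-- Computes a `(1 + ε)`-approximation of the discrete Fréchet distance. -/
def approximate (L : ℕ) : Program :=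
  .seq (sparseDP L)
    (.ite (.realLe (.sub (.ofNat (.lit 1)) (.var 0)) (.get 4 (.add (.var 10) (.var 1))))
      (.seq (.setReal 0 (.sub (.ofNat (.lit 1)) (.get 4 (.add (.var 10) (.var 1)))))
        (.ite (.realLe (.var 0) (.ofNat (.lit 0))) (.setReal 0 (.ofNat (.lit 0))) .skip))
      (search L))

section

attribute [local simp] search searchLoop sparseDP sparseRow sparseStep sparseCell decision
  decisionRow decisionStep mergeCell advance probe distance doubling
  Program.natVars Program.realVars Program.natArrs Program.realArrs

variable {f : ℕ → ℕ → ℝ} {n m L K : ℕ} {ℓ ε F B : ℝ} {J : ℝ → ℝ}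

/-- A negative decision proves μ < F, a positive one only F ≤ (1 + ε/4)μ, which is why the invariant
for the upper end carries that factor. The loop runs only while the gap exceeds ε/4 times the lower
end, hence ε²/4. The factor 2 under the logarithm keeps the argument at least 1 after a halving, so
each round lowers the logarithm by exactly 1. -/
theorem exec_searchLoop (hs : Loaded c f n m s) (hn : 0 < n) (hm : 0 < m) (hε0 : 0 < ε)
    (hε : s.realVar 0 = ε) (hL : 8 * ℓ ≤ L) (hL0 : 0 < L) (hℓ : 0 ≤ ℓ)
    (hf : ∀ i < n, ∀ j, j + 1 < m → |f i (j + 1) - f i j| ≤ ℓ)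
    (hf' : ∀ j < m, ∀ i, i + 1 < n → |f (i + 1) j - f i j| ≤ ℓ) (hK : m < 2 ^ K)
    (hF : ∀ x, F ≤ x ↔ reach (fun i j => f i j ≤ x) n m)
    (hJ0 : ∀ μ, ε ≤ μ → 0 ≤ J μ) (hJ : ∀ μ, ε ≤ μ → ∀ i < n,
      jumpPotential K (3 * L) (fun j => |f i j - (μ + ε * μ / 8)|) m 0 ≤ J μ)
    (hB0 : 0 ≤ B) (hB : ∀ μ, ε ≤ μ → ∀ κ : ℕ, (κ = 0 ∨ (2 : ℝ) ^ κ * L ≤ ε * μ) →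
      (n < 2 ^ κ ∨ ε * μ ≤ 2 * (2 ^ κ * L)) →
      rowCount n (2 ^ κ) * ((18 * Nat.log 2 m + 210) * J μ + 90) + 18 * Nat.log 2 n + 120 ≤ B)
    (hlo : ε ≤ s.realVar 4) (hloF : s.realVar 4 ≤ F)
    (hhiF : F ≤ s.realVar 5 + ε / 4 * s.realVar 5) :
    Exec c (searchLoop L) s fun s' T => Frame (searchLoop L) s s' ∧ s'.realVar 4 ≤ F ∧
      F ≤ s'.realVar 5 + ε / 4 * s'.realVar 5 ∧
      s'.realVar 5 ≤ s'.realVar 4 + ε / 4 * s'.realVar 4 ∧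
      (T : ℝ) ≤ (B + 60) *
        Real.logb 2 (max 1 (2 * (s.realVar 5 - s.realVar 4) / (ε ^ 2 / 4))) + 20 := by
  apply Exec.frame
  unfold searchLoop
  have hℓL : ℓ < L := by
    have : (0 : ℝ) < L := by exact_mod_cast hL0
    linarith
  have hlog : ∀ x, 0 ≤ (B + 60) * Real.logb 2 (max 1 (2 * x / (ε ^ 2 / 4))) := fun x =>
    mul_nonneg (by linarith) (Real.logb_nonneg one_lt_two (le_max_left _ _))
  refine (Exec.while (fun s' => ε ≤ s'.realVar 4 ∧ s'.realVar 4 ≤ F ∧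
      F ≤ s'.realVar 5 + ε / 4 * s'.realVar 5)
    (fun s' => (B + 60) *
      Real.logb 2 (max 1 (2 * (s'.realVar 5 - s'.realVar 4) / (ε ^ 2 / 4)))) ?_ ?_ ?_).mono ?_
  · exact fun s' _ => hlog _
  · rintro s₁ hfr ⟨h1, h2, h3⟩ hb
    have hs₁ : Loaded c f n m s₁ := by
      refine hs.of_eq ?_ ?_ fun a ha => ?_
      · rw [hfr.natVar 0 (by simp)]
      · rw [hfr.natVar 1 (by simp)]
      · rw [hfr.realArr a (by simp)]
    have e0 : s₁.realVar 0 = ε := by rw [hfr.realVar 0 (by simp), hε]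
    set lo := s₁.realVar 4 with hlo'
    set hi := s₁.realVar 5 with hhi'
    have hgap : ε ^ 2 / 4 < hi - lo := by
      have hb' : lo + ε / 4 * lo < hi := by
        simpa [Test.Holds, RealExpr.eval, NatExpr.eval, e0, ← hlo', ← hhi'] using hb
      nlinarith
    have hgap0 : 0 < hi - lo := lt_trans (by positivity) hgap
    set μ := (lo + hi) / 2 with hμ
    have hεμ : ε ≤ μ := by rw [hμ]; linarith
    simp only [exec_seq, exec_setReal]
    refine (exec_decision (J := J μ) (ε := ε) (μ := μ) ?_ hn ?_ ?_
      hℓL hf hK hm (hJ0 μ hεμ) (hJ μ hεμ)).mono ?_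
    · exact hs₁.of_eq rfl rfl fun _ _ => rfl
    · simp [setReal_realVar, e0]
    · simp [setReal_realVar, RealExpr.eval, NatExpr.eval, ← hlo', ← hhi', hμ]
    rintro s₂ T ⟨hfr₂, κ, hκ1, hκ2, hfl, hT⟩
    have hT' := hT.trans (hB μ hεμ κ hκ1 hκ2)
    have r4 : s₂.realVar 4 = lo := by
      rw [hfr₂.realVar 4 (by simp)]; simp [setReal_realVar, ← hlo']
    have r5 : s₂.realVar 5 = hi := by
      rw [hfr₂.realVar 5 (by simp)]; simp [setReal_realVar, ← hhi']
    have r7 : s₂.realVar 7 = μ := by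
      rw [hfr₂.realVar 7 (by simp)]
      simp [setReal_realVar, RealExpr.eval, NatExpr.eval, ← hlo', ← hhi', hμ]
    have hdec := reach_rowCount hn hm hL hℓ hf'
      (mul_nonneg hε0.le (hε0.le.trans hεμ)) hκ1 hF
    rw [← hfl] at hdec
    have hhalf : Real.logb 2 (max 1 (2 * ((hi - lo) / 2) / (ε ^ 2 / 4))) + 1 =
        Real.logb 2 (max 1 (2 * (hi - lo) / (ε ^ 2 / 4))) := by
      have h1 : 1 ≤ 2 * ((hi - lo) / 2) / (ε ^ 2 / 4) := by
        rw [le_div_iff₀ (by positivity)]; linarith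
      have h2 : 2 * (hi - lo) / (ε ^ 2 / 4) = 2 * ((hi - lo) / 2) / (ε ^ 2 / 4) * 2 := by ring
      rw [max_eq_right h1, h2, max_eq_right (by linarith), Real.logb_mul (by positivity)
        (by norm_num), Real.logb_self_eq_one one_lt_two]
    have hcost : (B + 60) * Real.logb 2 (max 1 (2 * ((hi - lo) / 2) / (ε ^ 2 / 4))) + (B + 60) =
        (B + 60) * Real.logb 2 (max 1 (2 * (hi - lo) / (ε ^ 2 / 4))) := by
      rw [← hhalf]; ring
    simp only [exec_ite, exec_setReal, Test.Holds, RealExpr.eval, NatExpr.eval, setReal_realVar,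
      r4, r5, r7, Test.cost, RealExpr.cost, NatExpr.cost]
    norm_num only [if_true, if_false]
    refine ⟨fun h8 => ⟨⟨hεμ, ?_, h3⟩, ?_⟩, fun h8 => ⟨⟨h1, h2, ?_⟩, ?_⟩⟩
    · have h8' : s₂.natVar 8 = 0 := by omega
      by_contra hc
      exact hdec.2 (not_le.1 hc).le h8'
    · have : hi - μ = (hi - lo) / 2 := by rw [hμ]; ring
      rw [this]
      push_cast
      linarith
    · exact hdec.1 (by omega)
    · have : μ - lo = (hi - lo) / 2 := by rw [hμ]; ring
      rw [this]
      push_cast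
      linarith
  · exact ⟨hlo, hloF, hhiF⟩
  · rintro s' T ⟨hfr, ⟨h1, h2, h3⟩, hb, hT⟩
    have e0 : s'.realVar 0 = ε := by rw [hfr.realVar 0 (by simp), hε]
    refine ⟨h2, h3, ?_, ?_⟩
    · simpa [Test.Holds, RealExpr.eval, NatExpr.eval, e0] using hb
    · have := hlog (s'.realVar 5 - s'.realVar 4)
      simp only [Test.cost, RealExpr.cost, NatExpr.cost] at hT
      push_cast at hT
      linarith

theorem exec_search (hs : Loaded c f n m s) (hn : 0 < n) (hm : 0 < m) (hε0 : 0 < ε) (hε1 : ε < 1)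
    (hε : s.realVar 0 = ε) (hL : 8 * ℓ ≤ L) (hL0 : 0 < L) (hℓ : 0 ≤ ℓ) (hf0 : ∀ i j, 0 ≤ f i j)
    (hf : ∀ i < n, ∀ j, j + 1 < m → |f i (j + 1) - f i j| ≤ ℓ)
    (hf' : ∀ j < m, ∀ i, i + 1 < n → |f (i + 1) j - f i j| ≤ ℓ) (hK : m < 2 ^ K)
    (hF : ∀ x, F ≤ x ↔ reach (fun i j => f i j ≤ x) n m)
    (hJ0 : ∀ μ, ε ≤ μ → 0 ≤ J μ) (hJ : ∀ μ, ε ≤ μ → ∀ i < n,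
      jumpPotential K (3 * L) (fun j => |f i j - (μ + ε * μ / 8)|) m 0 ≤ J μ)
    (hB0 : 0 ≤ B) (hB : ∀ μ, ε ≤ μ → ∀ κ : ℕ, (κ = 0 ∨ (2 : ℝ) ^ κ * L ≤ ε * μ) →
      (n < 2 ^ κ ∨ ε * μ ≤ 2 * (2 ^ κ * L)) →
      rowCount n (2 ^ κ) * ((18 * Nat.log 2 m + 210) * J μ + 90) + 18 * Nat.log 2 n + 120 ≤ B)
    (hεF : ε ≤ F) :
    Exec c (search L) s fun s' T => F ≤ s'.output ∧ s'.output ≤ (1 + ε) * F ∧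
      (T : ℝ) ≤ (B + 60) * Real.logb 2 (8 * L * (n + m) / ε ^ 2) + 100 := by
  unfold search
  have hd := hs.cellDist_eq 0 hn 0 hm
  unfold State.cellDist at hd
  have hL0' : (1 : ℝ) ≤ L := by exact_mod_cast hL0
  -- Every walk starts at the corner cell.
  have hd0 : f 0 0 ≤ F := by
    have h := (hF F).1 le_rfl
    have : ∀ i p, reach (fun i j => f i j ≤ F) (i + 1) (p + 1) → f 0 0 ≤ F := by
      intro i p h
      obtain ⟨k, z, h0, -, -, hz⟩ := chainTo_of_reach i p h
      have := (hz 0 (Nat.zero_le _)).1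
      rwa [h0] at this
    obtain ⟨n, rfl⟩ : ∃ n', n = n' + 1 := ⟨n - 1, by omega⟩
    obtain ⟨m, rfl⟩ : ∃ m', m = m' + 1 := ⟨m - 1, by omega⟩
    exact this n m h
  -- Every cell of the grid is within L(n + m) of the corner value, so at this threshold all cells
  -- are free.
  have hup : F ≤ f 0 0 + L * (n + m) := by
    rw [hF]
    have h := reach_true (n - 1) (m - 1)
    rw [Nat.sub_add_cancel hn, Nat.sub_add_cancel hm] at h
    refine (reach_congr (n := n) (m := m) (fun i hi j hj => ?_) n le_rfl m le_rfl).1 h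
    rw [true_iff]
    have k1 := (abs_le.1 (abs_sub_le_of_steps (f := fun i => f i 0) (hf' 0 hm) (j := 0) i
      (by omega))).2
    have k2 := (abs_le.1 (abs_sub_le_of_steps (f := f i) (hf i hi) (j := 0) j (by omega))).2
    rw [zero_add] at k1 k2
    have hℓL : ℓ ≤ L := by linarith
    have k3 : (i : ℝ) * ℓ ≤ n * L := by gcongr
    have k4 : (j : ℝ) * ℓ ≤ m * L := by gcongr
    linarith
  rw [exec_seq, exec_setNat, exec_seq, exec_setNat, exec_seq]
  unfold distance
  rw [exec_setReal, exec_seq, exec_setReal, exec_seq]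
  refine (exec_max _ _).mono ?_
  rintro _ T₁ ⟨rfl, hT₁⟩
  rw [exec_seq, exec_setReal, exec_seq]
  simp only [RealExpr.eval, NatExpr.eval, setNat_natVar, setNat_realVar, setNat_realArr,
    setReal_realVar, setReal_natVar]
  norm_num only [if_true, if_false]
  rw [hd, hε, hs.natVar_zero, hs.natVar_one]
  refine (exec_searchLoop (F := F) (B := B) (ε := ε) (hs.of_eq ?_ ?_ ?_) hn hm hε0 ?_ hL hL0 hℓ hf
    hf' hK hF hJ0 hJ hB0 hB ?_ ?_ ?_).mono ?_
  · simp [setNat_natVar, setReal_natVar]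
  · simp [setNat_natVar, setReal_natVar]
  · intro a _; rfl
  · simp [setReal_realVar, setNat_realVar, hε]
  · simp [setReal_realVar]
  · simp [setReal_realVar, hεF, hd0]
  · simp only [setReal_realVar, if_true]
    push_cast
    have : 0 ≤ f 0 0 + L * ((n : ℝ) + m) := add_nonneg (hf0 0 0) (by positivity)
    nlinarith
  rintro s' T ⟨hfr, h1, h2, h3, hT⟩
  have e0 : s'.realVar 0 = ε := by
    rw [hfr.realVar 0 (by simp)]; simp [setReal_realVar, setNat_realVar, hε]
  simp only [exec_setReal, RealExpr.eval, NatExpr.eval, State.output, setReal_realVar, if_true, e0]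
  have hN : (2 : ℝ) ≤ n + m := by
    have : 2 ≤ n + m := by omega
    exact_mod_cast this
  refine ⟨by push_cast; linarith, ?_, ?_⟩
  · push_cast
    -- The output is at most (1 + ε/4)²·F ≤ (1 + ε)·F.
    have h4 : s'.realVar 5 ≤ (1 + ε / 4) * F := by nlinarith
    have h5 : (1 + ε / 4) * s'.realVar 5 ≤ (1 + ε / 4) * ((1 + ε / 4) * F) := by gcongr
    have hF0 : 0 < F := hε0.trans_le hεF
    nlinarith [mul_pos hε0 hF0]
  · have hle : max 1 (2 * (f 0 0 + (L : ℝ) * (n + m) - max ε (f 0 0)) / (ε ^ 2 / 4)) ≤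
        8 * L * (n + m) / ε ^ 2 := by
      have e1 : 2 * ((L : ℝ) * (n + m)) / (ε ^ 2 / 4) = 8 * L * (n + m) / ε ^ 2 := by
        field_simp; ring
      refine max_le ?_ ?_
      · rw [le_div_iff₀ (by positivity)]
        nlinarith
      · rw [← e1]
        gcongr
        linarith [le_max_right ε (f 0 0)]
    have hlogle := Real.logb_le_logb_of_le one_lt_two (by positivity) hle
    have hmul := mul_le_mul_of_nonneg_left hlogle (show 0 ≤ B + 60 by linarith)
    simp only [setReal_realVar] at hT
    norm_num only [if_true, if_false] at hT
    simp only [RealExpr.cost, NatExpr.cost] at hT₁ ⊢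
    have hT₁' : (T₁ : ℝ) ≤ 7 := by exact_mod_cast hT₁
    push_cast at hT ⊢
    linarith

theorem exec_approximate (hs : Loaded c f n m s) (hn : 0 < n) (hm : 0 < m) (hε0 : 0 < ε)
    (hε1 : ε < 1) (hε : s.realVar 0 = ε) (hzero : s.realArr 4 = 0) (hL : 8 * ℓ ≤ L) (hL0 : 0 < L)
    (hℓ : 0 ≤ ℓ) (hf0 : ∀ i j, 0 ≤ f i j)
    (hf : ∀ i < n, ∀ j, j + 1 < m → |f i (j + 1) - f i j| ≤ ℓ)
    (hf' : ∀ j < m, ∀ i, i + 1 < n → |f (i + 1) j - f i j| ≤ ℓ) (hK : m < 2 ^ K)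
    (hF0 : 0 ≤ F) (hF : ∀ x, F ≤ x ↔ reach (fun i j => f i j ≤ x) n m)
    {J₁ : ℝ} (hJ₁0 : 0 ≤ J₁)
    (hJ₁ : ∀ i < n, jumpPotential K (3 * L) (fun j => |f i j - ε|) m 0 ≤ J₁)
    (hJ0 : ∀ μ, ε ≤ μ → 0 ≤ J μ) (hJ : ∀ μ, ε ≤ μ → ∀ i < n,
      jumpPotential K (3 * L) (fun j => |f i j - (μ + ε * μ / 8)|) m 0 ≤ J μ)
    (hB0 : 0 ≤ B) (hB : ∀ μ, ε ≤ μ → ∀ κ : ℕ, (κ = 0 ∨ (2 : ℝ) ^ κ * L ≤ ε * μ) →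
      (n < 2 ^ κ ∨ ε * μ ≤ 2 * (2 ^ κ * L)) →
      rowCount n (2 ^ κ) * ((18 * Nat.log 2 m + 210) * J μ + 90) + 18 * Nat.log 2 n + 120 ≤ B) :
    Exec c (approximate L) s fun s' T => F ≤ s'.output ∧ s'.output ≤ (1 + ε) * F ∧
      (T : ℝ) ≤ n * ((18 * Nat.log 2 m + 200) * J₁ + 40) +
        (B + 60) * Real.logb 2 (8 * L * (n + m) / ε ^ 2) + 200 := by
  unfold approximate
  have hℓL : ℓ < L := by
    have : (0 : ℝ) < L := by exact_mod_cast hL0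
    linarith
  have hlog : 0 ≤ (B + 60) * Real.logb 2 (8 * L * (n + m) / ε ^ 2) := by
    refine mul_nonneg (by linarith) (Real.logb_nonneg one_lt_two ?_)
    have h1 : (1 : ℝ) ≤ L := by exact_mod_cast hL0
    have h2 : (1 : ℝ) ≤ n := by exact_mod_cast hn
    have h3 : (0 : ℝ) ≤ m := Nat.cast_nonneg m
    rw [le_div_iff₀ (by positivity)]
    nlinarith
  rw [exec_seq]
  refine (exec_sparseDP hs hε hε1 hf0 hL0 hℓL hf hK hJ₁0 hJ₁ hzero).mono ?_
  rintro s₁ T₁ ⟨hfr, hY, hT₁⟩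
  have hs₁ : Loaded c f n m s₁ := by
    refine hs.of_eq ?_ ?_ fun a ha => ?_
    · rw [hfr.natVar 0 (by simp)]
    · rw [hfr.natVar 1 (by simp)]
    · rw [hfr.realArr a (by simp; omega)]
  have e0 : s₁.realVar 0 = ε := by rw [hfr.realVar 0 (by simp), hε]
  set Y := s₁.realArr 4 (s₁.natVar 10 + m) with hYdef
  have hY' : ∀ x, 0 ≤ x → x ≤ ε → (F ≤ x ↔ 1 - x ≤ Y) := fun x h0 h1 => by rw [hF, hY x h0 h1]
  rw [exec_ite]
  simp only [Test.Holds, RealExpr.eval, NatExpr.eval, e0, hs₁.natVar_one, ← hYdef, Nat.cast_one]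
  refine ⟨fun h => ?_, fun h => ?_⟩
  · have hFε := (hY' ε hε0.le le_rfl).2 h
    have h1 := (hY' F hF0 hFε).1 le_rfl
    -- The specification of the table speaks of nonnegative thresholds only and does not exclude 1 <
    -- Y; hence the maximum with 0.
    have h2 := (hY' (max (1 - Y) 0) (le_max_right _ _) (max_le (by linarith) hε0.le)).2
      (by linarith [le_max_left (1 - Y) 0])
    have hFeq : max (1 - Y) 0 = F := le_antisymm (max_le (by linarith) hF0) h2
    rw [exec_seq, exec_setReal]
    refine (exec_max _ _).mono ?_
    rintro _ T₂ ⟨rfl, hT₂⟩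
    simp only [State.output, setReal_realVar, RealExpr.eval, NatExpr.eval, if_true, hs₁.natVar_one,
      ← hYdef, Nat.cast_one, Nat.cast_zero, hFeq]
    refine ⟨le_rfl, by nlinarith, ?_⟩
    simp only [RealExpr.cost, NatExpr.cost, Test.cost] at hT₂ ⊢
    have hT₂' : (T₂ : ℝ) ≤ 9 := by exact_mod_cast hT₂
    push_cast
    linarith
  · have hFε : ε ≤ F := by
      by_contra hc
      exact h ((hY' ε hε0.le le_rfl).1 (not_le.1 hc).le)
    refine (exec_search hs₁ hn hm hε0 hε1 e0 hL hL0 hℓ hf0 hf hf' hK hF hJ0 hJ hB0 hB hFε).mono ?_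
    rintro s₂ T₂ ⟨h1, h2, h3⟩
    refine ⟨h1, h2, ?_⟩
    simp only [RealExpr.cost, NatExpr.cost, Test.cost]
    push_cast
    linarith

end

end RealRAM


/-! ### The running time -/

/-- `√δ / ε ^ 1.5 * N ^ 1.5`. -/
def timeBound (δ : ℕ) (ε N : ℝ) : ℝ := Real.sqrt δ / ε ^ (1.5 : ℝ) * N ^ (1.5 : ℝ)

section Time

variable {δ n m L κ : ℕ} {ε μ D N R : ℝ}

theorem rpow_three_halves_sq {x : ℝ} (hx : 0 ≤ x) : (x ^ (1.5 : ℝ)) ^ 2 = x ^ 3 := by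
  rw [← Real.rpow_natCast, ← Real.rpow_mul hx, ← Real.rpow_natCast]
  norm_num

theorem timeBound_nonneg (hε : 0 < ε) (hN : 0 ≤ N) : 0 ≤ timeBound δ ε N := by
  unfold timeBound; positivity

theorem timeBound_sq (hε : 0 < ε) (hN : 0 ≤ N) :
    timeBound δ ε N ^ 2 = δ * N ^ 3 / ε ^ 3 := by
  unfold timeBound
  rw [mul_pow, div_pow, rpow_three_halves_sq hε.le, rpow_three_halves_sq hN,
    Real.sq_sqrt (Nat.cast_nonneg δ)]
  ring

/-- Comparing squares removes the half-integral exponents. -/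
theorem le_of_sq_le_timeBound {x C : ℝ} (hε : 0 < ε) (hN : 0 ≤ N) (hC : 0 ≤ C)
    (h : x ^ 2 ≤ C ^ 2 * (δ * N ^ 3 / ε ^ 3)) : x ≤ C * timeBound δ ε N := by
  rw [← timeBound_sq hε hN, ← mul_pow] at h
  exact (abs_le_of_sq_le_sq' h (mul_nonneg hC (timeBound_nonneg hε hN))).2

theorem le_timeBound (hδ : 1 ≤ δ) (hε : 0 < ε) (hε1 : ε < 1) (hN : 1 ≤ N) :
    N ≤ timeBound δ ε N := by
  have h1 : (1 : ℝ) ≤ δ := by exact_mod_cast hδ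
  rw [← one_mul (timeBound δ ε N)]
  refine le_of_sq_le_timeBound hε (by linarith) zero_le_one ?_
  rw [one_pow, one_mul, le_div_iff₀ (by positivity)]
  have h2 : ε ^ 3 ≤ 1 := pow_le_one₀ hε.le hε1.le
  calc N ^ 2 * ε ^ 3 ≤ N ^ 2 * 1 := by gcongr
    _ ≤ 1 * N ^ 3 := by nlinarith [sq_nonneg N]
    _ ≤ δ * N ^ 3 := by gcongr

/-- With stride one, εμ ≤ 2L, so that μ = O(L/ε). With a larger stride, the row count R satisfies
R·εμ ≤ 4nL; as εμ ≥ 1, one factor εμ may be added to 3R²·εμ, which gives 3(4nL)² = 48n²L². If the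
stride exceeds n, a single row remains, and μ is not bounded at all. -/
theorem rowCount_sq_le (hn : 0 < n) (hε : 0 < ε) (hε1 : ε < 1) (hL : 1 ≤ L) (hμ : ε ≤ μ)
    (hκ : κ = 0 ∨ (2 : ℝ) ^ κ * L ≤ ε * μ) (hκ' : n < 2 ^ κ ∨ ε * μ ≤ 2 * (2 ^ κ * L)) :
    (RealRAM.rowCount n (2 ^ κ) : ℝ) = 1 ∨
      (RealRAM.rowCount n (2 ^ κ) : ℝ) ^ 2 * (μ + ε * μ / 8 + 1) ≤ 48 * L ^ 2 * n ^ 2 / ε := by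
  have hL1 : (1 : ℝ) ≤ L := by exact_mod_cast hL
  have hn1 : (1 : ℝ) ≤ n := by exact_mod_cast hn
  have hμ0 : 0 < μ := hε.trans_le hμ
  rcases Nat.lt_or_ge n (2 ^ κ) with h | h
  · left
    rw [RealRAM.rowCount, Nat.div_eq_of_lt (by omega)]
    simp
  right
  replace hκ' := hκ'.resolve_left (by omega)
  rw [le_div_iff₀ hε]
  rcases hκ with rfl | hκ
  · have hr : RealRAM.rowCount n (2 ^ 0) = n := by
      simp only [RealRAM.rowCount, pow_zero, Nat.div_one]; omega
    rw [hr]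
    have h1 : (μ + ε * μ / 8 + 1) * ε ≤ 48 * L ^ 2 := by
      rw [pow_zero, one_mul] at hκ'
      have : ε * μ / 8 * ε ≤ ε * μ / 8 := mul_le_of_le_one_right (by positivity) hε1.le
      nlinarith
    calc (n : ℝ) ^ 2 * (μ + ε * μ / 8 + 1) * ε = (n : ℝ) ^ 2 * ((μ + ε * μ / 8 + 1) * ε) := by ring
      _ ≤ (n : ℝ) ^ 2 * (48 * (L : ℝ) ^ 2) := by gcongr
      _ = _ := by ring
  · set rc := RealRAM.rowCount n (2 ^ κ) with hrc
    have h1 : rc * 2 ^ κ ≤ 2 * n := by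
      rw [hrc, RealRAM.rowCount, add_mul]
      have := Nat.div_mul_le_self (n - 1) (2 ^ κ)
      omega
    have h2 : (rc : ℝ) * 2 ^ κ ≤ 2 * n := by exact_mod_cast h1
    have h3 : (1 : ℝ) ≤ 2 ^ κ := one_le_pow₀ (by norm_num)
    have h4 : 1 ≤ ε * μ := by nlinarith
    have h5 : 1 ≤ μ := by nlinarith
    have h6 : (rc : ℝ) * (ε * μ) ≤ 4 * n * L := by
      calc (rc : ℝ) * (ε * μ) ≤ rc * (2 * (2 ^ κ * L)) := by gcongr
        _ = 2 * (rc * 2 ^ κ) * L := by ring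
        _ ≤ 2 * (2 * n) * L := by gcongr
        _ = _ := by ring
    have h7 : μ + ε * μ / 8 + 1 ≤ 3 * μ := by nlinarith
    calc (rc : ℝ) ^ 2 * (μ + ε * μ / 8 + 1) * ε ≤ rc ^ 2 * (3 * μ) * ε := by gcongr
      _ = 3 * rc ^ 2 * (ε * μ) * 1 := by ring
      _ ≤ 3 * rc ^ 2 * (ε * μ) * (ε * μ) := by gcongr
      _ = 3 * (rc * (ε * μ)) ^ 2 := by ring
      _ ≤ 3 * (4 * n * L) ^ 2 := by gcongr
      _ = _ := by ring

/-- The number of jumps in all rows is bounded by the geometric mean of two bounds. -/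
theorem mul_min_le_timeBound (hδ : 1 ≤ δ) (hε : 0 < ε) (hε1 : ε < 1) (hn : 0 < n) (hL : 1 ≤ L)
    (hD : 0 ≤ D) (hR0 : 0 ≤ R) (hR : R = 1 ∨ R ^ 2 * (D + 1) ≤ 48 * L ^ 2 * n ^ 2 / ε) :
    R * min (m : ℝ) (60 * L * Real.sqrt (m * δ * (D + 1)) / ε) ≤
      480 * L ^ 2 * timeBound δ ε (n + m) := by
  have hL1 : (1 : ℝ) ≤ L := by exact_mod_cast hL
  have hn1 : (1 : ℝ) ≤ n := by exact_mod_cast hn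
  have hm0 : (0 : ℝ) ≤ m := Nat.cast_nonneg m
  rcases hR with rfl | hR
  · rw [one_mul]
    have := le_timeBound hδ hε hε1 (show (1 : ℝ) ≤ n + m by linarith)
    calc _ ≤ (m : ℝ) := min_le_left _ _
      _ ≤ 1 * timeBound δ ε (n + m) := by linarith
      _ ≤ _ := mul_le_mul_of_nonneg_right (by nlinarith)
        (timeBound_nonneg hε (by positivity))
  · refine (mul_le_mul_of_nonneg_left (min_le_right _ _) hR0).trans ?_
    refine le_of_sq_le_timeBound hε (by positivity) (by positivity) ?_
    rw [mul_pow, div_pow, mul_pow, Real.sq_sqrt (by positivity)]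
    calc R ^ 2 * ((60 * L) ^ 2 * (m * δ * (D + 1)) / ε ^ 2) =
        R ^ 2 * (D + 1) * (3600 * L ^ 2 * m * δ / ε ^ 2) := by ring
      _ ≤ 48 * L ^ 2 * n ^ 2 / ε * (3600 * L ^ 2 * m * δ / ε ^ 2) := by gcongr
      _ = 172800 * L ^ 4 * (δ * (n ^ 2 * m) / ε ^ 3) := by field_simp; ring
      _ ≤ 230400 * L ^ 4 * (δ * (n + m) ^ 3 / ε ^ 3) := by
        gcongr
        · norm_num
        · nlinarith [mul_nonneg (sq_nonneg (n : ℝ)) hm0, mul_nonneg (sq_nonneg (m : ℝ)) hm0,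
            mul_nonneg (mul_nonneg hm0 hm0) (by linarith : (0 : ℝ) ≤ n),
            pow_nonneg (by linarith : (0 : ℝ) ≤ n) 3]
      _ = _ := by ring

theorem two_thirds_le_log (hN : 2 ≤ N) : 2 / 3 ≤ Real.log N := by
  have h1 := Real.log_le_log (by norm_num) hN
  linarith [Real.log_two_gt_d9]

theorem natLog_le {a : ℕ} (ha : 0 < a) (haN : (a : ℝ) ≤ N) :
    (Nat.log 2 a : ℝ) ≤ 3 / 2 * Real.log N := by
  have h0 : (0 : ℝ) < a := by exact_mod_cast ha
  have h1 : ((2 ^ Nat.log 2 a : ℕ) : ℝ) ≤ a := by exact_mod_cast Nat.pow_log_le_self 2 ha.ne'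
  have h2 := Real.log_le_log (by positivity) (h1.trans haN)
  push_cast at h2
  rw [Real.log_pow] at h2
  have h3 : (0 : ℝ) ≤ Nat.log 2 a := Nat.cast_nonneg _
  nlinarith [Real.log_two_gt_d9]

/-- One factor Λ comes from the levels of the jump potential, the other from the doubling inside
every probe. -/
theorem rows_cost_le {J M Λ lm : ℝ} (hΛ : 2 / 3 ≤ Λ) (hlm : lm ≤ 3 / 2 * Λ)
    (hM : 1 ≤ M) (hJ : J ≤ 1 + (3 / 2 * Λ + 1) * M) (hJ0 : 0 ≤ J) :
    (18 * lm + 210) * J + 90 ≤ 2400 * Λ ^ 2 * M := by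
  have h1 : J ≤ 5 * Λ * M := by nlinarith
  have h2 : 18 * lm + 210 ≤ 350 * Λ := by linarith
  have h3 : (18 * lm + 210) * J ≤ 350 * Λ * (5 * Λ * M) :=
    (mul_le_mul_of_nonneg_right h2 hJ0).trans (by gcongr)
  have h4 : 4 / 9 ≤ Λ ^ 2 := by nlinarith
  nlinarith

/-- The number of bisection steps costs only a logarithmic factor. -/
theorem min_mul_log_le (hδ : 1 ≤ δ) (hε : 0 < ε) (hε1 : ε < 1) (hN : 2 ≤ N) {C : ℝ} (hC : 1 ≤ C) :
    min (C * timeBound δ ε N) (N ^ 2) * Real.log (1 / ε) ≤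
      2 * C * timeBound δ ε N * Real.log N := by
  have hE := timeBound_nonneg (δ := δ) hε (show 0 ≤ N by linarith)
  have hΛ := two_thirds_le_log hN
  have hlog0 : 0 ≤ Real.log (1 / ε) := Real.log_nonneg (by rw [le_div_iff₀ hε]; linarith)
  set E := timeBound δ ε N with hEdef
  have hδ1 : (1 : ℝ) ≤ δ := by exact_mod_cast hδ
  -- If ε ≥ N^(-1/3), then log(1/ε) ≤ log N. For smaller ε the bound N² is better than E by the
  -- factor w = (Nε³)^(-1/2), and log w ≤ w shows that this gain outweighs log(1/ε).
  by_cases h : 1 ≤ N * ε ^ 3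
  · have h1 := Real.log_nonneg h
    rw [Real.log_mul (by positivity) (by positivity), Real.log_pow] at h1
    have h2 : Real.log (1 / ε) ≤ Real.log N := by
      rw [Real.log_div one_ne_zero hε.ne', Real.log_one]
      push_cast at h1
      linarith
    calc _ ≤ C * E * Real.log N := by
          gcongr
          exact min_le_left _ _
      _ ≤ 2 * (C * E * Real.log N) := by
          have : 0 ≤ C * E * Real.log N := by positivity
          linarith
      _ = _ := by ring
  · have h0 : N * ε ^ 3 < 1 := not_le.1 h
    -- `w ^ 2 = 1 / (N ε³)`
    set w := Real.sqrt (1 / (N * ε ^ 3)) with hw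
    have hNε : 0 < N * ε ^ 3 := by positivity
    have hw1 : 1 ≤ w := by
      rw [hw, Real.one_le_sqrt, le_div_iff₀ hNε]
      linarith
    have hlw : Real.log w ≤ w := (Real.log_le_sub_one_of_pos (by linarith)).trans (by linarith)
    have hlw2 : Real.log w = (3 * Real.log (1 / ε) - Real.log N) / 2 := by
      rw [hw, Real.log_sqrt (by positivity), Real.log_div one_ne_zero hNε.ne', Real.log_one,
        Real.log_mul (by positivity) (by positivity), Real.log_pow,
        Real.log_div one_ne_zero hε.ne', Real.log_one]
      push_cast
      ring
    have h1 : Real.log (1 / ε) ≤ 2 * w * Real.log N := by nlinarith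
    have h2 : N ^ 2 * w ≤ 1 * E := by
      refine le_of_sq_le_timeBound hε (by linarith) zero_le_one ?_
      rw [mul_pow, hw, Real.sq_sqrt (by positivity)]
      have : (N ^ 2) ^ 2 * (1 / (N * ε ^ 3)) = N ^ 3 / ε ^ 3 := by field_simp
      rw [this, one_pow, one_mul]
      gcongr
      have : 0 ≤ N ^ 3 := by positivity
      nlinarith
    have h3 : N ^ 2 * w ≤ C * E := by nlinarith
    calc _ ≤ N ^ 2 * (2 * w * Real.log N) := by
          gcongr
          exact min_le_right _ _
      _ = 2 * (N ^ 2 * w) * Real.log N := by ring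
      _ ≤ 2 * (C * E) * Real.log N := by
          exact mul_le_mul_of_nonneg_right (by linarith) (by linarith)
      _ = _ := by ring

theorem logb_iterations_le (hε : 0 < ε) (hε1 : ε < 1) (hN : 2 ≤ N) (hL : 1 ≤ L) :
    Real.logb 2 (8 * L * N / ε ^ 2) ≤ 40 * L * Real.log N + 3 * Real.log (1 / ε) := by
  have hL1 : (1 : ℝ) ≤ L := by exact_mod_cast hL
  have hΛ := two_thirds_le_log hN
  have h2 := Real.log_two_gt_d9
  have h3 := Real.log_two_lt_d9
  have e1 : Real.log (8 * L * N / ε ^ 2) =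
      3 * Real.log 2 + Real.log L + Real.log N + 2 * Real.log (1 / ε) := by
    have : (8 : ℝ) = 2 ^ 3 := by norm_num
    rw [Real.log_div (by positivity) (by positivity), Real.log_mul (by positivity) (by positivity),
      Real.log_mul (by norm_num) (by positivity), Real.log_pow, Real.log_div one_ne_zero hε.ne',
      Real.log_one, this, Real.log_pow]
    push_cast
    ring
  have hlog0 : 0 ≤ Real.log (1 / ε) := Real.log_nonneg (by rw [le_div_iff₀ hε]; linarith)
  have hlogL : Real.log L ≤ L := (Real.log_le_sub_one_of_pos (by linarith)).trans (by linarith)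
  have k1 : Real.log N ≤ L * Real.log N := le_mul_of_one_le_left (by linarith) hL1
  have k2 : (L : ℝ) * (2 / 3) ≤ L * Real.log N := by gcongr
  rw [Real.logb, div_le_iff₀ (by linarith), e1]
  have k3 : (40 * L * Real.log N + 3 * Real.log (1 / ε)) * 0.69 ≤
      (40 * L * Real.log N + 3 * Real.log (1 / ε)) * Real.log 2 := by
    gcongr
    linarith
  linarith

end Time

/-! ### Assembling the running time. -/

section Final

variable {c : ℝ≥0∞} {n m : ℕ} {P : Fin n → Plane} {Q : Fin m → Plane} {γ ε : ℝ} {δ : ℕ}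

theorem loaded_input : RealRAM.Loaded c (gridDist c P Q) n m (RealRAM.input P Q ε) := by
  refine ⟨rfl, rfl, fun i hi j hj => ?_⟩
  simp [RealRAM.State.cellDist, RealRAM.input, gridDist, hi, hj, lcDist]

theorem IsEpsDeltaCurve.one_le (hε : 0 < ε) (hm : 0 < m) (hQ : IsEpsDeltaCurve γ ε δ Q) :
    1 ≤ δ := by
  refine le_trans ?_ (hQ.2 (Q ⟨0, hm⟩))
  rw [Nat.one_le_iff_ne_zero, ← Nat.pos_iff_ne_zero, Set.ncard_pos]
  exact ⟨⟨0, hm⟩, Metric.mem_closedBall_self hε.le⟩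

/-- The product X * l has a hypothesis of its own, since l stands for log(1/ε), which no multiple of
Λ = log(n + m) bounds. -/
theorem total_time_le {E X Λ l I T L : ℝ} (hL : 1 ≤ L) (hΛ : 2 / 3 ≤ Λ) (hX : 1 ≤ X)
    (hl : 0 ≤ l) (hI : I ≤ 40 * L * Λ + 3 * l) (hXE : X ≤ 480 * L ^ 2 * E)
    (hXl : X * l ≤ 2 * (480 * L ^ 2) * E * Λ)
    (hT : T ≤ 2400 * Λ ^ 2 * X + (2400 * Λ ^ 2 * X + 27 * Λ + 120 + 60) * I + 200) :
    T ≤ 10 ^ 8 * L ^ 3 * E * Λ ^ 3 := by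
  have hΛ0 : 0 < Λ := by linarith
  have hΛ2 : 4 / 9 ≤ Λ ^ 2 := by nlinarith
  have hΛX : Λ ^ 2 ≤ Λ ^ 2 * X := le_mul_of_one_le_right (by positivity) hX
  have h1 : 2400 * Λ ^ 2 * X + 27 * Λ + 120 + 60 ≤ 2900 * (Λ ^ 2 * X) := by nlinarith
  have hI0 : 0 ≤ 40 * L * Λ + 3 * l := by positivity
  have h2 : (2400 * Λ ^ 2 * X + 27 * Λ + 120 + 60) * I ≤
      2900 * (Λ ^ 2 * X) * (40 * L * Λ + 3 * l) := by
    have : 0 ≤ 2400 * Λ ^ 2 * X + 27 * Λ + 120 + 60 := by positivity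
    exact (mul_le_mul_of_nonneg_left hI this).trans (mul_le_mul_of_nonneg_right h1 hI0)
  have hE0 : 0 ≤ E := by
    by_contra hc
    have : 480 * L ^ 2 * E ≤ 0 := mul_nonpos_of_nonneg_of_nonpos (by positivity) (not_le.1 hc).le
    linarith
  have h3 : Λ ^ 2 * X * (L * Λ) ≤ 480 * (L ^ 3 * E * Λ ^ 3) := by
    calc Λ ^ 2 * X * (L * Λ) = (Λ ^ 3 * L) * X := by ring
      _ ≤ (Λ ^ 3 * L) * (480 * L ^ 2 * E) := by gcongr
      _ = _ := by ring
  have h4 : Λ ^ 2 * X * l ≤ 960 * (L ^ 3 * E * Λ ^ 3) := by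
    calc Λ ^ 2 * X * l = Λ ^ 2 * (X * l) := by ring
      _ ≤ Λ ^ 2 * (2 * (480 * L ^ 2) * E * Λ) := by gcongr
      _ = 960 * (L ^ 2 * (E * Λ ^ 3)) := by ring
      _ ≤ 960 * (L ^ 3 * (E * Λ ^ 3)) := by
        gcongr
        norm_num
      _ = _ := by ring
  have h5 : Λ ^ 2 * X ≤ 3 / 2 * (Λ ^ 2 * X * (L * Λ)) := by
    have h6 : 2 / 3 ≤ L * Λ := by nlinarith
    have h7 : Λ ^ 2 * X * (2 / 3) ≤ Λ ^ 2 * X * (L * Λ) := by gcongr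
    linarith
  nlinarith

end Final

theorem mainTheorem4 (γ : ℝ) (hγ : 0 < γ) :
    ∃ (A : RealRAM.Program) (C : ℝ) (k : ℕ),
      ∀ (c : ENNReal), 1 ≤ c →
      ∀ (n m : ℕ), 0 < n → 0 < m →
      ∀ (P : Fin n → Plane) (Q : Fin m → Plane) (ε : ℝ) (δ : ℕ), 0 < ε → ε < 1 →
        EdgesAtMost γ P → IsEpsDeltaCurve γ ε δ Q →
        ∃ (T : ℕ) (s : RealRAM.State),
          RealRAM.Runs c A (RealRAM.input P Q ε) T s ∧
          (T : ℝ) ≤ C * (Real.sqrt (δ : ℝ) / ε ^ (1.5 : ℝ)) * ((n : ℝ) + (m : ℝ)) ^ (1.5 : ℝ) *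
            Real.log ((n : ℝ) + (m : ℝ)) ^ k ∧
          discreteFrechet c P Q ≤ s.output ∧
          s.output ≤ (1 + ε) * discreteFrechet c P Q := by
  -- The distances change by at most ℓ = 2γ per step, and L ≥ 8ℓ is needed; the summand 1 makes L
  -- positive. As a natural number, L can stand in the text of the program.
  set L : ℕ := ⌈16 * γ⌉₊ + 1 with hLdef
  have hL : 1 ≤ L := by omega
  have hLγ : 8 * (2 * γ) ≤ (L : ℝ) := by
    rw [hLdef]
    push_cast
    linarith [Nat.le_ceil (16 * γ)]
  refine ⟨RealRAM.approximate L, 10 ^ 8 * L ^ 3, 3, ?_⟩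
  intro c hc n m hn hm P Q ε δ hε hε1 hP hQ
  have hL1 : (1 : ℝ) ≤ L := by exact_mod_cast hL
  have hn1 : (1 : ℝ) ≤ n := by exact_mod_cast hn
  have hm1 : (1 : ℝ) ≤ m := by exact_mod_cast hm
  have hδ := hQ.one_le hε hm
  have hδ1 : (1 : ℝ) ≤ δ := by exact_mod_cast hδ
  set N : ℝ := (n : ℝ) + m with hN
  have hN2 : 2 ≤ N := by rw [hN]; linarith
  set Λ := Real.log N with hΛdef
  have hΛ := two_thirds_le_log hN2
  set K := Nat.log 2 m + 1 with hKdef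
  have hK : m < 2 ^ K := Nat.lt_pow_succ_log_self one_lt_two m
  have hlm := natLog_le (N := N) hm (by rw [hN]; linarith)
  have hln := natLog_le (N := N) hn (by rw [hN]; linarith)
  have hKΛ : (K : ℝ) ≤ 3 / 2 * Λ + 1 := by rw [hKdef]; push_cast; linarith
  let M : ℝ → ℝ := fun D => min (m : ℝ) (60 * L * Real.sqrt (m * δ * (D + 1)) / ε)
  let J : ℝ → ℝ := fun D => 1 + K * M D
  have hM1 : ∀ D, 0 ≤ D → 1 ≤ M D := fun D hD => by
    refine le_min hm1 ?_
    rw [le_div_iff₀ hε]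
    have h1 : 1 ≤ Real.sqrt (m * δ * (D + 1)) := by
      rw [Real.one_le_sqrt]
      have : (1 : ℝ) ≤ m * δ := one_le_mul_of_one_le_of_one_le hm1 hδ1
      exact one_le_mul_of_one_le_of_one_le this (by linarith)
    have h2 : (1 : ℝ) ≤ L * Real.sqrt (m * δ * (D + 1)) :=
      one_le_mul_of_one_le_of_one_le hL1 h1
    linarith
  have hJ0 : ∀ D, 0 ≤ D → 0 ≤ J D := fun D hD =>
    add_nonneg zero_le_one (mul_nonneg (Nat.cast_nonneg K) (by linarith [hM1 D hD]))
  have hJM : ∀ D, 0 ≤ D → (18 * (Nat.log 2 m : ℝ) + 210) * J D + 90 ≤ 2400 * Λ ^ 2 * M D :=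
    fun D hD => by
      refine rows_cost_le hΛ hlm (hM1 D hD) ?_ (hJ0 D hD)
      have := mul_le_mul_of_nonneg_right hKΛ (show 0 ≤ M D by linarith [hM1 D hD])
      show 1 + K * M D ≤ _
      linarith
  set E := timeBound δ ε N with hE
  -- The trivial bound N² is retained because it absorbs log(1/ε) for very small ε.
  set X := min (480 * (L : ℝ) ^ 2 * E) (N ^ 2) with hX
  have hMX : ∀ (R : ℕ) (D : ℝ), R ≤ n → 0 ≤ D →
      ((R : ℝ) = 1 ∨ (R : ℝ) ^ 2 * (D + 1) ≤ 48 * L ^ 2 * n ^ 2 / ε) → R * M D ≤ X := by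
    intro R D hRn hD hR
    refine le_min (mul_min_le_timeBound hδ hε hε1 hn hL hD (Nat.cast_nonneg R) hR) ?_
    have h1 : (R : ℝ) ≤ n := by exact_mod_cast hRn
    calc (R : ℝ) * M D ≤ n * m := by
          gcongr
          exact min_le_left _ _
      _ ≤ N ^ 2 := by rw [hN]; nlinarith
  have hE1 : 1 ≤ E := le_trans (by linarith) (le_timeBound hδ hε hε1 (by linarith : 1 ≤ N))
  have hX1 : 1 ≤ X := le_min (by nlinarith) (by nlinarith)
  have hrows : ∀ (R : ℕ) (D : ℝ), R ≤ n → 0 ≤ D →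
      ((R : ℝ) = 1 ∨ (R : ℝ) ^ 2 * (D + 1) ≤ 48 * L ^ 2 * n ^ 2 / ε) →
      R * ((18 * (Nat.log 2 m : ℝ) + 210) * J D + 90) ≤ 2400 * Λ ^ 2 * X := by
    intro R D hRn hD hR
    calc _ ≤ (R : ℝ) * (2400 * Λ ^ 2 * M D) := by gcongr; exact hJM D hD
      _ = 2400 * Λ ^ 2 * (R * M D) := by ring
      _ ≤ _ := by gcongr; exact hMX R D hRn hD hR
  have hF0 : 0 ≤ discreteFrechet c P Q := by
    by_contra hc'
    have h := (discreteFrechet_le_iff (c := c) (P := P) (Q := Q) hn hm _).1 (le_refl _)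
    obtain ⟨F, hF⟩ := (exists_walkCost_le_iff hn hm _).2 h
    rw [walkCost_le_iff] at hF
    exact hc' ((gridDist_nonneg hc _ _).trans (hF 0))
  have hB : ∀ μ, ε ≤ μ → ∀ κ : ℕ, (κ = 0 ∨ (2 : ℝ) ^ κ * L ≤ ε * μ) →
      (n < 2 ^ κ ∨ ε * μ ≤ 2 * (2 ^ κ * L)) →
      RealRAM.rowCount n (2 ^ κ) * ((18 * (Nat.log 2 m : ℝ) + 210) * J (μ + ε * μ / 8) + 90) +
        18 * Nat.log 2 n + 120 ≤ 2400 * Λ ^ 2 * X + 27 * Λ + 120 := by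
    intro μ hμ κ hκ hκ'
    have hμ0 : 0 < μ := hε.trans_le hμ
    have hrc : RealRAM.rowCount n (2 ^ κ) ≤ n := by
      have := Nat.div_le_self (n - 1) (2 ^ κ)
      unfold RealRAM.rowCount
      omega
    have := hrows _ (μ + ε * μ / 8) hrc (by positivity)
      (rowCount_sq_le hn hε hε1 hL hμ hκ hκ')
    linarith
  obtain ⟨T, s, hrun, h1, h2, hT⟩ := RealRAM.exec_approximate (c := c) (f := gridDist c P Q)
    (s := RealRAM.input P Q ε) (n := n) (m := m) (L := L) (K := K) (ℓ := 2 * γ) (ε := ε)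
    (F := discreteFrechet c P Q) (B := 2400 * Λ ^ 2 * X + 27 * Λ + 120)
    (J := fun μ => J (μ + ε * μ / 8)) (J₁ := J ε) loaded_input hn hm hε hε1 rfl
    (by funext i; simp [RealRAM.input]) hLγ hL (by positivity) (gridDist_nonneg hc)
    (fun i hi j hj => gridDist_succ_right hc hQ.1 hi j hj)
    (fun j hj i hi => gridDist_succ_left hc hP hj i hi) hK hF0 (discreteFrechet_le_iff hn hm)
    (hJ0 ε hε.le) (fun i hi => jumpPotential_gridDist_le hc hm hε hε1 hQ hi hε.le hL1 K)
    (fun μ hμ => hJ0 _ (by have := hε.trans_le hμ; positivity))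
    (fun μ hμ i hi => jumpPotential_gridDist_le hc hm hε hε1 hQ hi
      (by have := hε.trans_le hμ; positivity) hL1 K) (by positivity) hB
  refine ⟨T, s, hrun, ?_, h1, h2⟩
  have hlog0 : 0 ≤ Real.log (1 / ε) := Real.log_nonneg (by rw [le_div_iff₀ hε]; linarith)
  have hsparse : (n : ℝ) * ((18 * (Nat.log 2 m : ℝ) + 200) * J ε + 40) ≤ 2400 * Λ ^ 2 * X := by
    refine le_trans ?_ (hrows n ε le_rfl hε.le (Or.inr ?_))
    · have := hJ0 ε hε.le
      gcongr <;> norm_num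
    · rw [le_div_iff₀ hε]
      have : (ε + 1) * ε ≤ 48 * L ^ 2 := by nlinarith
      calc (n : ℝ) ^ 2 * (ε + 1) * ε = (n : ℝ) ^ 2 * ((ε + 1) * ε) := by ring
        _ ≤ (n : ℝ) ^ 2 * (48 * (L : ℝ) ^ 2) := by gcongr
        _ = _ := by ring
  have := total_time_le (T := T) hL1 hΛ hX1 hlog0 (logb_iterations_le hε hε1 hN2 hL)
    (min_le_left _ _) (min_mul_log_le hδ hε hε1 hN2 (by nlinarith))
    (hT.trans (by linarith))
  refine this.trans (le_of_eq ?_)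
  rw [hE, timeBound]
  ring

end
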